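/- **Setting.** There are $n\ge 1$ agents. Agent $i$ has sampled losses $f_i(x,y;\xi)$ and $g_i(x,y;\xi)$, differentiable in $(x,y)\in\mathbb R^{d_x}\times\mathbb R^{d_y}$; put $f_i(x,y)=\mathbb E f_i(x,y;\xi_{f,i})$, $g_i(x,y)=\mathbb E g_i(x,y;\xi_{g,i})$, $F=\frac1n\sum_i f_i$, $G=\frac1n\sum_i g_i$. For $\gamma>0$ and $\mu>0$ let $$V_\gamma(x,y)=\min_\theta\Big\{G(x,\theta)+\tfrac1{2\gamma}\|\theta-y\|^2\Big\},\qquad \Psi_\mu=\mu F+G-V_\gamma ,$$ and let $\theta^*_\gamma(x,y)$ be the minimizer in the definition of $V_\gamma$. Assume: 1. $F\ge\underline F$; each $f_i$ is $C^1$ with $L_1$-Lipschitz gradient and each $g_i$ is $C^1$ with $L_2$-Lipschitz gradient (jointly in $(x,y)$), where $L_1\ge 0$, $L_2>0$. 2. $\nabla f_i(x,y;\xi_{f,i})$ and $\nabla g_i(x,y;\xi_{g,i})$ are unbiased estimators of $\nabla f_i(x,y)$ and $\nabla g_i(x,y)$ with variances at most $\delta_f^2$ and $\delta_g^2$. The samples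 $\xi^k_{f,i}$ (and $\xi^k_{g,i}$) have the same law for all $k$, and the pairs $(\xi^k_{f,i},\xi^k_{g,i})$ are independent over all $k$ and $i$. 3. $W=(w_{ij})\in\mathbb R^{n\times n}$ is symmetric and doubly stochastic with nonnegative entries and eigenvalues $\lambda_1\ge\dots\ge\lambda_n$, and $\rho:=\max\{|\lambda_2|,|\lambda_n|\}<1$ ($\rho:=0$ if $n=1$). **Algorithm (SUN-DSBO-GT).** Start from deterministic $(\theta_i^0,x_i^0,y_i^0)$ and $\hat D^{-1}_{\Diamond,i}=D^{-1}_{\Diamond,i}=0$ for $\Diamond\in\{\theta,x,y\}$. For $k=0,\dots,K-1$ and all $i$ compute $$\begin{aligned}\hat D^k_{\theta,i}&=\nabla_y g_i(x_i^k,\theta_i^k;\xi^k_{g,i})+\tfrac1\gamma(\theta_i^k-y_i^k),\\ \hat D^k_{x,i}&=\mu_k\nabla_x f_i(x_i^k,y_i^k;\xi^k_{f,i})+\nabla_x g_i(x_i^k,y_i^k;\xi^k_{g,i})-\nabla_x g_i(x_i^k,\theta_i^k;\xi^k_{g,i}),\\ \hat D^k_{y,i}&=\mu_k\nabla_y f_i(x_i^k,y_i^k;\xi^k_{f,i})+\nabla_y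 g_i(x_i^k,y_i^k;\xi^k_{g,i})-\tfrac1\gamma(y_i^k-\theta_i^k),\end{aligned}$$ $D^k_{\Diamond,i}=\sum_j w_{ij}(D^{k-1}_{\Diamond,j}+\hat D^k_{\Diamond,j}-\hat D^{k-1}_{\Diamond,j})$ and $\Diamond_i^{k+1}=\sum_j w_{ij}(\Diamond_j^k-\lambda_\Diamond D^k_{\Diamond,j})$. A bar denotes the average over the agents, and $\Delta^k=\frac1n\sum_i\mathbb E\big(\|x_i^k-\bar x^k\|^2+\|y_i^k-\bar y^k\|^2+\|\theta_i^k-\bar\theta^k\|^2\big)$. **Parameters.** Let $\mu_0>0$, $p\in[0,1/4)$ (so $p=0$, a constant penalty parameter, is included), $\mu_k=\mu_0(k+1)^{-p}$, $\gamma\in(0,\frac1{2L_2})$, and $$\lambda_\theta=c_\theta n^{1/2}K^{-1/2},\qquad \lambda_x=\lambda_y=c_\lambda\lambda_\theta,\qquad c_\theta>0,\qquad 0<c_\lambda\le\frac{\frac1\gamma-L_2}{32\,a_1L_\theta^2},\qquad a_1=\frac1{2L_\theta}\sqrt{L_2^2+\tfrac1{\gamma^2}},$$ where $L_\theta>0$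 is a Lipschitz constant of $\theta^*_\gamma$. **Claim.** There is a threshold $s>0$ depending only on $L_1,L_2,\gamma,\mu_0,p,L_\theta,c_\lambda$, and a constant $A>0$ depending only on these and $c_\theta$ (in particular neither depends on $n$, $\rho$, $K$, $\delta_f$, $\delta_g$, the dimensions or the problem), such that whenever $K\ge 1$ and $\lambda_\theta\le s(1-\rho)^4$, the functions $\Psi_{\mu_k}$ are differentiable, the expectations below are finite, and $$\frac1K\sum_{k=0}^{K-1}\mathbb E\|\nabla\Psi_{\mu_k}(\bar x^k,\bar y^k)\|^2\le A\,\frac{\mathcal C_2}{\sqrt{nK}}+A\,\frac{n(\delta_f^2+\delta_g^2)}{(1-\rho)^4K},$$ $$\frac1K\sum_{k=0}^{K-1}\Delta^k\le A\,\frac{\mathcal C_2}{\sqrt K}+A\,\frac{n^{3/2}(\delta_f^2+\delta_g^2)}{(1-\rho)^4K},$$ where $$\mathcal C_2=\mu_0\big(F(\bar x^0,\bar y^0)-\underline F\big)+G(\bar x^0,\bar y^0)-V_\gamma(\bar x^0,\bar y^0)+\|\bar\theta^0-\theta^*_\gamma(\bar x^0,\bar y^0)\|^2+\Delta^0+\frac1n\sum_{i}\sum_{\Diamond\in\{\theta,x,y\}}\mathbb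 E\|D^0_{\Diamond,i}-\bar D^0_\Diamond\|^2+\delta_f^2+\delta_g^2 .$$ -/

import Mathlib

open MeasureTheory ProbabilityTheory

noncomputable section

namespace SunDSBO

/-- Euclidean space of dimension `d`. -/
abbrev Vec (d : ℕ) : Type := EuclideanSpace ℝ (Fin d)

/-- The product of two Euclidean spaces with the joint Euclidean norm
`‖(x, y)‖² = ‖x‖² + ‖y‖²`. -/
abbrev VecPair (dx dy : ℕ) : Type := WithLp 2 (Vec dx × Vec dy)

/-- The point `(x, y)` of the product space. -/
def pair {dx dy : ℕ} (x : Vec dx) (y : Vec dy) : VecPair dx dy := WithLp.toLp 2 (x, y)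

/-- The average `(1/n) ∑ i, v i` over the agents. -/
def avg {n : ℕ} {E : Type*} [AddCommGroup E] [Module ℝ E] (v : Fin n → E) : E :=
  (1 / (n : ℝ)) • ∑ i, v i

/-! ### The decentralized stochastic bilevel problem -/

/-- Data of a decentralized stochastic bilevel problem with `n` agents: agent `i` has the sampled
upper-level loss `f i (x, y) ξ`, the sampled lower-level loss `g i (x, y) ξ`, and the laws
`νf i`, `νg i` of its samples. -/
structure Problem (n dx dy : ℕ) (Ξf Ξg : Type*) [MeasurableSpace Ξf] [MeasurableSpace Ξg] where
  f : Fin n → VecPair dx dy → Ξf → ℝ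
  g : Fin n → VecPair dx dy → Ξg → ℝ
  νf : Fin n → Measure Ξf
  νg : Fin n → Measure Ξg

section Objectives

variable {n dx dy : ℕ} {Ξf Ξg : Type*} [MeasurableSpace Ξf] [MeasurableSpace Ξg]

/-- Local upper-level objective `f_i(x, y) = 𝔼 f_i(x, y; ξ)`. -/
def Problem.localF (P : Problem n dx dy Ξf Ξg) (i : Fin n) (z : VecPair dx dy) : ℝ :=
  ∫ ξ, P.f i z ξ ∂(P.νf i)

/-- Local lower-level objective `g_i(x, y) = 𝔼 g_i(x, y; ξ)`. -/
def Problem.localG (P : Problem n dx dy Ξf Ξg) (i : Fin n) (z : VecPair dx dy) : ℝ :=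
  ∫ ξ, P.g i z ξ ∂(P.νg i)

/-- Global upper-level objective `F = (1/n) ∑ i, f_i`. -/
def Problem.upper (P : Problem n dx dy Ξf Ξg) (z : VecPair dx dy) : ℝ :=
  avg fun i => P.localF i z

/-- Global lower-level objective `G = (1/n) ∑ i, g_i`. -/
def Problem.lower (P : Problem n dx dy Ξf Ξg) (z : VecPair dx dy) : ℝ :=
  avg fun i => P.localG i z

/-- The objective `θ ↦ G(x, θ) + ‖θ - y‖² / (2γ)` that defines the Moreau envelope at `(x, y)`. -/
def Problem.proxObjective (P : Problem n dx dy Ξf Ξg) (γ : ℝ) (z : VecPair dx dy) (θ : Vec dy) :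
    ℝ :=
  P.lower (pair z.fst θ) + 1 / (2 * γ) * ‖θ - z.snd‖ ^ 2

/-- The Moreau envelope `V_γ(x, y) = min_θ {G(x, θ) + ‖θ - y‖² / (2γ)}`. -/
def Problem.moreau (P : Problem n dx dy Ξf Ξg) (γ : ℝ) (z : VecPair dx dy) : ℝ :=
  ⨅ θ : Vec dy, P.proxObjective γ z θ

/-- The minimizer `θ*_γ(x, y)` in the definition of the Moreau envelope
(unique when `G` is `L₂`-smooth and `γ < 1 / (2 L₂)`). -/
def Problem.thetaStar (P : Problem n dx dy Ξf Ξg) (γ : ℝ) (z : VecPair dx dy) : Vec dy :=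
  Classical.epsilon fun θ => ∀ θ', P.proxObjective γ z θ ≤ P.proxObjective γ z θ'

/-- The penalized objective `Ψ_μ = μ F + G - V_γ`. -/
def Problem.penalized (P : Problem n dx dy Ξf Ξg) (γ μ : ℝ) (z : VecPair dx dy) : ℝ :=
  μ * P.upper z + P.lower z - P.moreau γ z

/-- Smoothness: every `f_i` is continuously differentiable with `L₁`-Lipschitz gradient, and every
`g_i` is continuously differentiable with `L₂`-Lipschitz gradient, jointly in `(x, y)`. -/
structure Problem.Smooth (P : Problem n dx dy Ξf Ξg) (L₁ L₂ : ℝ) : Prop where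
  contDiff_f : ∀ i, ContDiff ℝ 1 (P.localF i)
  contDiff_g : ∀ i, ContDiff ℝ 1 (P.localG i)
  lipschitz_f : ∀ i z z', ‖gradient (P.localF i) z - gradient (P.localF i) z'‖ ≤ L₁ * ‖z - z'‖
  lipschitz_g : ∀ i z z', ‖gradient (P.localG i) z - gradient (P.localG i) z'‖ ≤ L₂ * ‖z - z'‖

/-- Stochastic oracle: the sampled losses are integrable and differentiable in `(x, y)`, their
gradients are (jointly measurable) unbiased estimators of `∇f_i` and `∇g_i`, with variances at most
`δf²` and `δg²`. -/
structure Problem.Oracle (P : Problem n dx dy Ξf Ξg) (δf δg : ℝ) : Prop where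
  integrable_f : ∀ i z, Integrable (P.f i z) (P.νf i)
  integrable_g : ∀ i z, Integrable (P.g i z) (P.νg i)
  differentiable_f : ∀ i ξ, Differentiable ℝ fun z => P.f i z ξ
  differentiable_g : ∀ i ξ, Differentiable ℝ fun z => P.g i z ξ
  measurable_grad_f : ∀ i, Measurable fun q : VecPair dx dy × Ξf =>
    gradient (fun z => P.f i z q.2) q.1
  measurable_grad_g : ∀ i, Measurable fun q : VecPair dx dy × Ξg =>
    gradient (fun z => P.g i z q.2) q.1
  integrable_grad_f : ∀ i z, Integrable (fun ξ => gradient (fun w => P.f i w ξ) z) (P.νf i)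
  integrable_grad_g : ∀ i z, Integrable (fun ξ => gradient (fun w => P.g i w ξ) z) (P.νg i)
  unbiased_f : ∀ i z, ∫ ξ, gradient (fun w => P.f i w ξ) z ∂(P.νf i) = gradient (P.localF i) z
  unbiased_g : ∀ i z, ∫ ξ, gradient (fun w => P.g i w ξ) z ∂(P.νg i) = gradient (P.localG i) z
  integrable_sq_f : ∀ i z, Integrable
    (fun ξ => ‖gradient (P.localF i) z - gradient (fun w => P.f i w ξ) z‖ ^ 2) (P.νf i)
  integrable_sq_g : ∀ i z, Integrable
    (fun ξ => ‖gradient (P.localG i) z - gradient (fun w => P.g i w ξ) z‖ ^ 2) (P.νg i)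
  variance_f : ∀ i z,
    ∫ ξ, ‖gradient (P.localF i) z - gradient (fun w => P.f i w ξ) z‖ ^ 2 ∂(P.νf i) ≤ δf ^ 2
  variance_g : ∀ i z,
    ∫ ξ, ‖gradient (P.localG i) z - gradient (fun w => P.g i w ξ) z‖ ^ 2 ∂(P.νg i) ≤ δg ^ 2

/-- The samples `ξf k i`, `ξg k i` (iteration `k`, agent `i`): they have the laws `νf i`, `νg i`,
and the pairs `(ξf k i, ξg k i)` are independent over all iterations and agents. -/
structure Problem.Sampling (P : Problem n dx dy Ξf Ξg) {Ω : Type*} [MeasurableSpace Ω]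
    (Pr : Measure Ω) (ξf : ℕ → Fin n → Ω → Ξf) (ξg : ℕ → Fin n → Ω → Ξg) : Prop where
  law_f : ∀ k i, MeasurePreserving (ξf k i) Pr (P.νf i)
  law_g : ∀ k i, MeasurePreserving (ξg k i) Pr (P.νg i)
  indep : iIndepFun (fun (ki : ℕ × Fin n) ω => (ξf ki.1 ki.2 ω, ξg ki.1 ki.2 ω)) Pr

end Objectives

/-! ### The communication network -/

/-- The connectivity parameter `ρ = max {|λ₂|, |λₙ|}`, where `λ₁ ≥ λ₂ ≥ ⋯ ≥ λₙ` are the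
eigenvalues of the symmetric matrix `W`; for a single agent there is no `λ₂` and `ρ = 0`. -/
def connectivity {n : ℕ} (W : Matrix (Fin n) (Fin n) ℝ) (hW : W.IsHermitian) : ℝ :=
  if h : 2 ≤ n then
    max |hW.eigenvalues₀ ⟨1, by rw [Fintype.card_fin]; omega⟩|
      |hW.eigenvalues₀ ⟨n - 1, by rw [Fintype.card_fin]; omega⟩|
  else 0

/-! ### The algorithm with gradient tracking -/

/-- A triple `(θ, x, y)`: the variables of one agent, or the directions for these variables. -/
structure Triple (dx dy : ℕ) where
  θ : Vec dy
  x : Vec dx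
  y : Vec dy

/-- The state before iteration `k`: the iterates `(θ_i^k, x_i^k, y_i^k)`, the stochastic directions
`D̂_i^{k-1}` and the tracked directions `D_i^{k-1}` of all agents. -/
structure State (n dx dy : ℕ) where
  v : Fin n → Triple dx dy
  Dhat : Fin n → Triple dx dy
  D : Fin n → Triple dx dy

section Algorithm

variable {n dx dy : ℕ} {Ξf Ξg : Type*} [MeasurableSpace Ξf] [MeasurableSpace Ξg]

/-- The stochastic directions `(D̂_θ, D̂_x, D̂_y)` of agent `i` at `v = (θ, x, y)` for the samples
`a = ξ_f` and `b = ξ_g`. -/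
def Problem.direction (P : Problem n dx dy Ξf Ξg) (γ μ : ℝ) (i : Fin n) (v : Triple dx dy)
    (a : Ξf) (b : Ξg) : Triple dx dy where
  θ := (gradient (fun z => P.g i z b) (pair v.x v.θ)).snd + (1 / γ) • (v.θ - v.y)
  x := μ • (gradient (fun z => P.f i z a) (pair v.x v.y)).fst
    + (gradient (fun z => P.g i z b) (pair v.x v.y)).fst
    - (gradient (fun z => P.g i z b) (pair v.x v.θ)).fst
  y := μ • (gradient (fun z => P.f i z a) (pair v.x v.y)).snd
    + (gradient (fun z => P.g i z b) (pair v.x v.y)).snd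
    - (1 / γ) • (v.y - v.θ)

/-- The tracking update `D_i = ∑ j, w_ij (D_j^{prev} + D̂_j - D̂_j^{prev})`, where `new` holds
the current stochastic directions `D̂`. -/
def track (W : Matrix (Fin n) (Fin n) ℝ) (s : State n dx dy) (new : Fin n → Triple dx dy) :
    Fin n → Triple dx dy := fun i =>
  { θ := ∑ j, W i j • ((s.D j).θ + (new j).θ - (s.Dhat j).θ)
    x := ∑ j, W i j • ((s.D j).x + (new j).x - (s.Dhat j).x)
    y := ∑ j, W i j • ((s.D j).y + (new j).y - (s.Dhat j).y) }

/-- The variable update `v_i^{next} = ∑ j, w_ij (v_j - λ D_j)`, with learning rate `lt` for `θ`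
and `lxy` for both `x` and `y`. -/
def move (W : Matrix (Fin n) (Fin n) ℝ) (lt lxy : ℝ) (v D : Fin n → Triple dx dy) :
    Fin n → Triple dx dy := fun i =>
  { θ := ∑ j, W i j • ((v j).θ - lt • (D j).θ)
    x := ∑ j, W i j • ((v j).x - lxy • (D j).x)
    y := ∑ j, W i j • ((v j).y - lxy • (D j).y) }

/-- One iteration of SUN-DSBO-GT with penalty parameter `μ`, for the samples `a i`, `b i` of the
agents. -/
def Problem.step (P : Problem n dx dy Ξf Ξg) (W : Matrix (Fin n) (Fin n) ℝ) (γ lt lxy μ : ℝ)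
    (a : Fin n → Ξf) (b : Fin n → Ξg) (s : State n dx dy) : State n dx dy :=
  let new : Fin n → Triple dx dy := fun i => P.direction γ μ i (s.v i) (a i) (b i)
  let D : Fin n → Triple dx dy := track W s new
  { v := move W lt lxy s.v D
    Dhat := new
    D := D }

/-- The run of SUN-DSBO-GT from the initial point `init`, for the penalty parameters `μ k` and the
sample path `a k i`, `b k i`; `D̂^{-1} = D^{-1} = 0`. Its value at `k` is the state before
iteration `k`. -/
def Problem.run (P : Problem n dx dy Ξf Ξg) (W : Matrix (Fin n) (Fin n) ℝ) (γ lt lxy : ℝ)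
    (μ : ℕ → ℝ) (init : Fin n → Triple dx dy) (a : ℕ → Fin n → Ξf) (b : ℕ → Fin n → Ξg) :
    ℕ → State n dx dy
  | 0 => { v := init, Dhat := fun _ => ⟨0, 0, 0⟩, D := fun _ => ⟨0, 0, 0⟩ }
  | k + 1 => P.step W γ lt lxy (μ k) (a k) (b k) (P.run W γ lt lxy μ init a b k)

/-- The averaged primal point `(x̄, ȳ)`. -/
def meanPoint (v : Fin n → Triple dx dy) : VecPair dx dy :=
  pair (avg fun i => (v i).x) (avg fun i => (v i).y)

/-- The dispersion `(1/n) ∑ i, (‖x_i - x̄‖² + ‖y_i - ȳ‖² + ‖θ_i - θ̄‖²)` around the averages. -/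
def dispersion (v : Fin n → Triple dx dy) : ℝ :=
  avg fun i => ‖(v i).x - avg fun j => (v j).x‖ ^ 2 + ‖(v i).y - avg fun j => (v j).y‖ ^ 2
    + ‖(v i).θ - avg fun j => (v j).θ‖ ^ 2

/-- The part of the initial gap that is fixed by the initial point:
`μ₀ (F - Fl) + G - V_γ` at `(x̄⁰, ȳ⁰)`, plus `‖θ̄⁰ - θ*_γ(x̄⁰, ȳ⁰)‖²`, plus the dispersion. -/
def Problem.initialGap (P : Problem n dx dy Ξf Ξg) (γ μ₀ Fl : ℝ) (init : Fin n → Triple dx dy) :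
    ℝ :=
  (μ₀ * (P.upper (meanPoint init) - Fl) + P.lower (meanPoint init) - P.moreau γ (meanPoint init))
    + ‖(avg fun i => (init i).θ) - P.thetaStar γ (meanPoint init)‖ ^ 2
    + dispersion init

end Algorithm

/-- The penalty parameters `μ_k = μ₀ (k + 1)^{-p}`. -/
def penalty (μ₀ p : ℝ) (k : ℕ) : ℝ := μ₀ * ((k : ℝ) + 1) ^ (-p)

/-- The learning rate `λ_θ = c_θ n^{1/2} K^{-1/2}`. -/
def rate (cθ : ℝ) (n K : ℕ) : ℝ := cθ * Real.sqrt n / Real.sqrt K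

/-- The weight `a₁ = √(L₂² + 1/γ²) / (2 L_θ)`. -/
def weightA (L₂ γ Lθ : ℝ) : ℝ := 1 / (2 * Lθ) * Real.sqrt (L₂ ^ 2 + 1 / γ ^ 2)

end SunDSBO

end

namespace SunDSBO

set_option linter.unusedSectionVars false

/-! ### Averages, dispersion and mixing -/

section Averages

variable {n : ℕ} {E : Type*} [NormedAddCommGroup E] [InnerProductSpace ℝ E]

/-! On averages the algorithm is an inexact stochastic gradient method for a Lyapunov function.
Write h(z, θ) for the proximal objective, so that V_γ(z) = min_θ h(z, θ), and put Φ = μ(F − F̲) + (G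
− V_γ) + (h − V_γ). At a consensual point the mean direction is (∇_θ h, ∇Ψ − q) and the gradient of
Φ is (∇_θ h, ∇Ψ + q), with the same bias q = ∇_z h(z, θ) − ∇V_γ(z). With the (x, y) part scaled by
c_λ, their inner product is ‖∇_θ h‖² + c_λ(‖∇Ψ‖² − ‖q‖²). The bias is Lipschitz in θ − θ*, and this
distance is bounded by ‖∇_θ h‖ because γ < 1/(2L₂). The bound on c_λ lets half of ‖∇_θ h‖² pay for q
(`step_ratio`, `le_inner_gradLyap`). Hence each step lowers Φ by a multiple of λ(‖∇Ψ‖² + ‖mean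
direction‖²), up to λ times the dispersion of the iterates and λ² times the noise of the averaged
direction. Independence over the agents divides that noise by n, and a decreasing μ only lowers Φ.

The dispersions are handled by the spectral gap τ = 1 − ρ: W contracts zero-sum families by ρ
(`sum_mulVec_sq_le`). The dispersion X of the iterates is driven by λ² times the dispersion Y of the
tracked directions, and Y is driven by the increments of the stochastic directions: noise, Lipschitz
terms in the displacement, and (μ_{k+1} − μ_k)∇f_i.

The last increment is the delicate one, because no bound on the dissimilarity of the ∇f_i is
assumed. It is split into its value at the initial point and a Lipschitz remainder. The initial
value enters only through its mixed dispersion, which can be read off from D⁰: subtracting the θ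
direction from the y direction cancels the proximal terms and leaves μ₀∇f_i up to ∇g_i(x, y) −
∇g_i(x, θ), whose size is at most L₂‖y − θ‖ and is controlled by the initial gap
(`disp_mix_upperDir_le`, `initial_heterogeneity_le`). The remainder involves the squared
displacement from the start, at most k times the sum of the squared steps; this is harmless since ∑
(k + 1)(μ_{k+1} − μ_k)² ≤ μ₀² (`sum_penalty_sub_sq_le`).

Summed over k, the recursions for X, Y and Φ form a closed system (`sum_le_of_recursions`). Each of
the two contractions costs 1/τ², so X feeds back into itself with weight of order λ²/τ⁴, and λ ≤ sτ⁴
absorbs it. What remains is gap/λ, noise λσ²/n per step from the averages and λ²σ²/τ⁴ per step from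
the tracking; λ = c_θ√(n/K) turns these into the stated rates (`rate_bound`). -/

lemma avg_add (u v : Fin n → E) : (avg fun i => u i + v i) = avg u + avg v := by
  simp [avg, Finset.sum_add_distrib, smul_add]

lemma avg_sub (u v : Fin n → E) : (avg fun i => u i - v i) = avg u - avg v := by
  simp [avg, Finset.sum_sub_distrib, smul_sub]

lemma avg_smul (c : ℝ) (u : Fin n → E) : (avg fun i => c • u i) = c • avg u := by
  simp [avg, ← Finset.smul_sum, smul_comm c]

lemma map_avg {F : Type*} [AddCommGroup F] [Module ℝ F] (T : E →ₗ[ℝ] F) (u : Fin n → E) :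
    T (avg u) = avg fun i => T (u i) := by
  simp [avg, map_sum]

lemma avg_const (hn : 1 ≤ n) (c : E) : (avg fun _ : Fin n => c) = c := by
  have : (n : ℝ) ≠ 0 := by positivity
  simp only [avg, Finset.sum_const, Finset.card_univ, Fintype.card_fin, ← Nat.cast_smul_eq_nsmul ℝ,
    smul_smul]
  rw [one_div, inv_mul_cancel₀ this, one_smul]

lemma avg_mono {u v : Fin n → ℝ} (h : ∀ i, u i ≤ v i) : avg u ≤ avg v := by
  simp only [avg, smul_eq_mul]
  gcongr with i
  exact h i

lemma avg_nonneg {u : Fin n → ℝ} (h : ∀ i, 0 ≤ u i) : 0 ≤ avg u := by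
  simp only [avg, smul_eq_mul]
  exact mul_nonneg (by positivity) (Finset.sum_nonneg fun i _ => h i)

lemma avg_mul (c : ℝ) (u : Fin n → ℝ) : (avg fun i => c * u i) = c * avg u := by
  simpa using avg_smul c u

/-- Mean square of a family of vectors. -/
noncomputable def msq (u : Fin n → E) : ℝ := avg fun i => ‖u i‖ ^ 2

/-- Mean square deviation of a family of vectors from its average. -/
noncomputable def disp (u : Fin n → E) : ℝ := msq fun i => u i - avg u

lemma msq_nonneg (u : Fin n → E) : 0 ≤ msq u := avg_nonneg fun _ => by positivity

lemma disp_eq (u : Fin n → E) : disp u = avg fun i => ‖u i - avg u‖ ^ 2 := rfl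

lemma disp_nonneg (u : Fin n → E) : 0 ≤ disp u := msq_nonneg _

lemma norm_add_sq_le (a b : E) : ‖a + b‖ ^ 2 ≤ 2 * ‖a‖ ^ 2 + 2 * ‖b‖ ^ 2 := by
  have := norm_add_le a b
  nlinarith [sq_nonneg (‖a‖ - ‖b‖), norm_nonneg (a + b), norm_nonneg a, norm_nonneg b]

lemma norm_sub_sq_le (a b : E) : ‖a - b‖ ^ 2 ≤ 2 * ‖a‖ ^ 2 + 2 * ‖b‖ ^ 2 := by
  simpa [sub_eq_add_neg] using norm_add_sq_le a (-b)

lemma norm_add₃_sq_le (a b c : E) :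
    ‖a + b + c‖ ^ 2 ≤ 3 * ‖a‖ ^ 2 + 3 * ‖b‖ ^ 2 + 3 * ‖c‖ ^ 2 := by
  have := norm_add₃_le (a := a) (b := b) (c := c)
  nlinarith [sq_nonneg (‖a‖ - ‖b‖), sq_nonneg (‖a‖ - ‖c‖), sq_nonneg (‖b‖ - ‖c‖),
    norm_nonneg (a + b + c), norm_nonneg a, norm_nonneg b, norm_nonneg c]

/-- The cross term vanishes because the deviations from the average sum to zero. -/
lemma msq_eq_disp_add (hn : 1 ≤ n) (u : Fin n → E) : msq u = disp u + ‖avg u‖ ^ 2 := by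
  have h : ∀ i, ‖u i‖ ^ 2 = ‖u i - avg u‖ ^ 2 + (2 * inner ℝ (avg u) (u i - avg u) + ‖avg u‖ ^ 2) := by
    intro i
    have := norm_add_sq_real (u i - avg u) (avg u)
    rw [sub_add_cancel, real_inner_comm] at this
    linarith
  have h0 : (avg fun i => inner ℝ (avg u) (u i - avg u)) = (0 : ℝ) := by
    have := (map_avg ((innerSL ℝ (avg u)).toLinearMap) (fun i => u i - avg u)).symm
    simp only [ContinuousLinearMap.coe_coe, innerSL_apply_apply] at this
    rw [this, avg_sub, avg_const hn, sub_self, inner_zero_right]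
  unfold disp msq
  simp_rw [h]
  rw [avg_add (E := ℝ), avg_add (E := ℝ), avg_mul, h0, avg_const (E := ℝ) hn]
  ring

lemma disp_le_msq (hn : 1 ≤ n) (u : Fin n → E) : disp u ≤ msq u := by
  rw [msq_eq_disp_add hn u]; nlinarith [sq_nonneg ‖avg u‖]

lemma norm_avg_sq_le (hn : 1 ≤ n) (u : Fin n → E) : ‖avg u‖ ^ 2 ≤ msq u := by
  rw [msq_eq_disp_add hn u]; linarith [disp_nonneg u]

lemma msq_add_le (u v : Fin n → E) : msq (fun i => u i + v i) ≤ 2 * msq u + 2 * msq v := by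
  unfold msq
  rw [← avg_mul, ← avg_mul, ← avg_add (E := ℝ)]
  exact avg_mono fun i => norm_add_sq_le _ _

lemma disp_add_le (u v : Fin n → E) : disp (fun i => u i + v i) ≤ 2 * disp u + 2 * disp v := by
  have := msq_add_le (fun i => u i - avg u) (fun i => v i - avg v)
  simp only [disp, avg_add]
  convert this using 3
  exact add_sub_add_comm _ _ _ _

lemma disp_smul (c : ℝ) (u : Fin n → E) : disp (fun i => c • u i) = c ^ 2 * disp u := by
  rw [disp_eq, disp_eq, avg_smul, ← avg_mul]
  congr 1; ext i
  rw [← smul_sub, norm_smul, mul_pow, Real.norm_eq_abs, sq_abs]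

/-- Young's inequality with weights r and 1 − r. The factor 1/r on the first term is cheap when r is
close to 1, so a contraction of that term survives. -/
lemma norm_add_sq_le_div {a b : E} {r : ℝ} (hr : 0 < r) (hr1 : r < 1) :
    ‖a + b‖ ^ 2 ≤ 1 / r * ‖a‖ ^ 2 + 1 / (1 - r) * ‖b‖ ^ 2 := by
  have h1 : 0 < 1 - r := by linarith
  have : (‖a‖ + ‖b‖) ^ 2 ≤ 1 / r * ‖a‖ ^ 2 + 1 / (1 - r) * ‖b‖ ^ 2 := by
    have e : 1 / r * ‖a‖ ^ 2 + 1 / (1 - r) * ‖b‖ ^ 2 - (‖a‖ + ‖b‖) ^ 2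
        = ((1 - r) * ‖a‖ - r * ‖b‖) ^ 2 / (r * (1 - r)) := by
      field_simp; ring
    have : 0 ≤ ((1 - r) * ‖a‖ - r * ‖b‖) ^ 2 / (r * (1 - r)) := by positivity
    linarith
  exact le_trans (by gcongr; exact norm_add_le a b) this

lemma disp_add_le_div {u v : Fin n → E} {r : ℝ} (hr : 0 < r) (hr1 : r < 1) :
    disp (fun i => u i + v i) ≤ 1 / r * disp u + 1 / (1 - r) * disp v := by
  rw [disp_eq, disp_eq, disp_eq, avg_add, ← avg_mul, ← avg_mul, ← avg_add (E := ℝ)]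
  refine avg_mono fun i => ?_
  rw [show u i + v i - (avg u + avg v) = (u i - avg u) + (v i - avg v) by abel]
  exact norm_add_sq_le_div hr hr1

lemma disp_map_le {F : Type*} [NormedAddCommGroup F] [InnerProductSpace ℝ F] (T : E →ₗ[ℝ] F)
    {c : ℝ} (hT : ∀ u, ‖T u‖ ^ 2 ≤ c * ‖u‖ ^ 2) (u : Fin n → E) :
    disp (fun i => T (u i)) ≤ c * disp u := by
  rw [disp_eq, disp_eq, ← map_avg, ← avg_mul]
  refine avg_mono fun i => ?_
  rw [← map_sub]
  exact hT _

/-- Mixing of a family of vectors by a matrix. -/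
noncomputable def mix (W : Matrix (Fin n) (Fin n) ℝ) (u : Fin n → E) : Fin n → E :=
  fun i => ∑ j, W i j • u j

lemma mix_add (W : Matrix (Fin n) (Fin n) ℝ) (u v : Fin n → E) :
    mix W (fun i => u i + v i) = fun i => mix W u i + mix W v i := by
  ext i; simp [mix, smul_add, Finset.sum_add_distrib]

lemma mix_sub (W : Matrix (Fin n) (Fin n) ℝ) (u v : Fin n → E) :
    mix W (fun i => u i - v i) = fun i => mix W u i - mix W v i := by
  ext i; simp [mix, smul_sub, Finset.sum_sub_distrib]

lemma mix_smul (W : Matrix (Fin n) (Fin n) ℝ) (c : ℝ) (u : Fin n → E) :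
    mix W (fun i => c • u i) = fun i => c • mix W u i := by
  ext i; simp [mix, Finset.smul_sum, smul_comm c]

lemma map_mix {F : Type*} [AddCommGroup F] [Module ℝ F] (T : E →ₗ[ℝ] F)
    (W : Matrix (Fin n) (Fin n) ℝ) (u : Fin n → E) (i : Fin n) :
    T (mix W u i) = ∑ j, W i j • T (u j) := by
  simp [mix, map_sum]

lemma avg_mix {W : Matrix (Fin n) (Fin n) ℝ} (hW : W ∈ doublyStochastic ℝ (Fin n))
    (u : Fin n → E) : avg (mix W u) = avg u := by
  have hc := (mem_doublyStochastic_iff_sum.1 hW).2.2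
  simp only [avg, mix]
  rw [Finset.sum_comm]
  congr 1
  refine Finset.sum_congr rfl fun j _ => ?_
  rw [← Finset.sum_smul, hc, one_smul]

lemma mix_const {W : Matrix (Fin n) (Fin n) ℝ} (hW : W ∈ doublyStochastic ℝ (Fin n))
    (c : E) : mix W (fun _ => c) = fun _ => c := by
  have hc := (mem_doublyStochastic_iff_sum.1 hW).2.1
  ext i
  simp only [mix]
  rw [← Finset.sum_smul, hc, one_smul]

end Averages

/-! ### Spectral contraction of the mixing matrix on zero-sum families. -/

section Connectivity

variable {n : ℕ} {W : Matrix (Fin n) (Fin n) ℝ} (hW : W.IsHermitian)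

lemma connectivity_nonneg : 0 ≤ connectivity W hW := by
  unfold connectivity
  split_ifs
  · exact le_max_of_le_left (abs_nonneg _)
  · exact le_rfl

/-- Every eigenvalue after the first lies between λₙ and λ₂, so its absolute value is at most the
larger of theirs. -/
lemma abs_eigenvalues₀_le_connectivity (hn : 2 ≤ n) {j : Fin (Fintype.card (Fin n))}
    (hj : 1 ≤ (j : ℕ)) : |hW.eigenvalues₀ j| ≤ connectivity W hW := by
  have hjn : (j : ℕ) < n := by simpa using j.2
  unfold connectivity
  rw [dif_pos hn]
  have h1 := hW.eigenvalues₀_antitone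
    (show (⟨1, by rw [Fintype.card_fin]; omega⟩ : Fin (Fintype.card (Fin n))) ≤ j from hj)
  have h2 := hW.eigenvalues₀_antitone
    (show j ≤ (⟨n - 1, by rw [Fintype.card_fin]; omega⟩ : Fin (Fintype.card (Fin n))) by
      rw [Fin.le_def]; simp only; omega)
  rw [max_comm]
  exact abs_le_max_abs_abs h2 h1

/-- All but one of the eigenvalues are bounded by the connectivity parameter. -/
lemma exists_forall_ne_abs_eigenvalues_le (hn : 2 ≤ n) :
    ∃ i₀, ∀ i, i ≠ i₀ → |hW.eigenvalues i| ≤ connectivity W hW := by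
  let e : Fin (Fintype.card (Fin n)) ≃ Fin n := Fintype.equivOfCardEq (Fintype.card_fin _)
  have h0 : 0 < Fintype.card (Fin n) := by simp; omega
  refine ⟨e ⟨0, h0⟩, fun i hi => ?_⟩
  refine abs_eigenvalues₀_le_connectivity hW hn ?_
  by_contra hcon
  apply hi
  have : e.symm i = ⟨0, h0⟩ := by
    ext; simp only; change ¬ 1 ≤ ((e.symm i : Fin _) : ℕ) at hcon; omega
  rw [← this, Equiv.apply_symm_apply]

/-- In an orthonormal eigenbasis, every eigenvector with eigenvalue different from 1 is orthogonal
to the all-ones vector, which W fixes. Since ρ < 1, only the index i₀ escapes this, so the all-ones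
vector is a multiple of that one eigenvector and a zero-sum u has no component along it. The other
coordinates are multiplied by at most ρ in absolute value. -/
lemma sum_mulVec_sq_le (hWd : W ∈ doublyStochastic ℝ (Fin n)) (hρ : connectivity W hW < 1)
    (u : EuclideanSpace ℝ (Fin n)) (hu : ∑ i, u i = 0) :
    ∑ i, (∑ j, W i j * u j) ^ 2 ≤ connectivity W hW ^ 2 * ∑ i, u i ^ 2 := by
  obtain hn | hn := Nat.lt_or_ge n 2
  · have hz : ∀ j, u j = 0 := by
      intro j
      interval_cases n
      · exact j.elim0
      · fin_cases j; simpa using hu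
    simp [hz]
  obtain ⟨i₀, hi₀⟩ := exists_forall_ne_abs_eigenvalues_le hW hn
  set b := hW.eigenvectorBasis with hb
  let T := Matrix.toEuclideanLin W
  have hTb : ∀ i, T (b i) = hW.eigenvalues i • b i := by
    intro i
    apply (WithLp.ofLp_injective 2)
    simpa [T, Matrix.toLpLin_apply] using hW.mulVec_eigenvectorBasis i
  have hsymm : ∀ v w, inner ℝ (T v) w = inner ℝ v (T w) :=
    Matrix.isSymmetric_toEuclideanLin_iff.2 hW
  have hcoef : ∀ i v, inner ℝ (b i) (T v) = hW.eigenvalues i * inner ℝ (b i) v := by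
    intro i v
    rw [← hsymm, hTb, real_inner_smul_left]
  let one : EuclideanSpace ℝ (Fin n) := WithLp.toLp 2 fun _ => 1
  have hT1 : T one = one := by
    apply (WithLp.ofLp_injective 2)
    ext i
    simp [T, one, Matrix.toLpLin_apply, Matrix.mulVec, dotProduct,
      (mem_doublyStochastic_iff_sum.1 hWd).2.1 i]
  have hone : ∀ i, i ≠ i₀ → inner ℝ (b i) one = (0 : ℝ) := by
    intro i hi
    have h := hcoef i one
    rw [hT1] at h
    have hlt := abs_lt.1 ((hi₀ i hi).trans_lt hρ)
    have : (1 - hW.eigenvalues i) * inner ℝ (b i) one = 0 := by linarith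
    rcases mul_eq_zero.1 this with h | h
    · linarith [hlt.2]
    · exact h
  have hu1 : inner ℝ one u = (0 : ℝ) := by
    simp [PiLp.inner_apply, one, hu]
  have hsum1 : inner ℝ one u = inner ℝ one (b i₀) * inner ℝ (b i₀) u := by
    rw [← b.sum_inner_mul_inner one u]
    refine Finset.sum_eq_single i₀ (fun i _ hi => ?_) (by simp)
    rw [real_inner_comm, hone i hi, zero_mul]
  have hsum2 : ‖one‖ ^ 2 = inner ℝ (b i₀) one ^ 2 := by
    rw [← b.sum_sq_norm_inner_right one]
    rw [Finset.sum_eq_single i₀ (fun i _ hi => by simp [hone i hi]) (by simp)]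
    simp
  have hpos : 0 < ‖one‖ ^ 2 := by
    have : NeZero n := ⟨by omega⟩
    have : one ≠ 0 := fun h => by
      have := congrArg (fun v : EuclideanSpace ℝ (Fin n) => v 0) h
      simp [one] at this
    positivity
  have hu0 : inner ℝ (b i₀) u = (0 : ℝ) := by
    rw [hu1, real_inner_comm] at hsum1
    rcases mul_eq_zero.1 hsum1.symm with h | h
    · rw [h] at hsum2; simp at hsum2; simp [hsum2] at hpos
    · exact h
  have hTu : ‖T u‖ ^ 2 = ∑ i, (∑ j, W i j * u j) ^ 2 := by
    rw [EuclideanSpace.norm_sq_eq]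
    refine Finset.sum_congr rfl fun i _ => ?_
    simp [T, Matrix.toLpLin_apply, Matrix.mulVec, dotProduct]
  have hnu : ‖u‖ ^ 2 = ∑ i, u i ^ 2 := by
    rw [EuclideanSpace.norm_sq_eq]; simp
  rw [← hTu, ← hnu, ← b.sum_sq_norm_inner_right, ← b.sum_sq_norm_inner_right u, Finset.mul_sum]
  refine Finset.sum_le_sum fun i _ => ?_
  rw [hcoef, norm_mul, mul_pow]
  by_cases hi : i = i₀
  · rw [hi, hu0]; simp
  · gcongr
    exact hi₀ i hi

variable {E : Type*} [NormedAddCommGroup E] [InnerProductSpace ℝ E] [FiniteDimensional ℝ E]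

/-- Mixing contracts the dispersion. -/
lemma disp_mix_le (hn : 1 ≤ n) (hWd : W ∈ doublyStochastic ℝ (Fin n))
    (hρ : connectivity W hW < 1) (u : Fin n → E) :
    disp (mix W u) ≤ connectivity W hW ^ 2 * disp u := by
  let b := stdOrthonormalBasis ℝ E
  set v : Fin n → E := fun i => u i - avg u with hv
  have hv0 : ∑ i, v i = 0 := by
    have h : avg v = 0 := by rw [hv, avg_sub, avg_const hn, sub_self]
    rw [avg, smul_eq_zero] at h
    exact h.resolve_left (by positivity)
  have hmix : ∀ i, mix W u i - avg (mix W u) = mix W v i := by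
    intro i
    rw [avg_mix hWd, hv, mix_sub, mix_const hWd]
  simp_rw [disp_eq, hmix]
  change avg _ ≤ _ * avg fun i => ‖v i‖ ^ 2
  rw [← avg_mul]
  rw [avg, avg, smul_eq_mul, smul_eq_mul]
  refine mul_le_mul_of_nonneg_left ?_ (by positivity)
  rw [← Finset.mul_sum]
  -- Parseval in an orthonormal basis of E reduces the claim to one scalar zero-sum family per
  -- coordinate.
  have hL : ∀ w : Fin n → E, ∑ i, ‖w i‖ ^ 2 = ∑ l, ∑ i, inner ℝ (b l) (w i) ^ 2 := by
    intro w
    rw [Finset.sum_comm]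
    refine Finset.sum_congr rfl fun i _ => ?_
    rw [← b.sum_sq_norm_inner_right]
    simp
  rw [hL, hL v, Finset.mul_sum]
  refine Finset.sum_le_sum fun l _ => ?_
  have := sum_mulVec_sq_le hW hWd hρ (WithLp.toLp 2 fun i => inner ℝ (b l) (v i)) (by
    simp only
    rw [← inner_sum, hv0, inner_zero_right])
  refine le_trans (le_of_eq ?_) this
  refine Finset.sum_congr rfl fun i _ => ?_
  simp [mix, inner_sum, real_inner_smul_right]

lemma disp_mix_le_disp (hn : 1 ≤ n) (hWd : W ∈ doublyStochastic ℝ (Fin n))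
    (hρ : connectivity W hW < 1) (u : Fin n → E) : disp (mix W u) ≤ disp u := by
  have h0 := connectivity_nonneg hW
  have := disp_mix_le hW hn hWd hρ u
  exact this.trans (mul_le_of_le_one_left (disp_nonneg u) (by nlinarith))

/-- Perturbed mixing: the contraction survives an additive perturbation. -/
lemma disp_mix_add_le (hn : 1 ≤ n) (hWd : W ∈ doublyStochastic ℝ (Fin n))
    (hρ : connectivity W hW < 1) (u v : Fin n → E) :
    disp (mix W fun i => u i + v i) ≤ (1 - (1 - connectivity W hW) / 2) * disp u
      + 2 / (1 - connectivity W hW) * disp (mix W v) := by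
  set ρ := connectivity W hW with hρ'
  have h0 : 0 ≤ ρ := connectivity_nonneg hW
  -- The Young weight (1 + ρ)/2 lies strictly between ρ and 1, also when ρ = 0. From ρ² ≤ ((1 +
  -- ρ)/2)², dividing by the weight leaves the factor (1 + ρ)/2 = 1 − (1 − ρ)/2.
  have hr : 0 < (1 + ρ) / 2 := by linarith
  rw [mix_add]
  refine (disp_add_le_div (r := (1 + ρ) / 2) hr (by linarith)).trans ?_
  have h1 : 1 / ((1 + ρ) / 2) * disp (mix W u) ≤ (1 + ρ) / 2 * disp u := by
    have h2 : disp (mix W u) ≤ ((1 + ρ) / 2) ^ 2 * disp u :=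
      (disp_mix_le hW hn hWd hρ u).trans
        (mul_le_mul_of_nonneg_right (by nlinarith) (disp_nonneg u))
    calc 1 / ((1 + ρ) / 2) * disp (mix W u)
        ≤ 1 / ((1 + ρ) / 2) * (((1 + ρ) / 2) ^ 2 * disp u) := by gcongr
      _ = (1 + ρ) / 2 * disp u := by field_simp
  have e : 1 / (1 - (1 + ρ) / 2) = 2 / (1 - ρ) := by
    have : 1 - ρ ≠ 0 := by linarith
    rw [show 1 - (1 + ρ) / 2 = (1 - ρ) / 2 by ring]
    field_simp
  rw [e]
  nlinarith

end Connectivity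

end SunDSBO

namespace SunDSBO

/-! ### Products of Euclidean spaces -/

section Pair

variable {dx dy : ℕ}

@[simp] lemma pair_fst (x : Vec dx) (y : Vec dy) : (pair x y).fst = x := rfl

@[simp] lemma pair_snd (x : Vec dx) (y : Vec dy) : (pair x y).snd = y := rfl

lemma pair_eta (z : VecPair dx dy) : pair z.fst z.snd = z := rfl

lemma pair_sub (x x' : Vec dx) (y y' : Vec dy) :
    pair x y - pair x' y' = pair (x - x') (y - y') := rfl

lemma norm_sq_prod {E F : Type*} [NormedAddCommGroup E] [NormedAddCommGroup F]
    (v : WithLp 2 (E × F)) : ‖v‖ ^ 2 = ‖v.fst‖ ^ 2 + ‖v.snd‖ ^ 2 :=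
  WithLp.prod_norm_sq_eq_of_L2 v

lemma inner_prod {E F : Type*} [NormedAddCommGroup E] [NormedAddCommGroup F]
    [InnerProductSpace ℝ E] [InnerProductSpace ℝ F] (v w : WithLp 2 (E × F)) :
    inner ℝ v w = inner ℝ v.fst w.fst + inner ℝ v.snd w.snd :=
  WithLp.prod_inner_apply v w

lemma norm_fst_le' {E F : Type*} [NormedAddCommGroup E] [NormedAddCommGroup F]
    (v : WithLp 2 (E × F)) : ‖v.fst‖ ≤ ‖v‖ := by
  refine abs_le_of_sq_le_sq' ?_ (norm_nonneg v) |>.2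
  rw [norm_sq_prod v]; nlinarith [sq_nonneg ‖v.snd‖]

lemma norm_snd_le' {E F : Type*} [NormedAddCommGroup E] [NormedAddCommGroup F]
    (v : WithLp 2 (E × F)) : ‖v.snd‖ ≤ ‖v‖ := by
  refine abs_le_of_sq_le_sq' ?_ (norm_nonneg v) |>.2
  rw [norm_sq_prod v]; nlinarith [sq_nonneg ‖v.fst‖]

lemma norm_le_add_prod {E F : Type*} [NormedAddCommGroup E] [NormedAddCommGroup F]
    (v : WithLp 2 (E × F)) : ‖v‖ ≤ ‖v.fst‖ + ‖v.snd‖ := by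
  refine abs_le_of_sq_le_sq' ?_ (by positivity) |>.2
  rw [norm_sq_prod v]; nlinarith [norm_nonneg v.fst, norm_nonneg v.snd]

lemma norm_pair_sub_pair_right (x : Vec dx) (y y' : Vec dy) :
    ‖pair x y - pair x y'‖ = ‖y - y'‖ := by
  rw [pair_sub, sub_self, ← sq_eq_sq₀ (norm_nonneg _) (norm_nonneg _), norm_sq_prod]
  simp

end Pair

/-! ### Functions with Lipschitz gradient -/

/-- Quadratic bound for the first-order expansion of a function with Lipschitz gradient. -/
lemma abs_sub_inner_gradient_le {E : Type*} [NormedAddCommGroup E] [InnerProductSpace ℝ E]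
    [CompleteSpace E] {f : E → ℝ} {g : E → E} {L : ℝ} (hL : 0 ≤ L)
    (hf : ∀ x, HasGradientAt f (g x) x) (hg : ∀ x y, ‖g x - g y‖ ≤ L * ‖x - y‖) (x y : E) :
    |f y - f x - inner ℝ (g x) (y - x)| ≤ L * ‖y - x‖ ^ 2 := by
  -- Mean value inequality on the ball of radius ‖y − x‖, where the gradient varies by at most L‖y −
  -- x‖. This gives the constant L instead of the sharp L/2, which is enough here.
  have := (convex_closedBall x ‖y - x‖).norm_image_sub_le_of_norm_hasFDerivWithin_le'
    (f := f) (f' := fun w => InnerProductSpace.toDual ℝ E (g w))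
    (φ := InnerProductSpace.toDual ℝ E (g x)) (C := L * ‖y - x‖) (x := x) (y := y)
    (fun w _ => (hf w).hasFDerivAt.hasFDerivWithinAt)
    (fun w hw => by
      rw [← map_sub, LinearIsometryEquiv.norm_map]
      refine (hg w x).trans ?_
      gcongr
      simpa [dist_eq_norm] using hw)
    (by simp) (by simp [dist_eq_norm])
  rw [InnerProductSpace.toDual_apply_apply, Real.norm_eq_abs] at this
  linarith [this, sq ‖y - x‖]

/-- A function with a quadratic first-order expansion at `x` has a gradient there. -/
lemma hasGradientAt_of_abs_le {E : Type*} [NormedAddCommGroup E] [InnerProductSpace ℝ E]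
    [CompleteSpace E] {f : E → ℝ} {g x : E} {C : ℝ}
    (h : ∀ y, |f y - f x - inner ℝ g (y - x)| ≤ C * ‖y - x‖ ^ 2) : HasGradientAt f g x := by
  rw [hasGradientAt_iff_isLittleO]
  refine Asymptotics.IsBigO.trans_isLittleO (g := fun y => ‖y - x‖ ^ 2) ?_ ?_
  · exact Asymptotics.IsBigO.of_bound C (Filter.Eventually.of_forall fun y => by
      simpa using h y)
  · have := (Asymptotics.isLittleO_norm_pow_id (E' := E) one_lt_two).comp_tendsto
      (show Filter.Tendsto (fun y => y - x) (nhds x) (nhds 0) by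
        simpa using (continuous_sub_right x).tendsto x)
    exact this

/-! ### The lower-level proximal problem -/

section Prox

variable {n dx dy : ℕ} {Ξf Ξg : Type*} [MeasurableSpace Ξf] [MeasurableSpace Ξg]
  {P : Problem n dx dy Ξf Ξg} {L₁ L₂ γ Lθ : ℝ}

/-- The gradient of the upper-level objective. -/
noncomputable def Problem.gradF (P : Problem n dx dy Ξf Ξg) (z : VecPair dx dy) : VecPair dx dy :=
  avg fun i => gradient (P.localF i) z

/-- The gradient of the lower-level objective. -/
noncomputable def Problem.gradG (P : Problem n dx dy Ξf Ξg) (z : VecPair dx dy) : VecPair dx dy :=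
  avg fun i => gradient (P.localG i) z

lemma hasGradientAt_avg {E : Type*} [NormedAddCommGroup E] [InnerProductSpace ℝ E]
    [CompleteSpace E] {f : Fin n → E → ℝ} {g : Fin n → E} {x : E}
    (h : ∀ i, HasGradientAt (f i) (g i) x) :
    HasGradientAt (fun z => avg fun i => f i z) (avg g) x := by
  rw [hasGradientAt_iff_hasFDerivAt]
  have := (HasFDerivAt.fun_sum (u := Finset.univ)
    fun i _ => (h i).hasFDerivAt).const_smul (1 / (n : ℝ))
  refine this.congr_fderiv ?_
  simp [avg, map_sum]

lemma norm_avg_sub_le (hn : 1 ≤ n) {E : Type*} [NormedAddCommGroup E] [InnerProductSpace ℝ E]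
    {u v : Fin n → E} {c : ℝ} (h : ∀ i, ‖u i - v i‖ ≤ c) : ‖avg u - avg v‖ ≤ c := by
  have h0 : (0 : ℝ) < n := by positivity
  rw [← avg_sub, avg, norm_smul, Real.norm_eq_abs, abs_of_nonneg (by positivity)]
  calc 1 / (n : ℝ) * ‖∑ i, (u i - v i)‖ ≤ 1 / (n : ℝ) * ∑ _i : Fin n, c := by
        gcongr
        exact norm_sum_le_of_le _ fun i _ => h i
    _ = c := by simp; field_simp

lemma Problem.Smooth.hasGradientAt_upper (hS : P.Smooth L₁ L₂) (z : VecPair dx dy) :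
    HasGradientAt P.upper (P.gradF z) z :=
  hasGradientAt_avg fun i =>
    ((hS.contDiff_f i).differentiable one_ne_zero z).hasGradientAt

lemma Problem.Smooth.hasGradientAt_lower (hS : P.Smooth L₁ L₂) (z : VecPair dx dy) :
    HasGradientAt P.lower (P.gradG z) z :=
  hasGradientAt_avg fun i =>
    ((hS.contDiff_g i).differentiable one_ne_zero z).hasGradientAt

lemma Problem.Smooth.gradF_lipschitz (hS : P.Smooth L₁ L₂) (hn : 1 ≤ n) (z z' : VecPair dx dy) :
    ‖P.gradF z - P.gradF z'‖ ≤ L₁ * ‖z - z'‖ :=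
  norm_avg_sub_le hn fun i => hS.lipschitz_f i z z'

lemma Problem.Smooth.gradG_lipschitz (hS : P.Smooth L₁ L₂) (hn : 1 ≤ n) (z z' : VecPair dx dy) :
    ‖P.gradG z - P.gradG z'‖ ≤ L₂ * ‖z - z'‖ :=
  norm_avg_sub_le hn fun i => hS.lipschitz_g i z z'

/-- The partial gradient of the proximal objective with respect to `θ`. -/
noncomputable def Problem.proxGrad (P : Problem n dx dy Ξf Ξg) (γ : ℝ) (z : VecPair dx dy)
    (θ : Vec dy) : Vec dy :=
  (P.gradG (pair z.fst θ)).snd + (1 / γ) • (θ - z.snd)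

/-- The partial gradient of the proximal objective with respect to `(x, y)`. -/
noncomputable def Problem.proxGradParam (P : Problem n dx dy Ξf Ξg) (γ : ℝ) (z : VecPair dx dy)
    (θ : Vec dy) : VecPair dx dy :=
  pair (P.gradG (pair z.fst θ)).fst ((1 / γ) • (z.snd - θ))

variable (hS : P.Smooth L₁ L₂) (hn : 1 ≤ n) (hL₂ : 0 < L₂) (hγ : 0 < γ)
  (hγ' : γ < 1 / (2 * L₂))

include hS hn hL₂ hγ

/-- First-order expansion of the proximal objective, jointly in all variables. -/
lemma proxObjective_expansion (z z' : VecPair dx dy) (θ θ' : Vec dy) :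
    |P.proxObjective γ z' θ' - P.proxObjective γ z θ
      - inner ℝ (P.proxGrad γ z θ) (θ' - θ) - inner ℝ (P.proxGradParam γ z θ) (z' - z)
      - 1 / (2 * γ) * ‖(θ' - θ) - (z'.snd - z.snd)‖ ^ 2|
      ≤ L₂ * (‖z'.fst - z.fst‖ ^ 2 + ‖θ' - θ‖ ^ 2) := by
  have h := abs_sub_inner_gradient_le hL₂.le hS.hasGradientAt_lower
    (hS.gradG_lipschitz hn) (pair z.fst θ) (pair z'.fst θ')
  rw [pair_sub, norm_sq_prod, inner_prod] at h
  simp only [pair_fst, pair_snd] at h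
  convert h using 2
  -- The quadratic part equals its own second-order expansion, so only G contributes an error,
  -- through the displacement of (x, θ).
  have e : ‖θ' - z'.snd‖ ^ 2 = ‖θ - z.snd‖ ^ 2 + 2 * inner ℝ (θ - z.snd) ((θ' - θ) - (z'.snd - z.snd))
      + ‖(θ' - θ) - (z'.snd - z.snd)‖ ^ 2 := by
    rw [← norm_add_sq_real]; congr 2; abel
  have e2 : inner ℝ (P.proxGradParam γ z θ) (z' - z)
      = inner ℝ (P.gradG (pair z.fst θ)).fst (z'.fst - z.fst)
        + 1 / γ * inner ℝ (z.snd - θ) (z'.snd - z.snd) := by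
    rw [inner_prod]
    simp [Problem.proxGradParam, real_inner_smul_left]
  have e3 : inner ℝ (z.snd - θ) (z'.snd - z.snd) = - inner ℝ (θ - z.snd) (z'.snd - z.snd) := by
    rw [← inner_neg_left, neg_sub]
  rw [e2, e3]
  simp only [Problem.proxObjective, Problem.proxGrad, e, inner_add_left, real_inner_smul_left]
  rw [inner_sub_right (θ - z.snd) (θ' - θ)]
  field_simp
  ring

/-- A substitute for strong convexity in θ: the quadratic term outweighs the curvature of G, and the
modulus 1/(2γ) − L₂ is positive by `half_inv_sub_pos`. -/
lemma proxObjective_ge (z : VecPair dx dy) (θ θ' : Vec dy) :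
    P.proxObjective γ z θ + inner ℝ (P.proxGrad γ z θ) (θ' - θ)
      + (1 / (2 * γ) - L₂) * ‖θ' - θ‖ ^ 2 ≤ P.proxObjective γ z θ' := by
  have h := (abs_le.1 (proxObjective_expansion hS hn hL₂ hγ z z θ θ')).1
  simp only [sub_self, inner_zero_right, norm_zero, sub_zero] at h
  nlinarith

lemma proxObjective_le (z : VecPair dx dy) (θ θ' : Vec dy) :
    P.proxObjective γ z θ' ≤ P.proxObjective γ z θ + inner ℝ (P.proxGrad γ z θ) (θ' - θ)
      + (1 / (2 * γ) + L₂) * ‖θ' - θ‖ ^ 2 := by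
  have h := (abs_le.1 (proxObjective_expansion hS hn hL₂ hγ z z θ θ')).2
  simp only [sub_self, inner_zero_right, norm_zero, sub_zero] at h
  nlinarith

include hγ'

omit hS hn in
lemma half_inv_sub_pos : 0 < 1 / (2 * γ) - L₂ := by
  rw [lt_div_iff₀ (by positivity)] at hγ'
  rw [sub_pos, lt_div_iff₀ (by positivity)]
  linarith

/-- The lower bound `proxObjective_ge` at θ = 0 makes the continuous objective grow quadratically,
hence coercive. -/
lemma exists_forall_proxObjective_le (z : VecPair dx dy) :
    ∃ θ, ∀ θ', P.proxObjective γ z θ ≤ P.proxObjective γ z θ' := by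
  have hm := half_inv_sub_pos hL₂ hγ hγ'
  set m := 1 / (2 * γ) - L₂
  have hcont : Continuous (P.proxObjective γ z) := by
    have hG : Continuous P.lower := continuous_iff_continuousAt.2 fun w =>
      (hS.hasGradientAt_lower w).continuousAt
    have hp : Continuous fun θ : Vec dy => pair z.fst θ := by
      unfold pair; fun_prop
    unfold Problem.proxObjective
    exact (hG.comp hp).add (by fun_prop)
  refine hcont.exists_forall_le ?_
  set a := ‖P.proxGrad γ z 0‖
  refine Filter.tendsto_atTop_mono (f := fun θ : Vec dy =>
    P.proxObjective γ z 0 + ‖θ‖ * (m * ‖θ‖ - a)) (fun θ => ?_) ?_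
  · have h := proxObjective_ge hS hn hL₂ hγ z 0 θ
    have h2 := neg_le_of_abs_le (abs_real_inner_le_norm (P.proxGrad γ z 0) (θ - 0))
    rw [sub_zero] at h h2
    nlinarith
  · have ht := tendsto_norm_cocompact_atTop (E := Vec dy)
    refine Filter.tendsto_atTop_add_const_left _ _ (ht.atTop_mul_atTop₀ ?_)
    exact Filter.tendsto_atTop_add_const_right _ _ (ht.const_mul_atTop hm)

lemma thetaStar_le (z : VecPair dx dy) (θ : Vec dy) :
    P.proxObjective γ z (P.thetaStar γ z) ≤ P.proxObjective γ z θ :=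
  Classical.epsilon_spec (exists_forall_proxObjective_le hS hn hL₂ hγ hγ' z) θ

lemma moreau_eq (z : VecPair dx dy) :
    P.moreau γ z = P.proxObjective γ z (P.thetaStar γ z) := by
  refine le_antisymm (ciInf_le ⟨P.proxObjective γ z (P.thetaStar γ z), ?_⟩ _)
    (le_ciInf fun θ => thetaStar_le hS hn hL₂ hγ hγ' z θ)
  rintro _ ⟨θ, rfl⟩
  exact thetaStar_le hS hn hL₂ hγ hγ' z θ

lemma moreau_le (z : VecPair dx dy) (θ : Vec dy) : P.moreau γ z ≤ P.proxObjective γ z θ := by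
  rw [moreau_eq hS hn hL₂ hγ hγ']; exact thetaStar_le hS hn hL₂ hγ hγ' z θ

/-- First-order optimality of the proximal point. -/
lemma proxGrad_thetaStar (z : VecPair dx dy) : P.proxGrad γ z (P.thetaStar γ z) = 0 := by
  set g := P.proxGrad γ z (P.thetaStar γ z)
  set C := 1 / (2 * γ) + L₂
  have hC : 0 < C := by positivity
  -- A gradient step of length 1/(2C) from the minimizer would lower the objective by ‖g‖²/(4C),
  -- which forces g = 0.
  have h1 := proxObjective_le hS hn hL₂ hγ z (P.thetaStar γ z)
    (P.thetaStar γ z - (1 / (2 * C)) • g)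
  have h2 := thetaStar_le hS hn hL₂ hγ hγ' z (P.thetaStar γ z - (1 / (2 * C)) • g)
  rw [sub_sub_cancel_left, inner_neg_right, real_inner_smul_right, real_inner_self_eq_norm_sq,
    norm_neg, norm_smul, mul_pow, Real.norm_eq_abs, sq_abs] at h1
  have h3 : (1 / (4 * C)) * ‖g‖ ^ 2 ≤ 0 := by
    have : C * ((1 / (2 * C)) ^ 2 * ‖g‖ ^ 2) = (1 / (4 * C)) * ‖g‖ ^ 2 := by
      field_simp; ring
    have h4 : 1 / (2 * C) * ‖g‖ ^ 2 = 2 * ((1 / (4 * C)) * ‖g‖ ^ 2) := by field_simp; ring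
    change _ ≤ _ + - (1 / (2 * C) * ‖g‖ ^ 2) + C * _ at h1
    linarith
  have h5 : ‖g‖ ^ 2 ≤ 0 := by
    by_contra hcon
    push Not at hcon
    have : 0 < (1 / (4 * C)) * ‖g‖ ^ 2 := by positivity
    linarith
  exact norm_eq_zero.1 (pow_eq_zero_iff two_ne_zero |>.1 (le_antisymm h5 (by positivity)))

lemma sq_norm_sub_thetaStar_le (z : VecPair dx dy) (θ : Vec dy) :
    (1 / (2 * γ) - L₂) * ‖θ - P.thetaStar γ z‖ ^ 2 ≤ P.proxObjective γ z θ - P.moreau γ z := by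
  have h := proxObjective_ge hS hn hL₂ hγ z (P.thetaStar γ z) θ
  rw [proxGrad_thetaStar hS hn hL₂ hγ hγ', inner_zero_left, ← moreau_eq hS hn hL₂ hγ hγ'] at h
  linarith

lemma proxObjective_sub_moreau_le (z : VecPair dx dy) (θ : Vec dy) :
    P.proxObjective γ z θ - P.moreau γ z ≤ (1 / (2 * γ) + L₂) * ‖θ - P.thetaStar γ z‖ ^ 2 := by
  have h := proxObjective_le hS hn hL₂ hγ z (P.thetaStar γ z) θ
  rw [proxGrad_thetaStar hS hn hL₂ hγ hγ', inner_zero_left, ← moreau_eq hS hn hL₂ hγ hγ'] at h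
  linarith

omit hS hn hL₂ hγ hγ' in
lemma proxObjective_snd (z : VecPair dx dy) : P.proxObjective γ z z.snd = P.lower z := by
  simp [Problem.proxObjective, pair_eta]

/-- Error bound: the partial gradient controls the distance to the proximal point. -/
lemma mul_norm_sub_thetaStar_le_norm_proxGrad (z : VecPair dx dy) (θ : Vec dy) :
    (1 / γ - L₂) * ‖θ - P.thetaStar γ z‖ ≤ ‖P.proxGrad γ z θ‖ := by
  set e := θ - P.thetaStar γ z with he
  -- Subtracting the vanishing gradient at the proximal point leaves a linear part with factor 1/γ
  -- and a difference of gradients of G, which takes away at most L₂.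
  have h1 : P.proxGrad γ z θ = ((P.gradG (pair z.fst θ)).snd
      - (P.gradG (pair z.fst (P.thetaStar γ z))).snd) + (1 / γ) • e := by
    have h0 := proxGrad_thetaStar hS hn hL₂ hγ hγ' z
    rw [← sub_zero (P.proxGrad γ z θ), ← h0]
    simp only [Problem.proxGrad, he, smul_sub]
    abel
  have h2 : ‖(P.gradG (pair z.fst θ)).snd - (P.gradG (pair z.fst (P.thetaStar γ z))).snd‖
      ≤ L₂ * ‖e‖ := by
    have := hS.gradG_lipschitz hn (pair z.fst θ) (pair z.fst (P.thetaStar γ z))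
    rw [norm_pair_sub_pair_right] at this
    exact (norm_snd_le' (P.gradG (pair z.fst θ) - P.gradG (pair z.fst (P.thetaStar γ z)))).trans this
  have h3 : ‖(1 / γ) • e‖ = 1 / γ * ‖e‖ := by
    rw [norm_smul, Real.norm_eq_abs, abs_of_pos (by positivity)]
  rw [h1]
  have h4 := norm_sub_norm_le ((1 / γ) • e) (-((P.gradG (pair z.fst θ)).snd
      - (P.gradG (pair z.fst (P.thetaStar γ z))).snd))
  rw [norm_neg, sub_neg_eq_add, add_comm ((1 / γ) • e)] at h4
  linarith

/-! ### The Moreau envelope -/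

/-- The gradient of the Moreau envelope. -/
noncomputable def Problem.gradV (P : Problem n dx dy Ξf Ξg) (γ : ℝ) (z : VecPair dx dy) :
    VecPair dx dy :=
  P.proxGradParam γ z (P.thetaStar γ z)

omit hL₂ hγ hγ' in
lemma norm_proxGradParam_sub_le (z : VecPair dx dy) (θ θ' : Vec dy) :
    ‖P.proxGradParam γ z θ - P.proxGradParam γ z θ'‖ ^ 2
      ≤ (L₂ ^ 2 + 1 / γ ^ 2) * ‖θ - θ'‖ ^ 2 := by
  rw [norm_sq_prod, add_mul]
  refine add_le_add ?_ ?_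
  · rw [← mul_pow]
    refine pow_le_pow_left₀ (norm_nonneg _) ?_ 2
    have := hS.gradG_lipschitz hn (pair z.fst θ) (pair z.fst θ')
    rw [norm_pair_sub_pair_right] at this
    exact (norm_fst_le' (P.gradG (pair z.fst θ) - P.gradG (pair z.fst θ'))).trans this
  · simp only [Problem.proxGradParam, WithLp.sub_snd, pair_snd]
    rw [← smul_sub, sub_sub_sub_cancel_left, norm_smul, mul_pow, norm_sub_rev, Real.norm_eq_abs,
      sq_abs, div_pow, one_pow]

variable (hLθ : 0 < Lθ)
  (hθ : ∀ z z', ‖P.thetaStar γ z - P.thetaStar γ z'‖ ≤ Lθ * ‖z - z'‖)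

include hLθ hθ

/-- First-order expansion of the Moreau envelope. -/
lemma abs_moreau_expansion_le (z z' : VecPair dx dy) :
    |P.moreau γ z' - P.moreau γ z - inner ℝ (P.gradV γ z) (z' - z)|
      ≤ (L₂ + 1 / γ + Real.sqrt (L₂ ^ 2 + 1 / γ ^ 2) * Lθ) * ‖z' - z‖ ^ 2 := by
  have hz := norm_sq_prod (z' - z)
  simp only [WithLp.sub_fst, WithLp.sub_snd] at hz
  have hx0 := sq_nonneg ‖z'.fst - z.fst‖
  have hy0 := sq_nonneg ‖z'.snd - z.snd‖
  have hγ2 : 1 / (2 * γ) ≤ 1 / γ := by gcongr; linarith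
  have hγ0 : 0 < 1 / (2 * γ) := by positivity
  set Q := Real.sqrt (L₂ ^ 2 + 1 / γ ^ 2)
  have hQ : 0 ≤ Q := Real.sqrt_nonneg _
  rw [abs_le]
  constructor
  -- Lower bound: θ*(z') is a competitor in V_γ(z). The resulting first-order term is taken at
  -- θ*(z') instead of θ*(z); the Lipschitz bounds on the gradient and on θ* make the discrepancy
  -- quadratic in ‖z' − z‖.
  · have h1 := (abs_le.1 (proxObjective_expansion hS hn hL₂ hγ z z' (P.thetaStar γ z')
      (P.thetaStar γ z'))).1
    rw [sub_self, inner_zero_right, norm_zero, zero_sub, norm_neg, sub_zero] at h1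
    have h2 := moreau_le hS hn hL₂ hγ hγ' z (P.thetaStar γ z')
    rw [← moreau_eq hS hn hL₂ hγ hγ' z'] at h1
    have h3 : |inner ℝ (P.gradV γ z - P.proxGradParam γ z (P.thetaStar γ z')) (z' - z)|
        ≤ Q * Lθ * ‖z' - z‖ ^ 2 := by
      refine (abs_real_inner_le_norm _ _).trans ?_
      have h4 := norm_proxGradParam_sub_le (γ := γ) hS hn z (P.thetaStar γ z) (P.thetaStar γ z')
      have h5 : ‖P.gradV γ z - P.proxGradParam γ z (P.thetaStar γ z')‖ ≤ Q * (Lθ * ‖z' - z‖) := by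
        refine (abs_le_of_sq_le_sq' (b := Q * ‖P.thetaStar γ z - P.thetaStar γ z'‖) ?_
          (by positivity)).2.trans ?_
        · rwa [mul_pow, Real.sq_sqrt (by positivity)]
        · rw [norm_sub_rev z' z]; gcongr; exact hθ z z'
      nlinarith [norm_nonneg (z' - z)]
    rw [inner_sub_left] at h3
    have h6 := (abs_le.1 h3).2
    have h7 : 0 ≤ 1 / (2 * γ) * ‖z'.snd - z.snd‖ ^ 2 := by positivity
    have h8 : 0 ≤ 1 / γ * ‖z' - z‖ ^ 2 := by positivity
    nlinarith
  -- Upper bound: θ*(z) is a competitor in V_γ(z'), and the first-order term is already taken at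
  -- θ*(z).
  · have h1 := (abs_le.1 (proxObjective_expansion hS hn hL₂ hγ z z' (P.thetaStar γ z)
      (P.thetaStar γ z))).2
    rw [sub_self, inner_zero_right, norm_zero, zero_sub, norm_neg, sub_zero] at h1
    have h2 := moreau_le hS hn hL₂ hγ hγ' z' (P.thetaStar γ z)
    rw [← moreau_eq hS hn hL₂ hγ hγ' z] at h1
    have h7 : 1 / (2 * γ) * ‖z'.snd - z.snd‖ ^ 2 ≤ 1 / γ * ‖z' - z‖ ^ 2 := by
      rw [hz]; gcongr; linarith
    have h8 : 0 ≤ Q * Lθ * ‖z' - z‖ ^ 2 := by positivity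
    have h9 : L₂ * ‖z'.fst - z.fst‖ ^ 2 ≤ L₂ * ‖z' - z‖ ^ 2 := by rw [hz]; gcongr; linarith
    change P.moreau γ z' - P.moreau γ z - inner ℝ (P.proxGradParam γ z (P.thetaStar γ z)) (z' - z) ≤ _
    linarith

lemma hasGradientAt_moreau (z : VecPair dx dy) :
    HasGradientAt (P.moreau γ) (P.gradV γ z) z :=
  hasGradientAt_of_abs_le fun z' => abs_moreau_expansion_le hS hn hL₂ hγ hγ' hLθ hθ z z'

lemma hasGradientAt_penalized (μ : ℝ) (z : VecPair dx dy) :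
    HasGradientAt (P.penalized γ μ) (μ • P.gradF z + P.gradG z - P.gradV γ z) z := by
  rw [hasGradientAt_iff_hasFDerivAt]
  refine ((((hS.hasGradientAt_upper z).hasFDerivAt.const_mul μ).add
    (hS.hasGradientAt_lower z).hasFDerivAt).sub
    (hasGradientAt_moreau hS hn hL₂ hγ hγ' hLθ hθ z).hasFDerivAt).congr_fderiv ?_
  simp

omit hLθ in
/-- The Lipschitz constant of the proximal map cannot be small, unless there is no `y`. -/
lemma one_le_mul_lipschitz [Nontrivial (Vec dy)] : 1 ≤ 3 / 2 * Lθ := by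
  obtain ⟨y, y', hy⟩ := exists_pair_ne (Vec dy)
  let z : VecPair dx dy := pair 0 y
  let z' : VecPair dx dy := pair 0 y'
  have h1 := proxGrad_thetaStar hS hn hL₂ hγ hγ' z
  have h2 := proxGrad_thetaStar hS hn hL₂ hγ hγ' z'
  set t := P.thetaStar γ z
  set t' := P.thetaStar γ z'
  -- Optimality reads y = θ* + γ∇_y G(x, θ*). With x fixed, y is thus a (1 + γL₂)-Lipschitz function
  -- of θ*, and 1 + γL₂ ≤ 3/2, so θ* cannot contract y by more than this factor.
  have h3 : y - y' = (t - t') + γ • ((P.gradG (pair 0 t)).snd - (P.gradG (pair 0 t')).snd) := by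
    have h4 : ∀ (s w g : Vec dy), g + (1 / γ) • (s - w) = 0 → w = s + γ • g := by
      intro s w g h
      have : g = - ((1 / γ) • (s - w)) := eq_neg_of_add_eq_zero_left h
      rw [this, smul_neg, smul_smul, mul_one_div_cancel hγ.ne', one_smul]
      abel
    have e1 := h4 t y _ h1
    have e2 := h4 t' y' _ h2
    simp only [z, z', pair_fst] at e1 e2
    conv_lhs => rw [e1, e2]
    rw [smul_sub]
    abel
  have h5 : ‖(P.gradG (pair 0 t)).snd - (P.gradG (pair 0 t')).snd‖ ≤ L₂ * ‖t - t'‖ := by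
    have := hS.gradG_lipschitz hn (pair 0 t) (pair 0 t')
    rw [norm_pair_sub_pair_right] at this
    exact (norm_snd_le' (P.gradG (pair 0 t) - P.gradG (pair 0 t'))).trans this
  have h6 : ‖t - t'‖ ≤ Lθ * ‖y - y'‖ := by
    have := hθ z z'
    rwa [norm_pair_sub_pair_right] at this
  have h7 : ‖y - y'‖ ≤ ‖t - t'‖ + γ * (L₂ * ‖t - t'‖) := by
    rw [h3]
    refine (norm_add_le _ _).trans ?_
    rw [norm_smul, Real.norm_eq_abs, abs_of_pos hγ]
    gcongr
  have h8 : γ * L₂ ≤ 1 / 2 := by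
    rw [lt_div_iff₀ (by positivity)] at hγ'
    linarith
  have hpos : 0 < ‖y - y'‖ := norm_pos_iff.2 (sub_ne_zero.2 hy)
  have h9 : ‖y - y'‖ ≤ 3 / 2 * Lθ * ‖y - y'‖ := by
    nlinarith [norm_nonneg (t - t')]
  nlinarith

end Prox

end SunDSBO

namespace SunDSBO

/-! ### Directions on the joint space -/

/-- The joint space of `(θ, (x, y))` with the Euclidean norm. -/
abbrev Joint (dx dy : ℕ) : Type := WithLp 2 (Vec dy × VecPair dx dy)

section Joint

variable {n dx dy : ℕ}

/-- The upper-level part of the direction at `v`, for the gradient field `φ`. -/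
noncomputable def upperDir (φ : VecPair dx dy → VecPair dx dy) (v : Joint dx dy) : Joint dx dy :=
  WithLp.toLp 2 (0, φ v.snd)

/-- The lower-level part of the direction at `v`, for the gradient field `ψ`. -/
noncomputable def lowerDir (γ : ℝ) (ψ : VecPair dx dy → VecPair dx dy) (v : Joint dx dy) :
    Joint dx dy :=
  WithLp.toLp 2 ((ψ (pair v.snd.fst v.fst)).snd + (1 / γ) • (v.fst - v.snd.snd),
    pair ((ψ v.snd).fst - (ψ (pair v.snd.fst v.fst)).fst)
      ((ψ v.snd).snd - (1 / γ) • (v.snd.snd - v.fst)))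

@[simp] lemma upperDir_fst (φ : VecPair dx dy → VecPair dx dy) (v : Joint dx dy) :
    (upperDir φ v).fst = 0 := rfl

@[simp] lemma upperDir_snd (φ : VecPair dx dy → VecPair dx dy) (v : Joint dx dy) :
    (upperDir φ v).snd = φ v.snd := rfl

lemma lowerDir_fst (γ : ℝ) (ψ : VecPair dx dy → VecPair dx dy) (v : Joint dx dy) :
    (lowerDir γ ψ v).fst
      = (ψ (pair v.snd.fst v.fst)).snd + (1 / γ) • (v.fst - v.snd.snd) := rfl

lemma lowerDir_snd_fst (γ : ℝ) (ψ : VecPair dx dy → VecPair dx dy) (v : Joint dx dy) :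
    (lowerDir γ ψ v).snd.fst = (ψ v.snd).fst - (ψ (pair v.snd.fst v.fst)).fst := rfl

lemma lowerDir_snd_snd (γ : ℝ) (ψ : VecPair dx dy → VecPair dx dy) (v : Joint dx dy) :
    (lowerDir γ ψ v).snd.snd = (ψ v.snd).snd - (1 / γ) • (v.snd.snd - v.fst) := rfl

/-- Scaling of the `(x, y)` part. -/
noncomputable def scale (c : ℝ) : Joint dx dy →ₗ[ℝ] Joint dx dy where
  toFun v := WithLp.toLp 2 (v.fst, c • v.snd)
  map_add' v w := by
    apply WithLp.ofLp_injective 2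
    ext1 <;> simp
  map_smul' r v := by
    apply WithLp.ofLp_injective 2
    ext1
    · simp
    · simp [smul_comm c r]

@[simp] lemma scale_fst (c : ℝ) (v : Joint dx dy) : (scale c v).fst = v.fst := rfl

@[simp] lemma scale_snd (c : ℝ) (v : Joint dx dy) : (scale c v).snd = c • v.snd := rfl

lemma norm_scale_sq_le {c : ℝ} (hc : 0 ≤ c) (v : Joint dx dy) :
    ‖scale c v‖ ^ 2 ≤ (1 + c) ^ 2 * ‖v‖ ^ 2 := by
  rw [norm_sq_prod, norm_sq_prod v, scale_fst, scale_snd, norm_smul, mul_pow, Real.norm_eq_abs,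
    sq_abs]
  nlinarith [sq_nonneg ‖v.fst‖, sq_nonneg ‖v.snd‖, mul_nonneg hc (sq_nonneg ‖v.fst‖),
    mul_nonneg hc (sq_nonneg ‖v.snd‖), mul_nonneg (sq_nonneg c) (sq_nonneg ‖v.fst‖)]

lemma norm_scale_le {c : ℝ} (hc : 0 ≤ c) (v : Joint dx dy) : ‖scale c v‖ ≤ (1 + c) * ‖v‖ := by
  refine (abs_le_of_sq_le_sq' ?_ (by positivity)).2
  rw [mul_pow]
  exact norm_scale_sq_le hc v

lemma norm_pair_fst_sub_le (v w : Joint dx dy) :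
    ‖pair v.snd.fst v.fst - pair w.snd.fst w.fst‖ ≤ ‖v - w‖ := by
  refine (abs_le_of_sq_le_sq' ?_ (norm_nonneg _)).2
  rw [norm_sq_prod, norm_sq_prod (v - w), norm_sq_prod (v - w).snd]
  simp only [pair_sub, pair_fst, pair_snd, WithLp.sub_fst, WithLp.sub_snd]
  nlinarith [sq_nonneg ‖v.snd.snd - w.snd.snd‖]

lemma upperDir_lipschitz {φ : VecPair dx dy → VecPair dx dy} {L : ℝ} (hL : 0 ≤ L)
    (h : ∀ z z', ‖φ z - φ z'‖ ≤ L * ‖z - z'‖) (v w : Joint dx dy) :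
    ‖upperDir φ v - upperDir φ w‖ ≤ L * ‖v - w‖ := by
  refine (norm_le_add_prod _).trans ?_
  simp only [WithLp.sub_fst, WithLp.sub_snd, upperDir_fst, upperDir_snd, sub_self, norm_zero, zero_add]
  refine (h _ _).trans ?_
  gcongr
  exact norm_snd_le' (v - w)

/-- The norm is bounded by the sum of the norms of the three blocks. Together they contain four
increments of ψ and two proximal terms, each of which varies by at most 2/γ times the displacement.
-/
lemma lowerDir_lipschitz {ψ : VecPair dx dy → VecPair dx dy} {γ L : ℝ} (hγ : 0 < γ) (hL : 0 ≤ L)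
    (h : ∀ z z', ‖ψ z - ψ z'‖ ≤ L * ‖z - z'‖) (v w : Joint dx dy) :
    ‖lowerDir γ ψ v - lowerDir γ ψ w‖ ≤ (4 * L + 4 / γ) * ‖v - w‖ := by
  set d := ‖v - w‖
  have h1 : ‖ψ v.snd - ψ w.snd‖ ≤ L * d :=
    (h _ _).trans (by gcongr; exact norm_snd_le' (v - w))
  have h2 : ‖ψ (pair v.snd.fst v.fst) - ψ (pair w.snd.fst w.fst)‖ ≤ L * d :=
    (h _ _).trans (by gcongr; exact norm_pair_fst_sub_le v w)
  have hθ : ‖v.fst - w.fst‖ ≤ d := norm_fst_le' (v - w)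
  have hy : ‖v.snd.snd - w.snd.snd‖ ≤ d :=
    (norm_snd_le' (v - w).snd).trans (norm_snd_le' (v - w))
  have h3 : ‖(1 / γ) • ((v.fst - w.fst) - (v.snd.snd - w.snd.snd))‖ ≤ 1 / γ * (d + d) := by
    rw [norm_smul, Real.norm_eq_abs, abs_of_pos (by positivity)]
    gcongr
    exact (norm_sub_le _ _).trans (add_le_add hθ hy)
  set r := (1 / γ) • ((v.fst - w.fst) - (v.snd.snd - w.snd.snd))
  have e1 : (lowerDir γ ψ v - lowerDir γ ψ w).fst
      = (ψ (pair v.snd.fst v.fst) - ψ (pair w.snd.fst w.fst)).snd + r := by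
    simp only [lowerDir_fst, WithLp.sub_fst, WithLp.sub_snd, r, smul_sub]; abel
  have e2 : (lowerDir γ ψ v - lowerDir γ ψ w).snd.fst
      = (ψ v.snd - ψ w.snd).fst - (ψ (pair v.snd.fst v.fst) - ψ (pair w.snd.fst w.fst)).fst := by
    simp only [lowerDir_snd_fst, WithLp.sub_fst, WithLp.sub_snd]; abel
  have e3 : (lowerDir γ ψ v - lowerDir γ ψ w).snd.snd = (ψ v.snd - ψ w.snd).snd + r := by
    simp only [lowerDir_snd_snd, WithLp.sub_snd, r, smul_sub]; abel
  have b1 : ‖(lowerDir γ ψ v - lowerDir γ ψ w).fst‖ ≤ L * d + 1 / γ * (d + d) := by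
    rw [e1]
    exact (norm_add_le _ _).trans (add_le_add ((norm_snd_le' _).trans h2) h3)
  have b2 : ‖(lowerDir γ ψ v - lowerDir γ ψ w).snd.fst‖ ≤ L * d + L * d := by
    rw [e2]
    exact (norm_sub_le _ _).trans
      (add_le_add ((norm_fst_le' _).trans h1) ((norm_fst_le' _).trans h2))
  have b3 : ‖(lowerDir γ ψ v - lowerDir γ ψ w).snd.snd‖ ≤ L * d + 1 / γ * (d + d) := by
    rw [e3]
    exact (norm_add_le _ _).trans (add_le_add ((norm_snd_le' _).trans h1) h3)
  refine (norm_le_add_prod _).trans ((add_le_add_right (norm_le_add_prod _) _).trans ?_)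
  calc _ ≤ (L * d + 1 / γ * (d + d)) + ((L * d + L * d) + (L * d + 1 / γ * (d + d))) := by gcongr
    _ = _ := by ring

lemma upperDir_avg (φ : Fin n → VecPair dx dy → VecPair dx dy) (v : Joint dx dy) :
    (avg fun i => upperDir (φ i) v) = upperDir (fun z => avg fun i => φ i z) v := by
  let T : VecPair dx dy →ₗ[ℝ] Joint dx dy :=
    { toFun := fun z => WithLp.toLp 2 (0, z)
      map_add' := fun z w => by
        apply WithLp.ofLp_injective 2
        ext1 <;> simp
      map_smul' := fun r z => by
        apply WithLp.ofLp_injective 2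
        ext1 <;> simp }
  exact (map_avg T fun i => φ i v.snd).symm

lemma fst_avg {E F : Type*} [NormedAddCommGroup E] [NormedAddCommGroup F]
    [InnerProductSpace ℝ E] [InnerProductSpace ℝ F] (u : Fin n → WithLp 2 (E × F)) :
    (avg u).fst = avg fun i => (u i).fst :=
  map_avg (WithLp.fstL 2 ℝ E F).toLinearMap u

lemma snd_avg {E F : Type*} [NormedAddCommGroup E] [NormedAddCommGroup F]
    [InnerProductSpace ℝ E] [InnerProductSpace ℝ F] (u : Fin n → WithLp 2 (E × F)) :
    (avg u).snd = avg fun i => (u i).snd :=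
  map_avg (WithLp.sndL 2 ℝ E F).toLinearMap u

lemma joint_ext {v w : Joint dx dy} (h1 : v.fst = w.fst) (h2 : v.snd.fst = w.snd.fst)
    (h3 : v.snd.snd = w.snd.snd) : v = w := by
  apply WithLp.ofLp_injective 2
  refine Prod.ext h1 ?_
  apply WithLp.ofLp_injective 2
  exact Prod.ext h2 h3

lemma lowerDir_avg (hn : 1 ≤ n) (γ : ℝ) (ψ : Fin n → VecPair dx dy → VecPair dx dy)
    (v : Joint dx dy) :
    (avg fun i => lowerDir γ (ψ i) v) = lowerDir γ (fun z => avg fun i => ψ i z) v := by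
  apply joint_ext
  · simp only [fst_avg, lowerDir_fst, snd_avg]
    rw [avg_add, avg_const hn]
  · simp only [snd_avg, fst_avg, lowerDir_snd_fst]
    rw [avg_sub]
  · simp only [snd_avg, lowerDir_snd_snd]
    rw [avg_sub, avg_const hn]

end Joint

/-! ### The Lyapunov function -/

section Lyapunov

variable {n dx dy : ℕ} {Ξf Ξg : Type*} [MeasurableSpace Ξf] [MeasurableSpace Ξg]

/-- The standing regularity assumptions. -/
structure Problem.Regular (P : Problem n dx dy Ξf Ξg) (L₁ L₂ γ Lθ : ℝ) : Prop where
  smooth : P.Smooth L₁ L₂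
  one_le : 1 ≤ n
  nonneg : 0 ≤ L₁
  pos : 0 < L₂
  γ_pos : 0 < γ
  γ_lt : γ < 1 / (2 * L₂)
  Lθ_pos : 0 < Lθ
  lipschitz : ∀ z z', ‖P.thetaStar γ z - P.thetaStar γ z'‖ ≤ Lθ * ‖z - z'‖

variable {P : Problem n dx dy Ξf Ξg} {L₁ L₂ γ Lθ : ℝ}

/-- The mean direction at a consensual point. -/
noncomputable def Problem.meanDir (P : Problem n dx dy Ξf Ξg) (γ μ : ℝ) (v : Joint dx dy) :
    Joint dx dy :=
  μ • upperDir P.gradF v + lowerDir γ P.gradG v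

/-- The gradient of the penalized objective. -/
noncomputable def Problem.gradPenalized (P : Problem n dx dy Ξf Ξg) (γ μ : ℝ)
    (z : VecPair dx dy) : VecPair dx dy :=
  μ • P.gradF z + P.gradG z - P.gradV γ z

/-- The Lyapunov function: the penalized objective plus the gap of the proximal objective. -/
noncomputable def Problem.lyap (P : Problem n dx dy Ξf Ξg) (γ μ Fl : ℝ) (v : Joint dx dy) : ℝ :=
  μ * (P.upper v.snd - Fl) + (P.lower v.snd - P.moreau γ v.snd)
    + (P.proxObjective γ v.snd v.fst - P.moreau γ v.snd)

/-- The gradient of the Lyapunov function. -/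
noncomputable def Problem.gradLyap (P : Problem n dx dy Ξf Ξg) (γ μ : ℝ) (v : Joint dx dy) :
    Joint dx dy :=
  WithLp.toLp 2 (P.proxGrad γ v.snd v.fst,
    P.gradPenalized γ μ v.snd + (P.proxGradParam γ v.snd v.fst - P.gradV γ v.snd))

@[simp] lemma gradLyap_fst (μ : ℝ) (v : Joint dx dy) :
    (P.gradLyap γ μ v).fst = P.proxGrad γ v.snd v.fst := rfl

@[simp] lemma gradLyap_snd (μ : ℝ) (v : Joint dx dy) :
    (P.gradLyap γ μ v).snd
      = P.gradPenalized γ μ v.snd + (P.proxGradParam γ v.snd v.fst - P.gradV γ v.snd) := rfl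

lemma meanDir_fst (μ : ℝ) (v : Joint dx dy) :
    (P.meanDir γ μ v).fst = P.proxGrad γ v.snd v.fst := by
  simp [Problem.meanDir, upperDir, lowerDir, Problem.proxGrad]

/-- The bias enters `gradLyap` with the opposite sign, so the inner product of the two (x, y) parts
is a difference of squares. -/
lemma meanDir_snd (μ : ℝ) (v : Joint dx dy) :
    (P.meanDir γ μ v).snd
      = P.gradPenalized γ μ v.snd - (P.proxGradParam γ v.snd v.fst - P.gradV γ v.snd) := by
  have : P.gradPenalized γ μ v.snd - (P.proxGradParam γ v.snd v.fst - P.gradV γ v.snd)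
      = μ • P.gradF v.snd + (P.gradG v.snd - P.proxGradParam γ v.snd v.fst) := by
    simp only [Problem.gradPenalized]; abel
  rw [this]
  simp only [Problem.meanDir, WithLp.add_snd, WithLp.smul_snd, upperDir, lowerDir]
  rfl

/-- The curvature constant of the Moreau envelope. -/
noncomputable def moreauConst (L₂ γ Lθ : ℝ) : ℝ :=
  L₂ + 1 / γ + Real.sqrt (L₂ ^ 2 + 1 / γ ^ 2) * Lθ

/-- The curvature constant of the Lyapunov function. -/
noncomputable def lyapConst (L₁ L₂ γ Lθ μ₀ : ℝ) : ℝ :=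
  μ₀ * L₁ + 2 * L₂ + 1 / γ + 2 * moreauConst L₂ γ Lθ

lemma moreauConst_pos (hL₂ : 0 < L₂) (hγ : 0 < γ) (hLθ : 0 < Lθ) : 0 < moreauConst L₂ γ Lθ := by
  unfold moreauConst; positivity

lemma lyapConst_pos {μ₀ : ℝ} (hL₁ : 0 ≤ L₁) (hL₂ : 0 < L₂) (hγ : 0 < γ) (hLθ : 0 < Lθ)
    (hμ : 0 ≤ μ₀) : 0 < lyapConst L₁ L₂ γ Lθ μ₀ := by
  have := moreauConst_pos hL₂ hγ hLθ
  unfold lyapConst; positivity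

variable (hP : P.Regular L₁ L₂ γ Lθ)

include hP

/-- Sum of the first-order expansions of F, G, V_γ and the proximal objective. The envelope occurs
with coefficient −2 in the Lyapunov function, which explains the factor 2 of `moreauConst`; the term
1/γ comes from the coupling of θ and y. -/
lemma Problem.Regular.lyap_le {μ μ₀ Fl : ℝ} (hμ : 0 ≤ μ) (hμ' : μ ≤ μ₀) (v w : Joint dx dy) :
    P.lyap γ μ Fl w ≤ P.lyap γ μ Fl v + inner ℝ (P.gradLyap γ μ v) (w - v)
      + lyapConst L₁ L₂ γ Lθ μ₀ * ‖w - v‖ ^ 2 := by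
  obtain ⟨hS, hn, hL₁, hL₂, hγ, hγ', hLθ, hθ⟩ := hP
  have hF := (abs_le.1 (abs_sub_inner_gradient_le hL₁ hS.hasGradientAt_upper
    (hS.gradF_lipschitz hn) v.snd w.snd)).2
  have hG := (abs_le.1 (abs_sub_inner_gradient_le hL₂.le hS.hasGradientAt_lower
    (hS.gradG_lipschitz hn) v.snd w.snd)).2
  have hV := (abs_le.1 (abs_moreau_expansion_le hS hn hL₂ hγ hγ' hLθ hθ v.snd w.snd)).1
  have hh := (abs_le.1 (proxObjective_expansion hS hn hL₂ hγ v.snd w.snd v.fst w.fst)).2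
  have h0 := norm_sq_prod (w - v)
  have h1 := norm_sq_prod (w - v).snd
  simp only [WithLp.sub_fst, WithLp.sub_snd] at h0 h1
  have h2 := norm_sub_sq_le (w.fst - v.fst) (w.snd.snd - v.snd.snd)
  have hsnd : ‖w.snd - v.snd‖ ^ 2 ≤ ‖w - v‖ ^ 2 := by rw [h0]; nlinarith [sq_nonneg ‖w.fst - v.fst‖]
  have b1 : μ * (L₁ * ‖w.snd - v.snd‖ ^ 2) ≤ μ₀ * L₁ * ‖w - v‖ ^ 2 := by
    rw [← mul_assoc]
    have := hμ.trans hμ'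
    gcongr
  have b2 : L₂ * ‖w.snd - v.snd‖ ^ 2 ≤ L₂ * ‖w - v‖ ^ 2 := by gcongr
  have b3 : L₂ * (‖w.snd.fst - v.snd.fst‖ ^ 2 + ‖w.fst - v.fst‖ ^ 2) ≤ L₂ * ‖w - v‖ ^ 2 := by
    gcongr; rw [h0, h1]; nlinarith [sq_nonneg ‖w.snd.snd - v.snd.snd‖]
  have b4 : 1 / (2 * γ) * ‖w.fst - v.fst - (w.snd.snd - v.snd.snd)‖ ^ 2
      ≤ 1 / γ * ‖w - v‖ ^ 2 := by
    have : 1 / γ * ‖w - v‖ ^ 2 = 1 / (2 * γ) * (2 * ‖w - v‖ ^ 2) := by field_simp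
    rw [this]
    gcongr
    rw [h0, h1]; nlinarith [sq_nonneg ‖w.snd.fst - v.snd.fst‖]
  have b5 : moreauConst L₂ γ Lθ * ‖w.snd - v.snd‖ ^ 2 ≤ moreauConst L₂ γ Lθ * ‖w - v‖ ^ 2 := by
    have := moreauConst_pos hL₂ hγ hLθ
    gcongr
  have hF' := mul_le_mul_of_nonneg_left hF hμ
  have e : inner ℝ (P.gradLyap γ μ v) (w - v) = inner ℝ (P.proxGrad γ v.snd v.fst) (w.fst - v.fst)
      + (μ * inner ℝ (P.gradF v.snd) (w.snd - v.snd) + inner ℝ (P.gradG v.snd) (w.snd - v.snd)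
        - inner ℝ (P.gradV γ v.snd) (w.snd - v.snd)
        + (inner ℝ (P.proxGradParam γ v.snd v.fst) (w.snd - v.snd)
        - inner ℝ (P.gradV γ v.snd) (w.snd - v.snd))) := by
    rw [inner_prod]
    simp only [gradLyap_fst, gradLyap_snd, Problem.gradPenalized, WithLp.sub_fst, WithLp.sub_snd,
      inner_add_left, inner_sub_left, real_inner_smul_left]
  rw [e]
  change -(moreauConst L₂ γ Lθ * _) ≤ _ at hV
  simp only [Problem.lyap, lyapConst]
  linarith

lemma Problem.Regular.two_mul_inv_le : 1 / (2 * γ) ≤ 1 / γ - L₂ := by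
  have := half_inv_sub_pos hP.pos hP.γ_pos hP.γ_lt
  have e : 1 / γ = 2 * (1 / (2 * γ)) := by
    have := hP.γ_pos.ne'
    field_simp
  linarith

lemma Problem.Regular.norm_sub_thetaStar_le (v : Joint dx dy) :
    ‖v.fst - P.thetaStar γ v.snd‖ ≤ 2 * γ * ‖P.proxGrad γ v.snd v.fst‖ := by
  have h1 := mul_norm_sub_thetaStar_le_norm_proxGrad hP.smooth hP.one_le hP.pos hP.γ_pos hP.γ_lt
    v.snd v.fst
  have h2 := mul_le_mul_of_nonneg_right hP.two_mul_inv_le (norm_nonneg (v.fst - P.thetaStar γ v.snd))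
  have h3 := h2.trans h1
  have hγ := hP.γ_pos
  rw [one_div, inv_mul_le_iff₀ (by positivity)] at h3
  exact h3

/-- Since L₂ < 1/(2γ) and 1/γ = 2 · 1/(2γ), the two squares contribute at most 1 and 4. -/
lemma Problem.Regular.curvature_le : L₂ ^ 2 + 1 / γ ^ 2 ≤ 5 * (1 / (2 * γ)) ^ 2 := by
  have h := half_inv_sub_pos hP.pos hP.γ_pos hP.γ_lt
  have hL := hP.pos
  have e : 1 / γ ^ 2 = 4 * (1 / (2 * γ)) ^ 2 := by
    have := hP.γ_pos.ne'
    field_simp; norm_num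
  rw [e]
  nlinarith

/-- The bias of the `(x, y)` directions is controlled by the `θ` direction. -/
lemma Problem.Regular.norm_bias_sq_le (v : Joint dx dy) :
    ‖P.proxGradParam γ v.snd v.fst - P.gradV γ v.snd‖ ^ 2
      ≤ 5 * ‖P.proxGrad γ v.snd v.fst‖ ^ 2 := by
  refine (norm_proxGradParam_sub_le hP.smooth hP.one_le v.snd v.fst _).trans ?_
  have h := pow_le_pow_left₀ (norm_nonneg _) (hP.norm_sub_thetaStar_le v) 2
  have hγ := hP.γ_pos
  calc (L₂ ^ 2 + 1 / γ ^ 2) * ‖v.fst - P.thetaStar γ v.snd‖ ^ 2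
      ≤ 5 * (1 / (2 * γ)) ^ 2 * (2 * γ * ‖P.proxGrad γ v.snd v.fst‖) ^ 2 := by
        gcongr
        exact hP.curvature_le
    _ = _ := by field_simp

/-- The two (x, y) parts differ by twice the bias q, and ‖q‖² ≤ 5‖∇_θ h‖². The constant is 1 + 2 · 4
· 5 = 41. -/
lemma Problem.Regular.norm_gradLyap_sq_le (μ : ℝ) (v : Joint dx dy) :
    ‖P.gradLyap γ μ v‖ ^ 2 ≤ 41 * ‖P.meanDir γ μ v‖ ^ 2 := by
  have h := hP.norm_bias_sq_le v
  set q := P.proxGradParam γ v.snd v.fst - P.gradV γ v.snd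
  have e : (P.gradLyap γ μ v).snd = (P.meanDir γ μ v).snd + (2 : ℝ) • q := by
    rw [meanDir_snd, two_smul]
    simp only [gradLyap_snd, q]
    abel
  have h2 := norm_add_sq_le (P.meanDir γ μ v).snd ((2 : ℝ) • q)
  rw [norm_smul, mul_pow, Real.norm_eq_abs, sq_abs] at h2
  rw [norm_sq_prod, norm_sq_prod (P.meanDir γ μ v), e, meanDir_fst]
  change ‖P.proxGrad γ v.snd v.fst‖ ^ 2 + _ ≤ _
  nlinarith [sq_nonneg ‖(P.meanDir γ μ v).snd‖]

/-- Here the bound on cl is spent. With Q = √(L₂² + 1/γ²) and m = 1/γ − L₂, the bias is at most Q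
times the distance to θ*, and m times that distance is at most ‖∇_θ h‖. The hypothesis reads 16 · cl
· Q · Lθ ≤ m; since Lθ ≥ 2/3 by `one_le_mul_lipschitz`, it gives cl · Q ≤ (3/32)m, while Q ≤ 3m. The
lower bound on Lθ needs a nontrivial y-space; otherwise the bias is zero. -/
lemma Problem.Regular.step_ratio {cl : ℝ} (hcl : 0 < cl)
    (hcl' : cl ≤ (1 / γ - L₂) / (32 * weightA L₂ γ Lθ * Lθ ^ 2)) (v : Joint dx dy) :
    cl * (3 / 2) * ‖P.proxGradParam γ v.snd v.fst - P.gradV γ v.snd‖ ^ 2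
      ≤ 1 / 2 * ‖P.proxGrad γ v.snd v.fst‖ ^ 2 := by
  obtain h | h := subsingleton_or_nontrivial (Vec dy)
  · have : P.proxGradParam γ v.snd v.fst - P.gradV γ v.snd = 0 := by
      rw [Problem.gradV, Subsingleton.elim (P.thetaStar γ v.snd) v.fst, sub_self]
    rw [this]; simp
  have h1 := one_le_mul_lipschitz hP.smooth hP.one_le hP.pos hP.γ_pos hP.γ_lt hP.lipschitz
  have h2 := norm_proxGradParam_sub_le (γ := γ) hP.smooth hP.one_le v.snd v.fst
    (P.thetaStar γ v.snd)
  have h3 := mul_norm_sub_thetaStar_le_norm_proxGrad hP.smooth hP.one_le hP.pos hP.γ_pos hP.γ_lt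
    v.snd v.fst
  have h4 := hP.two_mul_inv_le
  have h5 := hP.curvature_le
  have hγ := hP.γ_pos
  have hLθ := hP.Lθ_pos
  have hg : 0 < 1 / (2 * γ) := by positivity
  have hQpos : 0 < L₂ ^ 2 + 1 / γ ^ 2 := by positivity
  set m := 1 / γ - L₂
  set Q := Real.sqrt (L₂ ^ 2 + 1 / γ ^ 2) with hQ
  have hQ2 : Q ^ 2 = L₂ ^ 2 + 1 / γ ^ 2 := Real.sq_sqrt hQpos.le
  have hQ0 : 0 < Q := Real.sqrt_pos.2 hQpos
  have hw : 32 * weightA L₂ γ Lθ * Lθ ^ 2 = 16 * Q * Lθ := by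
    unfold weightA; rw [← hQ]; field_simp; ring
  rw [hw, le_div_iff₀ (by positivity)] at hcl'
  have hQ3 : Q ≤ 3 * m := by
    refine (abs_le_of_sq_le_sq' ?_ (by linarith)).2
    nlinarith
  have h6 : cl * Q ≤ 3 / 32 * m := by
    have : cl * Q * 1 ≤ cl * Q * (3 / 2 * Lθ) := by gcongr
    nlinarith
  set e := ‖v.fst - P.thetaStar γ v.snd‖
  have he : 0 ≤ e := norm_nonneg _
  calc cl * (3 / 2) * ‖P.proxGradParam γ v.snd v.fst - P.gradV γ v.snd‖ ^ 2
      ≤ cl * (3 / 2) * (Q ^ 2 * e ^ 2) := by gcongr; rw [hQ2]; exact h2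
    _ = 3 / 2 * (cl * Q) * Q * e ^ 2 := by ring
    _ ≤ 3 / 2 * (3 / 32 * m) * (3 * m) * e ^ 2 := by gcongr; nlinarith
    _ ≤ 1 / 2 * (m * e) ^ 2 := by nlinarith [mul_nonneg (sq_nonneg m) (sq_nonneg e)]
    _ ≤ _ := by gcongr; nlinarith

/-- With p = ∇Ψ, the (x, y) part is cl⟨p + q, p − q⟩ = cl(‖p‖² − ‖q‖²). Since ‖p − q‖²/4 ≤ ‖p‖²/2 +
‖q‖²/2, the total deficit is (3/2)cl‖q‖², which `step_ratio` charges to half of the θ term. -/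
lemma Problem.Regular.le_inner_gradLyap {cl : ℝ} (hcl : 0 < cl)
    (hcl' : cl ≤ (1 / γ - L₂) / (32 * weightA L₂ γ Lθ * Lθ ^ 2)) (μ : ℝ) (v : Joint dx dy) :
    1 / 2 * ‖(P.meanDir γ μ v).fst‖ ^ 2 + cl * (1 / 2 * ‖P.gradPenalized γ μ v.snd‖ ^ 2
      + 1 / 4 * ‖(P.meanDir γ μ v).snd‖ ^ 2)
      ≤ inner ℝ (P.gradLyap γ μ v) (scale cl (P.meanDir γ μ v)) := by
  have h := hP.step_ratio hcl hcl' v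
  rw [inner_prod, scale_fst, scale_snd, meanDir_fst, meanDir_snd]
  simp only [gradLyap_fst, gradLyap_snd]
  set q := P.proxGradParam γ v.snd v.fst - P.gradV γ v.snd
  set p := P.gradPenalized γ μ v.snd
  rw [real_inner_self_eq_norm_sq, real_inner_smul_right]
  have e1 : ∀ p q : VecPair dx dy, inner ℝ (p + q) (p - q) = ‖p‖ ^ 2 - ‖q‖ ^ 2 := by
    intro p q
    rw [inner_add_left, inner_sub_right, inner_sub_right, real_inner_comm p q,
      real_inner_self_eq_norm_sq, real_inner_self_eq_norm_sq]
    ring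
  have e2 : ‖p - q‖ ^ 2 ≤ 2 * ‖p‖ ^ 2 + 2 * ‖q‖ ^ 2 := norm_sub_sq_le p q
  rw [e1]
  nlinarith

/-- One-step decrease of the Lyapunov function at a point `v`, for the mean direction perturbed by
a bias `b` and a noise `ε`. -/
lemma Problem.Regular.lyap_step_le {cl c lt μ μ₀ Fl : ℝ} (hcl : 0 < cl)
    (hcl' : cl ≤ (1 / γ - L₂) / (32 * weightA L₂ γ Lθ * Lθ ^ 2)) (hμ : 0 ≤ μ) (hμ' : μ ≤ μ₀)
    (hlt : 0 ≤ lt) (hc0 : 0 < c) (hc : c ≤ 1 / 8) (hc' : c ≤ cl / 16)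
    (hltc : 3 * (1 + cl) ^ 2 * lyapConst L₁ L₂ γ Lθ μ₀ * lt ≤ c)
    (v b ε : Joint dx dy) :
    P.lyap γ μ Fl (v - lt • scale cl (P.meanDir γ μ v + b + ε)) ≤ P.lyap γ μ Fl v
      - c * lt * (‖P.gradPenalized γ μ v.snd‖ ^ 2 + ‖P.meanDir γ μ v‖ ^ 2)
      + (41 * (1 + cl) ^ 2 / (4 * c) + c) * lt * ‖b‖ ^ 2
      + 3 * (1 + cl) ^ 2 * lyapConst L₁ L₂ γ Lθ μ₀ * lt ^ 2 * ‖ε‖ ^ 2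
      - lt * inner ℝ (P.gradLyap γ μ v) (scale cl ε) := by
  have hC := lyapConst_pos hP.nonneg hP.pos hP.γ_pos hP.Lθ_pos (hμ.trans hμ')
  set C := lyapConst L₁ L₂ γ Lθ μ₀
  set m := P.meanDir γ μ v
  set N := P.gradLyap γ μ v
  have h1 := hP.lyap_le (Fl := Fl) hμ hμ' v (v - lt • scale cl (m + b + ε))
  have h2 := hP.le_inner_gradLyap hcl hcl' μ v
  have h3 : ‖N‖ ^ 2 ≤ 41 * ‖m‖ ^ 2 := hP.norm_gradLyap_sq_le μ v
  rw [sub_sub_cancel_left, inner_neg_right, norm_neg, real_inner_smul_right, map_add, map_add,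
    inner_add_right, inner_add_right, norm_smul, mul_pow, Real.norm_eq_abs, sq_abs, ← map_add,
    ← map_add] at h1
  have h4 : ‖scale cl (m + b + ε)‖ ^ 2
      ≤ (1 + cl) ^ 2 * (3 * ‖m‖ ^ 2 + 3 * ‖b‖ ^ 2 + 3 * ‖ε‖ ^ 2) :=
    (norm_scale_sq_le hcl.le _).trans (by gcongr; exact norm_add₃_sq_le _ _ _)
  have h5 : -(c * ‖m‖ ^ 2 + 41 * (1 + cl) ^ 2 / (4 * c) * ‖b‖ ^ 2) ≤ inner ℝ N (scale cl b) := by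
    have a1 := neg_le_of_abs_le (abs_real_inner_le_norm N (scale cl b))
    have a2 : ‖N‖ * ‖scale cl b‖ ≤ c / 41 * ‖N‖ ^ 2 + 41 / (4 * c) * ‖scale cl b‖ ^ 2 := by
      have : 0 ≤ (2 * c * ‖N‖ - 41 * ‖scale cl b‖) ^ 2 / (4 * c * 41) := by positivity
      have e : (2 * c * ‖N‖ - 41 * ‖scale cl b‖) ^ 2 / (4 * c * 41)
        = c / 41 * ‖N‖ ^ 2 + 41 / (4 * c) * ‖scale cl b‖ ^ 2 - ‖N‖ * ‖scale cl b‖ := by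
        field_simp; ring
      linarith
    have a3 : 41 / (4 * c) * ‖scale cl b‖ ^ 2 ≤ 41 / (4 * c) * ((1 + cl) ^ 2 * ‖b‖ ^ 2) := by
      gcongr; exact norm_scale_sq_le hcl.le b
    have a4 : 41 / (4 * c) * ((1 + cl) ^ 2 * ‖b‖ ^ 2)
        = 41 * (1 + cl) ^ 2 / (4 * c) * ‖b‖ ^ 2 := by ring
    have a5 : c / 41 * ‖N‖ ^ 2 ≤ c * ‖m‖ ^ 2 := by
      calc c / 41 * ‖N‖ ^ 2 ≤ c / 41 * (41 * ‖m‖ ^ 2) := by gcongr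
        _ = _ := by ring
    linarith
  -- Of the three units c‖m‖², one pays for the cross term with the bias (`h5`), one for the
  -- second-order term (`h7`), and one remains in the conclusion.
  have h6 : c * ‖P.gradPenalized γ μ v.snd‖ ^ 2 + 3 * c * ‖m‖ ^ 2 ≤ inner ℝ N (scale cl m) := by
    refine le_trans ?_ h2
    rw [norm_sq_prod m]
    nlinarith [sq_nonneg ‖P.gradPenalized γ μ v.snd‖, sq_nonneg ‖m.fst‖, sq_nonneg ‖m.snd‖]
  have h7 : C * (lt ^ 2 * ‖scale cl (m + b + ε)‖ ^ 2)
      ≤ lt * c * (‖m‖ ^ 2 + ‖b‖ ^ 2) + 3 * (1 + cl) ^ 2 * C * lt ^ 2 * ‖ε‖ ^ 2 := by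
    calc C * (lt ^ 2 * ‖scale cl (m + b + ε)‖ ^ 2)
        ≤ C * (lt ^ 2 * ((1 + cl) ^ 2 * (3 * ‖m‖ ^ 2 + 3 * ‖b‖ ^ 2 + 3 * ‖ε‖ ^ 2))) := by gcongr
      _ = lt * (3 * (1 + cl) ^ 2 * C * lt) * (‖m‖ ^ 2 + ‖b‖ ^ 2)
          + 3 * (1 + cl) ^ 2 * C * lt ^ 2 * ‖ε‖ ^ 2 := by ring
      _ ≤ _ := by gcongr
  have h5' := mul_le_mul_of_nonneg_left h5 hlt
  have h6' := mul_le_mul_of_nonneg_left h6 hlt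
  have h8 : 0 ≤ lt * c * ‖m‖ ^ 2 := by positivity
  linarith

lemma Problem.Regular.moreau_le_lower (z : VecPair dx dy) : P.moreau γ z ≤ P.lower z := by
  rw [← proxObjective_snd (γ := γ)]
  exact moreau_le hP.smooth hP.one_le hP.pos hP.γ_pos hP.γ_lt z z.snd

lemma Problem.Regular.lyap_nonneg {μ Fl : ℝ} (hμ : 0 ≤ μ) (hFl : ∀ z, Fl ≤ P.upper z)
    (v : Joint dx dy) : 0 ≤ P.lyap γ μ Fl v := by
  have h1 := hP.moreau_le_lower v.snd
  have h2 := moreau_le hP.smooth hP.one_le hP.pos hP.γ_pos hP.γ_lt v.snd v.fst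
  have h3 := mul_nonneg hμ (sub_nonneg.2 (hFl v.snd))
  unfold Problem.lyap
  linarith

-- Because F ≥ F̲, replacing μ by a smaller value never increases the Lyapunov function; this makes
-- the varying penalty parameter harmless in the descent.
omit hP in
lemma lyap_mono {μ μ' Fl : ℝ} (hμ : μ ≤ μ') (hFl : ∀ z, Fl ≤ P.upper z)
    (v : Joint dx dy) : P.lyap γ μ Fl v ≤ P.lyap γ μ' Fl v := by
  have := mul_le_mul_of_nonneg_right hμ (sub_nonneg.2 (hFl v.snd))
  unfold Problem.lyap
  linarith

lemma Problem.Regular.lyap_le_gap {μ Fl : ℝ} (v : Joint dx dy) :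
    P.lyap γ μ Fl v ≤ μ * (P.upper v.snd - Fl) + (P.lower v.snd - P.moreau γ v.snd)
      + (1 / (2 * γ) + L₂) * ‖v.fst - P.thetaStar γ v.snd‖ ^ 2 := by
  have := proxObjective_sub_moreau_le hP.smooth hP.one_le hP.pos hP.γ_pos hP.γ_lt v.snd v.fst
  unfold Problem.lyap
  linarith

/-- The proximal objective at θ = y equals G, so its quadratic growth bounds ‖y − θ*‖² by G − V_γ.
This converts ‖ȳ⁰ − θ̄⁰‖ into quantities of the initial gap. -/
lemma Problem.Regular.norm_snd_sub_fst_sq_le (v : Joint dx dy) :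
    ‖v.snd.snd - v.fst‖ ^ 2 ≤ 2 / (1 / (2 * γ) - L₂) * (P.lower v.snd - P.moreau γ v.snd)
      + 2 * ‖v.fst - P.thetaStar γ v.snd‖ ^ 2 := by
  have h1 := sq_norm_sub_thetaStar_le hP.smooth hP.one_le hP.pos hP.γ_pos hP.γ_lt v.snd v.snd.snd
  rw [proxObjective_snd] at h1
  have h2 := norm_sub_sq_le (v.snd.snd - P.thetaStar γ v.snd) (v.fst - P.thetaStar γ v.snd)
  rw [sub_sub_sub_cancel_right] at h2
  have hm := half_inv_sub_pos hP.pos hP.γ_pos hP.γ_lt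
  rw [← le_div_iff₀' hm] at h1
  rw [div_mul_eq_mul_div, mul_div_assoc]
  linarith

lemma Problem.Regular.meanDir_lipschitz {μ μ₀ : ℝ} (hμ : 0 ≤ μ) (hμ' : μ ≤ μ₀)
    (v w : Joint dx dy) :
    ‖P.meanDir γ μ v - P.meanDir γ μ w‖ ≤ (μ₀ * L₁ + (4 * L₂ + 4 / γ)) * ‖v - w‖ := by
  have h1 := upperDir_lipschitz hP.nonneg (hP.smooth.gradF_lipschitz hP.one_le) v w
  have h2 := lowerDir_lipschitz hP.γ_pos hP.pos.le (hP.smooth.gradG_lipschitz hP.one_le) v w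
  have h0 := hP.nonneg
  have hμ0 := hμ.trans hμ'
  have e : P.meanDir γ μ v - P.meanDir γ μ w = μ • (upperDir P.gradF v - upperDir P.gradF w)
      + (lowerDir γ P.gradG v - lowerDir γ P.gradG w) := by
    simp only [Problem.meanDir, smul_sub]; abel
  rw [e]
  refine (norm_add_le _ _).trans ?_
  rw [norm_smul, Real.norm_eq_abs, abs_of_nonneg hμ, add_mul, mul_assoc]
  gcongr

end Lyapunov

end SunDSBO

namespace SunDSBO

/-! ### The algorithm on the joint space -/

section Encoding

variable {n dx dy : ℕ} {Ξf Ξg : Type*} [MeasurableSpace Ξf] [MeasurableSpace Ξg]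

/-- A triple as a point of the joint space. -/
noncomputable def Triple.toJoint (t : Triple dx dy) : Joint dx dy :=
  WithLp.toLp 2 (t.θ, pair t.x t.y)

@[simp] lemma Triple.toJoint_fst (t : Triple dx dy) : t.toJoint.fst = t.θ := rfl

@[simp] lemma Triple.toJoint_snd (t : Triple dx dy) : t.toJoint.snd = pair t.x t.y := rfl

/-- The iterates of all agents. -/
noncomputable def State.pos (s : State n dx dy) : Fin n → Joint dx dy := fun i => (s.v i).toJoint

/-- The tracked directions of all agents. -/
noncomputable def State.dir (s : State n dx dy) : Fin n → Joint dx dy := fun i => (s.D i).toJoint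

/-- The stochastic directions of all agents. -/
noncomputable def State.est (s : State n dx dy) : Fin n → Joint dx dy :=
  fun i => (s.Dhat i).toJoint

lemma avg_toJoint_fst (v : Fin n → Triple dx dy) :
    (avg fun i => (v i).toJoint).fst = avg fun i => (v i).θ := by
  simp [fst_avg]

lemma avg_toJoint_snd (v : Fin n → Triple dx dy) :
    (avg fun i => (v i).toJoint).snd = meanPoint v := by
  apply WithLp.ofLp_injective 2
  refine Prod.ext ?_ ?_
  · change (avg fun i => (v i).toJoint).snd.fst = _
    simp [snd_avg, fst_avg, meanPoint, pair]
  · change (avg fun i => (v i).toJoint).snd.snd = _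
    simp [snd_avg, meanPoint, pair]

lemma dispersion_eq_disp (v : Fin n → Triple dx dy) :
    dispersion v = disp fun i => (v i).toJoint := by
  rw [disp_eq, dispersion]
  congr 1; ext i
  rw [norm_sq_prod, norm_sq_prod (_ : Joint dx dy).snd]
  simp only [WithLp.sub_fst, WithLp.sub_snd, avg_toJoint_fst, avg_toJoint_snd, Triple.toJoint_fst,
    Triple.toJoint_snd, meanPoint, pair_fst, pair_snd]
  ring

/-- The stochastic direction of agent `i`, for the samples `a`, `b`. -/
noncomputable def Problem.sampleDir (P : Problem n dx dy Ξf Ξg) (γ μ : ℝ) (i : Fin n)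
    (v : Joint dx dy) (a : Ξf) (b : Ξg) : Joint dx dy :=
  μ • upperDir (fun z => gradient (fun w => P.f i w a) z) v
    + lowerDir γ (fun z => gradient (fun w => P.g i w b) z) v

/-- The expected direction of agent `i`. -/
noncomputable def Problem.localDir (P : Problem n dx dy Ξf Ξg) (γ μ : ℝ) (i : Fin n)
    (v : Joint dx dy) : Joint dx dy :=
  μ • upperDir (gradient (P.localF i)) v + lowerDir γ (gradient (P.localG i)) v

variable (P : Problem n dx dy Ξf Ξg)

lemma toJoint_direction (γ μ : ℝ) (i : Fin n) (t : Triple dx dy) (a : Ξf) (b : Ξg) :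
    (P.direction γ μ i t a b).toJoint = P.sampleDir γ μ i t.toJoint a b := by
  apply joint_ext
  · simp [Problem.direction, Problem.sampleDir, lowerDir_fst]
  · simp [Problem.direction, Problem.sampleDir, lowerDir_snd_fst, add_sub_assoc]
  · simp [Problem.direction, Problem.sampleDir, lowerDir_snd_snd, add_sub_assoc]

lemma fst_mix {E F : Type*} [NormedAddCommGroup E] [NormedAddCommGroup F]
    [InnerProductSpace ℝ E] [InnerProductSpace ℝ F] (W : Matrix (Fin n) (Fin n) ℝ)
    (u : Fin n → WithLp 2 (E × F)) (i : Fin n) : (mix W u i).fst = ∑ j, W i j • (u j).fst :=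
  map_mix (WithLp.fstL 2 ℝ E F).toLinearMap W u i

lemma snd_mix {E F : Type*} [NormedAddCommGroup E] [NormedAddCommGroup F]
    [InnerProductSpace ℝ E] [InnerProductSpace ℝ F] (W : Matrix (Fin n) (Fin n) ℝ)
    (u : Fin n → WithLp 2 (E × F)) (i : Fin n) : (mix W u i).snd = mix W (fun j => (u j).snd) i :=
  map_mix (WithLp.sndL 2 ℝ E F).toLinearMap W u i

variable (W : Matrix (Fin n) (Fin n) ℝ) (γ lt cl μ : ℝ) (a : Fin n → Ξf) (b : Fin n → Ξg)
  (s : State n dx dy)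

lemma step_est (i : Fin n) :
    (P.step W γ lt (cl * lt) μ a b s).est i = P.sampleDir γ μ i (s.pos i) (a i) (b i) :=
  toJoint_direction P γ μ i (s.v i) (a i) (b i)

lemma step_dir :
    (P.step W γ lt (cl * lt) μ a b s).dir
      = mix W fun j => s.dir j + ((P.step W γ lt (cl * lt) μ a b s).est j - s.est j) := by
  ext1 i
  set t := P.step W γ lt (cl * lt) μ a b s
  apply joint_ext
  · rw [fst_mix]
    change ∑ j, W i j • ((s.dir j).fst + (t.est j).fst - (s.est j).fst) = _
    simp only [add_sub_assoc]; rfl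
  · rw [snd_mix, fst_mix]
    change ∑ j, W i j • ((s.dir j).snd.fst + (t.est j).snd.fst - (s.est j).snd.fst) = _
    simp only [add_sub_assoc]; rfl
  · rw [snd_mix, snd_mix]
    change ∑ j, W i j • ((s.dir j).snd.snd + (t.est j).snd.snd - (s.est j).snd.snd) = _
    simp only [add_sub_assoc]; rfl

lemma step_pos :
    (P.step W γ lt (cl * lt) μ a b s).pos
      = mix W fun j => s.pos j - lt • scale cl ((P.step W γ lt (cl * lt) μ a b s).dir j) := by
  ext1 i
  set t := P.step W γ lt (cl * lt) μ a b s
  apply joint_ext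
  · rw [fst_mix]; rfl
  · rw [snd_mix, fst_mix]
    change ∑ j, W i j • ((s.pos j).snd.fst - (cl * lt) • (t.dir j).snd.fst) = _
    simp only [mul_comm cl lt, mul_smul]; rfl
  · rw [snd_mix, snd_mix]
    change ∑ j, W i j • ((s.pos j).snd.snd - (cl * lt) • (t.dir j).snd.snd) = _
    simp only [mul_comm cl lt, mul_smul]; rfl

end Encoding

/-! ### Deterministic recursions along a path -/

section Path

variable {n dx dy : ℕ} {Ξf Ξg : Type*} [MeasurableSpace Ξf] [MeasurableSpace Ξg]
  {P : Problem n dx dy Ξf Ξg} {W : Matrix (Fin n) (Fin n) ℝ} (hW : W.IsHermitian)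
  {γ lt cl : ℝ} {μ : ℕ → ℝ} {init : Fin n → Triple dx dy} {a : ℕ → Fin n → Ξf} {b : ℕ → Fin n → Ξg}

lemma run_est (k : ℕ) (i : Fin n) : (P.run W γ lt (cl * lt) μ init a b (k + 1)).est i
    = P.sampleDir γ (μ k) i ((P.run W γ lt (cl * lt) μ init a b k).pos i) (a k i) (b k i) :=
  step_est P W γ lt cl (μ k) (a k) (b k) _ i

lemma run_dir (k : ℕ) : (P.run W γ lt (cl * lt) μ init a b (k + 1)).dir
    = mix W fun j => (P.run W γ lt (cl * lt) μ init a b k).dir j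
      + ((P.run W γ lt (cl * lt) μ init a b (k + 1)).est j
        - (P.run W γ lt (cl * lt) μ init a b k).est j) :=
  step_dir P W γ lt cl (μ k) (a k) (b k) _

lemma run_pos (k : ℕ) : (P.run W γ lt (cl * lt) μ init a b (k + 1)).pos
    = mix W fun j => (P.run W γ lt (cl * lt) μ init a b k).pos j
      - lt • scale cl ((P.run W γ lt (cl * lt) μ init a b (k + 1)).dir j) :=
  step_pos P W γ lt cl (μ k) (a k) (b k) _

/-- The invariant of gradient tracking: mixing preserves averages and the increments of the
stochastic directions telescope, starting from zero. -/
lemma avg_run_dir (hWd : W ∈ doublyStochastic ℝ (Fin n)) (k : ℕ) :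
    avg (P.run W γ lt (cl * lt) μ init a b k).dir
      = avg (P.run W γ lt (cl * lt) μ init a b k).est := by
  induction k with
  | zero => rfl
  | succ k ih =>
    rw [run_dir, avg_mix hWd, avg_add, avg_sub, ih]
    exact add_sub_cancel _ _

lemma avg_run_pos (hWd : W ∈ doublyStochastic ℝ (Fin n)) (k : ℕ) :
    avg (P.run W γ lt (cl * lt) μ init a b (k + 1)).pos
      = avg (P.run W γ lt (cl * lt) μ init a b k).pos
        - lt • scale cl (avg (P.run W γ lt (cl * lt) μ init a b (k + 1)).dir) := by
  rw [run_pos, avg_mix hWd, avg_sub, avg_smul, ← map_avg]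

lemma norm_avg_run_pos_sub_sq_le (hWd : W ∈ doublyStochastic ℝ (Fin n)) (hcl : 0 ≤ cl) (k : ℕ) :
    ‖avg (P.run W γ lt (cl * lt) μ init a b (k + 1)).pos
      - avg (P.run W γ lt (cl * lt) μ init a b k).pos‖ ^ 2
      ≤ (1 + cl) ^ 2 * lt ^ 2 * ‖avg (P.run W γ lt (cl * lt) μ init a b (k + 1)).dir‖ ^ 2 := by
  rw [avg_run_pos hWd, sub_sub_cancel_left, norm_neg, norm_smul, mul_pow, Real.norm_eq_abs, sq_abs]
  have := norm_scale_sq_le hcl (avg (P.run W γ lt (cl * lt) μ init a b (k + 1)).dir)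
  nlinarith [sq_nonneg lt]

/-- The squared displacement of the average is at most `k` times the sum of the squared steps. -/
lemma norm_avg_run_pos_sub_init_sq_le (hWd : W ∈ doublyStochastic ℝ (Fin n)) (hcl : 0 ≤ cl)
    (k : ℕ) :
    ‖avg (P.run W γ lt (cl * lt) μ init a b k).pos
      - avg (P.run W γ lt (cl * lt) μ init a b 0).pos‖ ^ 2
      ≤ k * ∑ j ∈ Finset.range k, (1 + cl) ^ 2 * lt ^ 2
        * ‖avg (P.run W γ lt (cl * lt) μ init a b (j + 1)).dir‖ ^ 2 := by
  rw [← Finset.sum_range_sub (fun k => avg (P.run W γ lt (cl * lt) μ init a b k).pos) k]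
  have h1 := pow_le_pow_left₀ (norm_nonneg _) (norm_sum_le (Finset.range k) fun j =>
    avg (P.run W γ lt (cl * lt) μ init a b (j + 1)).pos
      - avg (P.run W γ lt (cl * lt) μ init a b j).pos) 2
  have h2 := sq_sum_le_card_mul_sum_sq (s := Finset.range k) (f := fun j =>
    ‖avg (P.run W γ lt (cl * lt) μ init a b (j + 1)).pos
      - avg (P.run W γ lt (cl * lt) μ init a b j).pos‖)
  rw [Finset.card_range] at h2
  refine h1.trans (h2.trans ?_)
  gcongr with j
  exact norm_avg_run_pos_sub_sq_le hWd hcl j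

lemma disp_run_pos_succ_le (hn : 1 ≤ n) (hWd : W ∈ doublyStochastic ℝ (Fin n))
    (hρ : connectivity W hW < 1) (hcl : 0 ≤ cl) (k : ℕ) :
    disp (P.run W γ lt (cl * lt) μ init a b (k + 1)).pos
      ≤ (1 - (1 - connectivity W hW) / 2) * disp (P.run W γ lt (cl * lt) μ init a b k).pos
        + 2 / (1 - connectivity W hW) * ((1 + cl) ^ 2 * lt ^ 2
          * disp (P.run W γ lt (cl * lt) μ init a b (k + 1)).dir) := by
  rw [run_pos]
  simp_rw [sub_eq_add_neg _ (lt • _)]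
  refine (disp_mix_add_le hW hn hWd hρ _ _).trans ?_
  have h1 : (0 : ℝ) < 1 - connectivity W hW := by linarith
  refine add_le_add le_rfl (mul_le_mul_of_nonneg_left ?_ (by positivity))
  refine (disp_mix_le_disp hW hn hWd hρ _).trans ?_
  set D := (P.run W γ lt (cl * lt) μ init a b (k + 1)).dir
  have h2 := disp_map_le (scale cl) (fun u => norm_scale_sq_le (dx := dx) (dy := dy) hcl u) D
  have h3 : disp (fun j => -(lt • scale cl (D j))) = lt ^ 2 * disp fun j => scale cl (D j) := by
    rw [← neg_sq lt, ← disp_smul]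
    simp
  rw [h3]
  nlinarith [sq_nonneg lt]

variable {L₁ L₂ Lθ μ₀ : ℝ} (hP : P.Regular L₁ L₂ γ Lθ)

/-- The Lipschitz constant of the directions. -/
noncomputable def dirConst (L₁ L₂ γ μ₀ : ℝ) : ℝ := μ₀ * L₁ + (4 * L₂ + 4 / γ)

include hP

lemma Problem.Regular.dirConst_pos (hμ₀ : 0 ≤ μ₀) : 0 < dirConst L₁ L₂ γ μ₀ := by
  have := hP.nonneg
  have := hP.pos
  have := hP.γ_pos
  unfold dirConst
  positivity

lemma Problem.Regular.localDir_lipschitz {μ μ₀ : ℝ} (hμ : 0 ≤ μ) (hμ' : μ ≤ μ₀) (i : Fin n)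
    (v w : Joint dx dy) :
    ‖P.localDir γ μ i v - P.localDir γ μ i w‖ ≤ dirConst L₁ L₂ γ μ₀ * ‖v - w‖ := by
  have h1 := upperDir_lipschitz hP.nonneg (hP.smooth.lipschitz_f i) v w
  have h2 := lowerDir_lipschitz hP.γ_pos hP.pos.le (hP.smooth.lipschitz_g i) v w
  have h0 := hP.nonneg
  have hμ0 := hμ.trans hμ'
  have e : P.localDir γ μ i v - P.localDir γ μ i w
      = μ • (upperDir (gradient (P.localF i)) v - upperDir (gradient (P.localF i)) w)
      + (lowerDir γ (gradient (P.localG i)) v - lowerDir γ (gradient (P.localG i)) w) := by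
    simp only [Problem.localDir, smul_sub]; abel
  rw [e, dirConst]
  refine (norm_add_le _ _).trans ?_
  rw [norm_smul, Real.norm_eq_abs, abs_of_nonneg hμ, add_mul, mul_assoc]
  gcongr

omit hP in
lemma avg_localDir (hn : 1 ≤ n) (μ : ℝ) (v : Joint dx dy) :
    (avg fun i => P.localDir γ μ i v) = P.meanDir γ μ v := by
  simp only [Problem.localDir, Problem.meanDir]
  rw [avg_add, avg_smul, upperDir_avg, lowerDir_avg hn]
  rfl

/-- The bias of the averaged direction is controlled by the dispersion. -/
lemma Problem.Regular.norm_avg_localDir_sub_sq_le {μ μ₀ : ℝ} (hμ : 0 ≤ μ) (hμ' : μ ≤ μ₀)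
    (X : Fin n → Joint dx dy) :
    ‖(avg fun i => P.localDir γ μ i (X i)) - P.meanDir γ μ (avg X)‖ ^ 2
      ≤ dirConst L₁ L₂ γ μ₀ ^ 2 * disp X := by
  rw [← avg_localDir hP.one_le, ← avg_sub]
  refine (norm_avg_sq_le hP.one_le _).trans ?_
  rw [disp_eq, ← avg_mul]
  refine avg_mono fun i => ?_
  rw [← mul_pow]
  exact pow_le_pow_left₀ (norm_nonneg _) (hP.localDir_lipschitz hμ hμ' i _ _) 2

/-- The increment of the expected directions. The part frozen at the starting point is kept
separate: only its mixed dispersion is under control. -/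
lemma Problem.Regular.norm_localDir_increment_sq_le {μ μ' μ₀ : ℝ} (hμ : 0 ≤ μ) (hμ' : μ ≤ μ₀)
    (i : Fin n) (v w z : Joint dx dy) :
    ‖P.localDir γ μ i v - P.localDir γ μ' i w
      - (μ - μ') • upperDir (gradient (P.localF i)) z‖ ^ 2
      ≤ 2 * (dirConst L₁ L₂ γ μ₀ ^ 2 * ‖v - w‖ ^ 2)
        + 2 * ((μ - μ') ^ 2 * (L₁ ^ 2 * ‖w - z‖ ^ 2)) := by
  have e : P.localDir γ μ i v - P.localDir γ μ' i w - (μ - μ') • upperDir (gradient (P.localF i)) z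
      = (P.localDir γ μ i v - P.localDir γ μ i w)
        + (μ - μ') • (upperDir (gradient (P.localF i)) w - upperDir (gradient (P.localF i)) z) := by
    simp only [Problem.localDir, smul_sub, sub_smul]; abel
  rw [e]
  refine (norm_add_sq_le _ _).trans ?_
  have h1 := pow_le_pow_left₀ (norm_nonneg _) (hP.localDir_lipschitz hμ hμ' i v w) 2
  have h2 := pow_le_pow_left₀ (norm_nonneg _)
    (upperDir_lipschitz hP.nonneg (hP.smooth.lipschitz_f i) w z) 2
  rw [mul_pow] at h1 h2
  rw [norm_smul, mul_pow, Real.norm_eq_abs, sq_abs]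
  gcongr

omit hP in
lemma msq_sub_le (hn : 1 ≤ n) (X Y : Fin n → Joint dx dy) :
    msq (fun i => X i - Y i) ≤ 2 * disp X + 2 * disp Y + ‖avg X - avg Y‖ ^ 2 := by
  rw [msq_eq_disp_add hn, avg_sub]
  have := disp_add_le X (fun i => -Y i)
  have e : disp (fun i => -Y i) = disp Y := by
    have := disp_smul (-1) Y
    simpa using this
  rw [e] at this
  simp only [← sub_eq_add_neg] at this
  linarith

/-- Initial heterogeneity of the upper-level gradients, after mixing: it is controlled by the
dispersion of the mixed directions, the dispersion of the iterates and `‖ȳ - θ̄‖`. -/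
lemma Problem.Regular.disp_mix_upperDir_le (hWd : W ∈ doublyStochastic ℝ (Fin n))
    (hρ : connectivity W hW < 1) (μ : ℝ) (X : Fin n → Joint dx dy) :
    μ ^ 2 * disp (mix W fun i => upperDir (gradient (P.localF i)) (X i))
      ≤ 4 * disp (mix W fun i => P.localDir γ μ i (X i))
        + 2 * L₂ ^ 2 * (2 * disp X + ‖(avg X).snd.snd - (avg X).fst‖ ^ 2) := by
  -- T subtracts the θ direction from the y direction. Both contain the same proximal term (θ −
  -- y)/γ, which cancels and leaves μ∇f_i + ∇g_i(x, y) − ∇g_i(x, θ).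
  let T : Joint dx dy →ₗ[ℝ] Joint dx dy :=
    { toFun := fun u => WithLp.toLp 2 (0, u.snd - pair 0 u.fst)
      map_add' := fun u w => by
        apply joint_ext <;> (simp; try abel)
      map_smul' := fun r u => by
        apply joint_ext <;> simp [smul_sub] }
  have hT : ∀ u, ‖T u‖ ^ 2 ≤ 2 * ‖u‖ ^ 2 := by
    intro u
    rw [norm_sq_prod]
    change ‖(0 : Vec dy)‖ ^ 2 + ‖u.snd - pair 0 u.fst‖ ^ 2 ≤ _
    have h1 := norm_sub_sq_le u.snd (pair 0 u.fst)
    have h2 : ‖(pair 0 u.fst : VecPair dx dy)‖ ^ 2 = ‖u.fst‖ ^ 2 := by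
      rw [norm_sq_prod]; simp
    rw [h2] at h1
    rw [norm_sq_prod u, norm_zero]
    linarith
  let S : Joint dx dy →ₗ[ℝ] Vec dy :=
    { toFun := fun u => u.snd.snd - u.fst
      map_add' := fun u w => by simp; abel
      map_smul' := fun r u => by simp [smul_sub] }
  have hSn : ∀ u, ‖S u‖ ^ 2 ≤ 2 * ‖u‖ ^ 2 := by
    intro u
    have h1 := norm_sub_sq_le u.snd.snd u.fst
    rw [norm_sq_prod u, norm_sq_prod u.snd]
    change ‖u.snd.snd - u.fst‖ ^ 2 ≤ _
    nlinarith [sq_nonneg ‖u.snd.fst‖]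
  let r : Fin n → Joint dx dy := fun i => WithLp.toLp 2 (0, gradient (P.localG i) (X i).snd
    - gradient (P.localG i) (pair (X i).snd.fst (X i).fst))
  have hdec : (fun i => μ • upperDir (gradient (P.localF i)) (X i))
      = fun i => T (P.localDir γ μ i (X i)) + (-1 : ℝ) • r i := by
    ext1 i
    apply joint_ext
    · change μ • (0 : Vec dy) = 0 + (-1 : ℝ) • 0
      simp
    · change μ • (gradient (P.localF i) (X i).snd).fst
        = (μ • (gradient (P.localF i) (X i).snd).fst + (lowerDir γ (gradient (P.localG i)) (X i)).snd.fst
          - 0) + (-1 : ℝ) • ((gradient (P.localG i) (X i).snd).fst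
            - (gradient (P.localG i) (pair (X i).snd.fst (X i).fst)).fst)
      rw [lowerDir_snd_fst, neg_one_smul]
      abel
    · change μ • (gradient (P.localF i) (X i).snd).snd
        = (μ • (gradient (P.localF i) (X i).snd).snd + (lowerDir γ (gradient (P.localG i)) (X i)).snd.snd
          - (μ • (0 : Vec dy) + (lowerDir γ (gradient (P.localG i)) (X i)).fst))
          + (-1 : ℝ) • ((gradient (P.localG i) (X i).snd).snd
            - (gradient (P.localG i) (pair (X i).snd.fst (X i).fst)).snd)
      rw [lowerDir_snd_snd, lowerDir_fst, neg_one_smul, smul_zero, smul_sub, smul_sub]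
      abel
  have h1 : μ ^ 2 * disp (mix W fun i => upperDir (gradient (P.localF i)) (X i))
      = disp (mix W fun i => T (P.localDir γ μ i (X i)) + (-1 : ℝ) • r i) := by
    rw [← disp_smul, ← mix_smul, hdec]
  -- The ∇g_i of different agents need not be close, so r is controlled by its mean square: each r i
  -- is at most L₂‖y_i − θ_i‖.
  have h2 : disp (mix W fun i => (-1 : ℝ) • r i) ≤ msq r := by
    rw [mix_smul, disp_smul]
    have := disp_mix_le_disp hW hP.one_le hWd hρ r
    have := disp_le_msq hP.one_le r
    linarith
  have h3 : msq r ≤ L₂ ^ 2 * msq fun i => S (X i) := by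
    unfold msq
    rw [← avg_mul]
    refine avg_mono fun i => ?_
    have h4 := hP.smooth.lipschitz_g i (X i).snd (pair (X i).snd.fst (X i).fst)
    have h5 : ‖(X i).snd - pair (X i).snd.fst (X i).fst‖ = ‖S (X i)‖ :=
      norm_pair_sub_pair_right (X i).snd.fst (X i).snd.snd (X i).fst
    rw [h5] at h4
    have h6 : ‖r i‖ ≤ L₂ * ‖S (X i)‖ := by
      refine (norm_le_add_prod _).trans ?_
      change ‖(0 : Vec dy)‖ + _ ≤ _
      rw [norm_zero, zero_add]
      exact h4
    rw [← mul_pow]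
    exact pow_le_pow_left₀ (norm_nonneg _) h6 2
  have h4 : msq (fun i => S (X i)) ≤ 2 * disp X + ‖(avg X).snd.snd - (avg X).fst‖ ^ 2 := by
    rw [msq_eq_disp_add hP.one_le, ← map_avg]
    exact add_le_add (disp_map_le S hSn X) le_rfl
  have h5 : disp (mix W fun i => T (P.localDir γ μ i (X i)))
      ≤ 2 * disp (mix W fun i => P.localDir γ μ i (X i)) := by
    refine le_trans (le_of_eq ?_) (disp_map_le T hT _)
    congr 1
    ext1 i
    rw [map_mix]; rfl
  rw [h1, mix_add]
  refine (disp_add_le _ _).trans ?_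
  have h6 := mul_le_mul_of_nonneg_left h4 (sq_nonneg L₂)
  linarith

end Path

end SunDSBO

namespace SunDSBO

/-! ### Freezing an independent variable -/

lemma integrable_inner_of_memLp {Ω E : Type*} [MeasurableSpace Ω] {Pr : Measure Ω}
    [NormedAddCommGroup E] [InnerProductSpace ℝ E] {u v : Ω → E} (hu : MemLp u 2 Pr)
    (hv : MemLp v 2 Pr) : Integrable (fun ω => (inner ℝ (u ω) (v ω) : ℝ)) Pr := by
  refine (hu.integrable_norm_pow two_ne_zero |>.add (hv.integrable_norm_pow two_ne_zero)).mono'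
    (hu.aestronglyMeasurable.inner hv.aestronglyMeasurable) (Filter.Eventually.of_forall fun ω => ?_)
  have := abs_real_inner_le_norm (u ω) (v ω)
  simp only [Pi.add_apply, Real.norm_eq_abs]
  nlinarith [sq_nonneg (‖u ω‖ - ‖v ω‖)]

section Freezing

set_option linter.unusedSectionVars false

variable {Ω 𝒰 𝒵 E : Type*} [MeasurableSpace Ω] [MeasurableSpace 𝒰] [MeasurableSpace 𝒵]
  {Pr : Measure Ω} [IsProbabilityMeasure Pr]
  [NormedAddCommGroup E] [InnerProductSpace ℝ E] [MeasurableSpace E] [BorelSpace E]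
  [SecondCountableTopology E] [CompleteSpace E]
  {U : Ω → 𝒰} {ζ : Ω → 𝒵} (hU : Measurable U) (hζ : Measurable ζ) (hind : IndepFun U ζ Pr)
  {φ : 𝒰 × 𝒵 → E} (hφ : Measurable φ)

include hU hζ hind

lemma map_prodMk_eq : Pr.map (fun ω => (U ω, ζ ω)) = (Pr.map U).prod (Pr.map ζ) :=
  (indepFun_iff_map_prod_eq_prod_map_map hU.aemeasurable hζ.aemeasurable).1 hind

include hφ

/-- By independence the joint law is a product, so U may be frozen by Fubini and the bound, uniform
in u, survives the outer integration. -/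
lemma integrable_norm_sq_of_indepFun {σ : ℝ}
    (hint : ∀ u, Integrable (fun ω => ‖φ (u, ζ ω)‖ ^ 2) Pr)
    (hle : ∀ u, ∫ ω, ‖φ (u, ζ ω)‖ ^ 2 ∂Pr ≤ σ) :
    Integrable (fun ω => ‖φ (U ω, ζ ω)‖ ^ 2) Pr ∧ ∫ ω, ‖φ (U ω, ζ ω)‖ ^ 2 ∂Pr ≤ σ := by
  have : IsProbabilityMeasure (Pr.map U) := Measure.isProbabilityMeasure_map hU.aemeasurable
  have : IsProbabilityMeasure (Pr.map ζ) := Measure.isProbabilityMeasure_map hζ.aemeasurable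
  have hm : Measurable fun q : 𝒰 × 𝒵 => ‖φ q‖ ^ 2 := hφ.norm.pow_const 2
  have hfix : ∀ u, ∫ z, ‖φ (u, z)‖ ^ 2 ∂(Pr.map ζ) = ∫ ω, ‖φ (u, ζ ω)‖ ^ 2 ∂Pr := fun u =>
    integral_map hζ.aemeasurable (hm.comp measurable_prodMk_left).aestronglyMeasurable
  have hprod : Integrable (fun q : 𝒰 × 𝒵 => ‖φ q‖ ^ 2) ((Pr.map U).prod (Pr.map ζ)) := by
    rw [integrable_prod_iff hm.aestronglyMeasurable]
    refine ⟨Filter.Eventually.of_forall fun u => ?_, ?_⟩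
    · exact (integrable_map_measure (hm.comp measurable_prodMk_left).aestronglyMeasurable
        hζ.aemeasurable).2 (hint u)
    · refine Integrable.of_bound (hm.aestronglyMeasurable.norm.integral_prod_right') σ
        (Filter.Eventually.of_forall fun u => ?_)
      simp only [norm_pow, norm_norm]
      rw [Real.norm_eq_abs, abs_of_nonneg (integral_nonneg fun _ => by positivity), hfix]
      exact hle u
  have hmap := map_prodMk_eq hU hζ hind
  constructor
  · rw [← hmap] at hprod
    exact (integrable_map_measure hm.aestronglyMeasurable (hU.prodMk hζ).aemeasurable).1 hprod
  · rw [← integral_map (f := fun q => ‖φ q‖ ^ 2) (hU.prodMk hζ).aemeasurable hm.aestronglyMeasurable,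
      hmap, integral_prod _ hprod]
    calc ∫ u, ∫ z, ‖φ (u, z)‖ ^ 2 ∂(Pr.map ζ) ∂(Pr.map U) ≤ ∫ _, σ ∂(Pr.map U) := by
          refine integral_mono hprod.integral_prod_left (integrable_const _) fun u => ?_
          simp only [hfix]
          exact hle u
      _ = σ := by simp

/-- For frozen U the inner integral pairs the constant ψ(u) with a vector of mean zero. This serves
both the noise against functions of the state and the noises of two agents against each other. -/
lemma integral_inner_eq_zero_of_indepFun {ψ : 𝒰 → E} (hψ : Measurable ψ)
    (hψ2 : MemLp (fun ω => ψ (U ω)) 2 Pr) (hφ2 : MemLp (fun ω => φ (U ω, ζ ω)) 2 Pr)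
    (hint : ∀ u, Integrable (fun ω => φ (u, ζ ω)) Pr)
    (hzero : ∀ u, ∫ ω, φ (u, ζ ω) ∂Pr = 0) :
    ∫ ω, inner ℝ (ψ (U ω)) (φ (U ω, ζ ω)) ∂Pr = 0 := by
  have : IsProbabilityMeasure (Pr.map U) := Measure.isProbabilityMeasure_map hU.aemeasurable
  have : IsProbabilityMeasure (Pr.map ζ) := Measure.isProbabilityMeasure_map hζ.aemeasurable
  have hm : Measurable fun q : 𝒰 × 𝒵 => (inner ℝ (ψ q.1) (φ q) : ℝ) :=
    (hψ.comp measurable_fst).inner hφ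
  have hI : Integrable (fun ω => (inner ℝ (ψ (U ω)) (φ (U ω, ζ ω)) : ℝ)) Pr :=
    integrable_inner_of_memLp hψ2 hφ2
  have hmap := map_prodMk_eq hU hζ hind
  have hprod : Integrable (fun q : 𝒰 × 𝒵 => (inner ℝ (ψ q.1) (φ q) : ℝ))
      ((Pr.map U).prod (Pr.map ζ)) := by
    rw [← hmap]
    exact (integrable_map_measure hm.aestronglyMeasurable (hU.prodMk hζ).aemeasurable).2 hI
  rw [← integral_map (f := fun q : 𝒰 × 𝒵 => (inner ℝ (ψ q.1) (φ q) : ℝ))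
    (hU.prodMk hζ).aemeasurable hm.aestronglyMeasurable, hmap, integral_prod _ hprod]
  have h0 : ∀ u, ∫ z, (inner ℝ (ψ u) (φ (u, z)) : ℝ) ∂(Pr.map ζ) = 0 := by
    intro u
    have hs : AEStronglyMeasurable (fun z => φ (u, z)) (Pr.map ζ) :=
      (hφ.comp measurable_prodMk_left).aestronglyMeasurable
    rw [integral_inner ((integrable_map_measure hs hζ.aemeasurable).2 (hint u)),
      integral_map hζ.aemeasurable hs, hzero, inner_zero_right]
  simp [h0]

end Freezing

/-! ### Measurability of the directions -/

section Measurability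

variable {n dx dy : ℕ} {Ξf Ξg : Type*} [MeasurableSpace Ξf] [MeasurableSpace Ξg]
  {P : Problem n dx dy Ξf Ξg}

section WithLp

variable {α E F : Type*} [MeasurableSpace α] [MeasurableSpace E] [MeasurableSpace F]

lemma measurable_toLp_prod {u : α → E} {v : α → F} (hu : Measurable u) (hv : Measurable v) :
    Measurable fun x => (WithLp.toLp 2 (u x, v x) : WithLp 2 (E × F)) :=
  (WithLp.measurable_toLp 2 _).comp (hu.prodMk hv)

lemma measurable_fst_prod {u : α → WithLp 2 (E × F)} (hu : Measurable u) :
    Measurable fun x => (u x).fst :=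
  measurable_fst.comp ((WithLp.measurable_ofLp 2 _).comp hu)

lemma measurable_snd_prod {u : α → WithLp 2 (E × F)} (hu : Measurable u) :
    Measurable fun x => (u x).snd :=
  measurable_snd.comp ((WithLp.measurable_ofLp 2 _).comp hu)

end WithLp

lemma measurable_lowerDir {α : Type*} [MeasurableSpace α]
    {ψ : α → VecPair dx dy → VecPair dx dy} {v : α → Joint dx dy} (γ : ℝ) (hv : Measurable v)
    (hψ : ∀ {w : α → VecPair dx dy}, Measurable w → Measurable fun x => ψ x (w x)) :
    Measurable fun x => lowerDir γ (ψ x) (v x) := by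
  have hθ := measurable_fst_prod hv
  have hz := measurable_snd_prod hv
  have hx := measurable_fst_prod hz
  have hy := measurable_snd_prod hz
  have h1 := hψ hz
  have h2 := hψ (measurable_toLp_prod hx hθ)
  refine measurable_toLp_prod ((measurable_snd_prod h2).add ((hθ.sub hy).const_smul (1 / γ)))
    (measurable_toLp_prod ((measurable_fst_prod h1).sub (measurable_fst_prod h2))
      ((measurable_snd_prod h1).sub ((hy.sub hθ).const_smul (1 / γ))))

lemma Problem.Oracle.measurable_sampleDir {δf δg : ℝ} (hO : P.Oracle δf δg) {α : Type*}
    [MeasurableSpace α] (γ μ : ℝ) (i : Fin n) {v : α → Joint dx dy} {a : α → Ξf} {b : α → Ξg}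
    (hv : Measurable v) (ha : Measurable a) (hb : Measurable b) :
    Measurable fun x => P.sampleDir γ μ i (v x) (a x) (b x) := by
  refine Measurable.add (Measurable.const_smul (measurable_toLp_prod measurable_const ?_) μ)
    (measurable_lowerDir (ψ := fun x z => gradient (fun w => P.g i w (b x)) z) γ hv ?_)
  · exact (hO.measurable_grad_f i).comp ((measurable_snd_prod hv).prodMk ha)
  · intro w hw
    exact (hO.measurable_grad_g i).comp (hw.prodMk hb)

variable {L₁ L₂ γ Lθ : ℝ}

lemma Problem.Regular.continuous_localDir (hP : P.Regular L₁ L₂ γ Lθ) {μ : ℝ} (hμ : 0 ≤ μ)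
    (i : Fin n) : Continuous (P.localDir γ μ i) :=
  (LipschitzWith.of_dist_le_mul (K := ⟨dirConst L₁ L₂ γ μ, (hP.dirConst_pos hμ).le⟩) fun v w => by
    rw [dist_eq_norm, dist_eq_norm]; exact hP.localDir_lipschitz hμ le_rfl i v w).continuous

lemma continuous_of_norm_sub_le {E F : Type*} [NormedAddCommGroup E] [NormedAddCommGroup F]
    {f : E → F} {L : ℝ} (hL : 0 ≤ L) (h : ∀ x y, ‖f x - f y‖ ≤ L * ‖x - y‖) : Continuous f :=
  (LipschitzWith.of_dist_le_mul (K := ⟨L, hL⟩) fun v w => by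
    rw [dist_eq_norm, dist_eq_norm]; exact h v w).continuous

lemma Problem.Regular.continuous_gradF (hP : P.Regular L₁ L₂ γ Lθ) : Continuous P.gradF :=
  continuous_of_norm_sub_le hP.nonneg (hP.smooth.gradF_lipschitz hP.one_le)

lemma Problem.Regular.continuous_gradG (hP : P.Regular L₁ L₂ γ Lθ) : Continuous P.gradG :=
  continuous_of_norm_sub_le hP.pos.le (hP.smooth.gradG_lipschitz hP.one_le)

lemma Problem.Regular.continuous_thetaStar (hP : P.Regular L₁ L₂ γ Lθ) :
    Continuous (P.thetaStar γ) :=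
  continuous_of_norm_sub_le hP.Lθ_pos.le hP.lipschitz

lemma Problem.Regular.measurable_gradV (hP : P.Regular L₁ L₂ γ Lθ) :
    Measurable (P.gradV γ) := by
  have hx := measurable_fst_prod (measurable_id (α := VecPair dx dy))
  have hy := measurable_snd_prod (measurable_id (α := VecPair dx dy))
  have hθ := hP.continuous_thetaStar.measurable
  exact measurable_toLp_prod
    (measurable_fst_prod (hP.continuous_gradG.measurable.comp (measurable_toLp_prod hx hθ)))
    ((hy.sub hθ).const_smul (1 / γ))

lemma Problem.Regular.measurable_gradPenalized (hP : P.Regular L₁ L₂ γ Lθ) (μ : ℝ) :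
    Measurable (P.gradPenalized γ μ) :=
  ((hP.continuous_gradF.measurable.const_smul μ).add hP.continuous_gradG.measurable).sub
    hP.measurable_gradV

lemma Problem.Regular.measurable_gradLyap (hP : P.Regular L₁ L₂ γ Lθ) (μ : ℝ) :
    Measurable (P.gradLyap γ μ) := by
  have hθ := measurable_fst_prod (measurable_id (α := Joint dx dy))
  have hz := measurable_snd_prod (measurable_id (α := Joint dx dy))
  have hx := measurable_fst_prod hz
  have hy := measurable_snd_prod hz
  have hG := hP.continuous_gradG.measurable.comp (measurable_toLp_prod hx hθ)
  refine measurable_toLp_prod ((measurable_snd_prod hG).add ((hθ.sub hy).const_smul (1 / γ))) ?_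
  refine ((hP.measurable_gradPenalized μ).comp hz).add ((measurable_toLp_prod
    (measurable_fst_prod hG) ((hy.sub hθ).const_smul (1 / γ))).sub (hP.measurable_gradV.comp hz))

lemma Problem.Regular.measurable_lyap (hP : P.Regular L₁ L₂ γ Lθ) (μ Fl : ℝ) :
    Measurable (P.lyap γ μ Fl) := by
  have hθ := measurable_fst_prod (measurable_id (α := Joint dx dy))
  have hz := measurable_snd_prod (measurable_id (α := Joint dx dy))
  have hx := measurable_fst_prod hz
  have hy := measurable_snd_prod hz
  have hF : Measurable P.upper := (continuous_iff_continuousAt.2 fun w =>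
    (hP.smooth.hasGradientAt_upper w).continuousAt).measurable
  have hG : Measurable P.lower := (continuous_iff_continuousAt.2 fun w =>
    (hP.smooth.hasGradientAt_lower w).continuousAt).measurable
  have hV : Measurable (P.moreau γ) := (continuous_iff_continuousAt.2 fun w =>
    (hasGradientAt_moreau hP.smooth hP.one_le hP.pos hP.γ_pos hP.γ_lt hP.Lθ_pos hP.lipschitz
      w).continuousAt).measurable
  refine ((((hF.comp hz).sub_const Fl).const_mul μ).add ((hG.comp hz).sub (hV.comp hz))).add
    (Measurable.sub ?_ (hV.comp hz))
  exact (hG.comp (measurable_toLp_prod hx hθ)).add (((hθ.sub hy).norm.pow_const 2).const_mul _)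

end Measurability

/-! ### The noise of one direction -/

section Noise

variable {n dx dy : ℕ} {Ξf Ξg Ω : Type*} [MeasurableSpace Ξf] [MeasurableSpace Ξg]
  [MeasurableSpace Ω] {Pr : Measure Ω} [IsProbabilityMeasure Pr] {P : Problem n dx dy Ξf Ξg}
  {γ δf δg μ : ℝ} {ξf : ℕ → Fin n → Ω → Ξf} {ξg : ℕ → Fin n → Ω → Ξg}

/-- The noise of the stochastic direction of agent `i`. -/
noncomputable def Problem.noise (P : Problem n dx dy Ξf Ξg) (γ μ : ℝ) (i : Fin n)
    (v : Joint dx dy) (a : Ξf) (b : Ξg) : Joint dx dy :=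
  P.sampleDir γ μ i v a b - P.localDir γ μ i v

/-- The embedding of `(x, y)` directions. -/
noncomputable def embedParam (dx dy : ℕ) : VecPair dx dy →ₗ[ℝ] Joint dx dy where
  toFun z := WithLp.toLp 2 (0, z)
  map_add' u w := by apply joint_ext <;> simp
  map_smul' r u := by apply joint_ext <;> simp

/-- The contribution of the gradient at `(x, θ)` to the directions. -/
noncomputable def embedProx (dx dy : ℕ) : VecPair dx dy →ₗ[ℝ] Joint dx dy where
  toFun z := WithLp.toLp 2 (z.snd, pair (-z.fst) 0)
  map_add' u w := by apply joint_ext <;> (simp; try abel)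
  map_smul' r u := by apply joint_ext <;> simp

lemma norm_embedParam_sq (z : VecPair dx dy) : ‖embedParam dx dy z‖ ^ 2 = ‖z‖ ^ 2 := by
  rw [norm_sq_prod]
  change ‖(0 : Vec dy)‖ ^ 2 + ‖z‖ ^ 2 = _
  simp

lemma norm_embedProx_sq (z : VecPair dx dy) : ‖embedProx dx dy z‖ ^ 2 = ‖z‖ ^ 2 := by
  rw [norm_sq_prod, norm_sq_prod (_ : Joint dx dy).snd, norm_sq_prod z]
  change ‖z.snd‖ ^ 2 + (‖-z.fst‖ ^ 2 + ‖(0 : Vec dy)‖ ^ 2) = _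
  rw [norm_neg, norm_zero]
  ring

/-- The proximal terms are deterministic given v and cancel, so the noise is linear in three
gradient errors, each at a point that does not depend on the sample. -/
lemma noise_eq (i : Fin n) (v : Joint dx dy) (a : Ξf) (b : Ξg) :
    P.noise γ μ i v a b
      = μ • embedParam dx dy (gradient (fun w => P.f i w a) v.snd - gradient (P.localF i) v.snd)
        + embedParam dx dy (gradient (fun w => P.g i w b) v.snd - gradient (P.localG i) v.snd)
        + embedProx dx dy (gradient (fun w => P.g i w b) (pair v.snd.fst v.fst)
          - gradient (P.localG i) (pair v.snd.fst v.fst)) := by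
  have key : ∀ ψ : VecPair dx dy → VecPair dx dy, lowerDir γ ψ v
      = embedParam dx dy (ψ v.snd) + embedProx dx dy (ψ (pair v.snd.fst v.fst))
        + lowerDir γ (fun _ => 0) v := by
    intro ψ
    apply joint_ext
    · change _ = 0 + (ψ (pair v.snd.fst v.fst)).snd + (0 + (1 / γ) • (v.fst - v.snd.snd))
      rw [lowerDir_fst, zero_add, zero_add]
    · change _ = (ψ v.snd).fst + - (ψ (pair v.snd.fst v.fst)).fst + ((0 : Vec dx) - 0)
      rw [lowerDir_snd_fst]; abel
    · change _ = (ψ v.snd).snd + 0 + (0 - (1 / γ) • (v.snd.snd - v.fst))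
      rw [lowerDir_snd_snd]; abel
  have key2 : ∀ φ : VecPair dx dy → VecPair dx dy, upperDir φ v = embedParam dx dy (φ v.snd) :=
    fun _ => rfl
  simp only [Problem.noise, Problem.sampleDir, Problem.localDir]
  rw [key, key (gradient (P.localG i)), key2, key2, map_sub, map_sub, map_sub, smul_sub]
  abel

omit [IsProbabilityMeasure Pr] in
lemma integral_combination_eq_zero {E F : Type*} [NormedAddCommGroup E] [InnerProductSpace ℝ E]
    [FiniteDimensional ℝ E] [NormedAddCommGroup F] [InnerProductSpace ℝ F] [CompleteSpace F]
    (c : ℝ) (T R : E →ₗ[ℝ] F) {u v w : Ω → E} (hu : Integrable u Pr) (hv : Integrable v Pr)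
    (hw : Integrable w Pr) (hu0 : ∫ ω, u ω ∂Pr = 0) (hv0 : ∫ ω, v ω ∂Pr = 0)
    (hw0 : ∫ ω, w ω ∂Pr = 0) :
    Integrable (fun ω => c • T (u ω) + T (v ω) + R (w ω)) Pr ∧
      ∫ ω, (c • T (u ω) + T (v ω) + R (w ω)) ∂Pr = 0 := by
  have : CompleteSpace E := FiniteDimensional.complete ℝ E
  have h1 : Integrable (fun ω => c • T (u ω)) Pr := (T.toContinuousLinearMap.integrable_comp hu).smul c
  have h2 : Integrable (fun ω => T (v ω)) Pr := T.toContinuousLinearMap.integrable_comp hv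
  have h3 : Integrable (fun ω => R (w ω)) Pr := R.toContinuousLinearMap.integrable_comp hw
  have e1 : ∫ ω, T (u ω) ∂Pr = T (∫ ω, u ω ∂Pr) := T.toContinuousLinearMap.integral_comp_comm hu
  have e2 : ∫ ω, T (v ω) ∂Pr = T (∫ ω, v ω ∂Pr) := T.toContinuousLinearMap.integral_comp_comm hv
  have e3 : ∫ ω, R (w ω) ∂Pr = R (∫ ω, w ω ∂Pr) := R.toContinuousLinearMap.integral_comp_comm hw
  have h12 : Integrable (fun ω => c • T (u ω) + T (v ω)) Pr := h1.add h2
  refine ⟨h12.add h3, ?_⟩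
  rw [integral_add h12 h3, integral_add h1 h2, integral_smul, e1, e2, e3, hu0, hv0, hw0]
  simp

variable (hO : P.Oracle δf δg) (hS : P.Sampling Pr ξf ξg)

include hS

omit [IsProbabilityMeasure Pr] in
lemma Problem.Sampling.integral_f {E : Type*} [NormedAddCommGroup E] [NormedSpace ℝ E]
    (k : ℕ) (i : Fin n) {h : Ξf → E} (hh : Integrable h (P.νf i)) :
    Integrable (fun ω => h (ξf k i ω)) Pr ∧ ∫ ω, h (ξf k i ω) ∂Pr = ∫ a, h a ∂(P.νf i) := by
  have hm := hS.law_f k i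
  rw [← hm.map_eq] at hh ⊢
  exact ⟨(integrable_map_measure hh.aestronglyMeasurable hm.measurable.aemeasurable).1 hh,
    (integral_map hm.measurable.aemeasurable hh.aestronglyMeasurable).symm⟩

omit [IsProbabilityMeasure Pr] in
lemma Problem.Sampling.integral_g {E : Type*} [NormedAddCommGroup E] [NormedSpace ℝ E]
    (k : ℕ) (i : Fin n) {h : Ξg → E} (hh : Integrable h (P.νg i)) :
    Integrable (fun ω => h (ξg k i ω)) Pr ∧ ∫ ω, h (ξg k i ω) ∂Pr = ∫ b, h b ∂(P.νg i) := by
  have hm := hS.law_g k i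
  rw [← hm.map_eq] at hh ⊢
  exact ⟨(integrable_map_measure hh.aestronglyMeasurable hm.measurable.aemeasurable).1 hh,
    (integral_map hm.measurable.aemeasurable hh.aestronglyMeasurable).symm⟩

include hO

lemma centered_f (k : ℕ) (i : Fin n) (z : VecPair dx dy) :
    Integrable (fun ω => gradient (fun w => P.f i w (ξf k i ω)) z - gradient (P.localF i) z) Pr ∧
    ∫ ω, (gradient (fun w => P.f i w (ξf k i ω)) z - gradient (P.localF i) z) ∂Pr = 0 := by
  obtain ⟨h1, h2⟩ := hS.integral_f k i (hO.integrable_grad_f i z)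
  refine ⟨h1.sub (integrable_const _), ?_⟩
  rw [integral_sub h1 (integrable_const _), h2, hO.unbiased_f]
  simp

lemma centered_g (k : ℕ) (i : Fin n) (z : VecPair dx dy) :
    Integrable (fun ω => gradient (fun w => P.g i w (ξg k i ω)) z - gradient (P.localG i) z) Pr ∧
    ∫ ω, (gradient (fun w => P.g i w (ξg k i ω)) z - gradient (P.localG i) z) ∂Pr = 0 := by
  obtain ⟨h1, h2⟩ := hS.integral_g k i (hO.integrable_grad_g i z)
  refine ⟨h1.sub (integrable_const _), ?_⟩
  rw [integral_sub h1 (integrable_const _), h2, hO.unbiased_g]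
  simp

omit [IsProbabilityMeasure Pr] in
lemma variance_f_le (k : ℕ) (i : Fin n) (z : VecPair dx dy) :
    Integrable (fun ω => ‖gradient (fun w => P.f i w (ξf k i ω)) z
      - gradient (P.localF i) z‖ ^ 2) Pr ∧
    ∫ ω, ‖gradient (fun w => P.f i w (ξf k i ω)) z - gradient (P.localF i) z‖ ^ 2 ∂Pr
      ≤ δf ^ 2 := by
  obtain ⟨h1, h2⟩ := hS.integral_f k i (hO.integrable_sq_f i z)
  simp only [norm_sub_rev (gradient (P.localF i) z)] at h1 h2
  refine ⟨h1, h2.trans_le ?_⟩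
  simpa only [norm_sub_rev (gradient (P.localF i) z)] using hO.variance_f i z

omit [IsProbabilityMeasure Pr] in
lemma variance_g_le (k : ℕ) (i : Fin n) (z : VecPair dx dy) :
    Integrable (fun ω => ‖gradient (fun w => P.g i w (ξg k i ω)) z
      - gradient (P.localG i) z‖ ^ 2) Pr ∧
    ∫ ω, ‖gradient (fun w => P.g i w (ξg k i ω)) z - gradient (P.localG i) z‖ ^ 2 ∂Pr
      ≤ δg ^ 2 := by
  obtain ⟨h1, h2⟩ := hS.integral_g k i (hO.integrable_sq_g i z)
  simp only [norm_sub_rev (gradient (P.localG i) z)] at h1 h2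
  refine ⟨h1, h2.trans_le ?_⟩
  simpa only [norm_sub_rev (gradient (P.localG i) z)] using hO.variance_g i z

lemma integral_noise (γ μ : ℝ) (k : ℕ) (i : Fin n) (v : Joint dx dy) :
    Integrable (fun ω => P.noise γ μ i v (ξf k i ω) (ξg k i ω)) Pr ∧
    ∫ ω, P.noise γ μ i v (ξf k i ω) (ξg k i ω) ∂Pr = 0 := by
  obtain ⟨hf, hf0⟩ := centered_f hO hS k i v.snd
  obtain ⟨hg, hg0⟩ := centered_g hO hS k i v.snd
  obtain ⟨hp, hp0⟩ := centered_g hO hS k i (pair v.snd.fst v.fst)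
  simp only [noise_eq]
  exact integral_combination_eq_zero μ _ _ hf hg hp hf0 hg0 hp0

/-- The noise level of the directions. -/
noncomputable def noiseLevel (μ₀ δf δg : ℝ) : ℝ := (3 * μ₀ ^ 2 + 6) * (δf ^ 2 + δg ^ 2)

/-- The same ξg enters at (x, y) and at (x, θ), and ξf may depend on ξg within a pair. The three
errors are therefore separated by the factor 3 only: 3μ₀²δf² + 6δg². -/
lemma integral_noise_sq_le (γ : ℝ) {μ μ₀ : ℝ} (hμ : 0 ≤ μ) (hμ' : μ ≤ μ₀) (k : ℕ) (i : Fin n)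
    (v : Joint dx dy) :
    Integrable (fun ω => ‖P.noise γ μ i v (ξf k i ω) (ξg k i ω)‖ ^ 2) Pr ∧
    ∫ ω, ‖P.noise γ μ i v (ξf k i ω) (ξg k i ω)‖ ^ 2 ∂Pr ≤ noiseLevel μ₀ δf δg := by
  obtain ⟨hf, hf0⟩ := variance_f_le hO hS k i v.snd
  obtain ⟨hg, hg0⟩ := variance_g_le hO hS k i v.snd
  obtain ⟨hp, hp0⟩ := variance_g_le hO hS k i (pair v.snd.fst v.fst)
  have hle : ∀ ω, ‖P.noise γ μ i v (ξf k i ω) (ξg k i ω)‖ ^ 2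
      ≤ 3 * (μ₀ ^ 2 * ‖gradient (fun w => P.f i w (ξf k i ω)) v.snd
          - gradient (P.localF i) v.snd‖ ^ 2)
        + 3 * ‖gradient (fun w => P.g i w (ξg k i ω)) v.snd - gradient (P.localG i) v.snd‖ ^ 2
        + 3 * ‖gradient (fun w => P.g i w (ξg k i ω)) (pair v.snd.fst v.fst)
          - gradient (P.localG i) (pair v.snd.fst v.fst)‖ ^ 2 := by
    intro ω
    rw [noise_eq]
    refine (norm_add₃_sq_le _ _ _).trans ?_
    rw [norm_smul, mul_pow, Real.norm_eq_abs, sq_abs, norm_embedParam_sq, norm_embedParam_sq,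
      norm_embedProx_sq]
    gcongr
  have hb := (((hf.const_mul (μ₀ ^ 2)).const_mul 3).add (hg.const_mul 3)).add (hp.const_mul 3)
  have hint : Integrable (fun ω => ‖P.noise γ μ i v (ξf k i ω) (ξg k i ω)‖ ^ 2) Pr := by
    refine hb.mono' (((integral_noise hO hS γ μ k i v).1.aestronglyMeasurable.norm).pow 2)
      (Filter.Eventually.of_forall fun ω => ?_)
    rw [Real.norm_eq_abs, abs_of_nonneg (by positivity)]
    exact hle ω
  refine ⟨hint, (integral_mono hint hb hle).trans ?_⟩
  rw [integral_add' (((hf.const_mul (μ₀ ^ 2)).const_mul 3).add (hg.const_mul 3)) (hp.const_mul 3),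
    integral_add' ((hf.const_mul (μ₀ ^ 2)).const_mul 3) (hg.const_mul 3), integral_const_mul,
    integral_const_mul, integral_const_mul, integral_const_mul, noiseLevel]
  nlinarith [mul_le_mul_of_nonneg_left hf0 (sq_nonneg μ₀), sq_nonneg μ₀, sq_nonneg δf,
    sq_nonneg δg, mul_nonneg (sq_nonneg μ₀) (sq_nonneg δg)]

end Noise

end SunDSBO

namespace SunDSBO

/-! ### The algorithm as a stochastic process -/

section Run

variable {n dx dy : ℕ} {Ξf Ξg Ω : Type*} [MeasurableSpace Ξf] [MeasurableSpace Ξg]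

/-- The state before iteration `k`, as a function of the sample path. -/
noncomputable def Problem.process (P : Problem n dx dy Ξf Ξg) (W : Matrix (Fin n) (Fin n) ℝ)
    (γ lt cl : ℝ) (μ : ℕ → ℝ) (init : Fin n → Triple dx dy) (ξf : ℕ → Fin n → Ω → Ξf)
    (ξg : ℕ → Fin n → Ω → Ξg) (k : ℕ) (ω : Ω) : State n dx dy :=
  P.run W γ lt (cl * lt) μ init (fun m i => ξf m i ω) (fun m i => ξg m i ω) k

/-- The noise of the stochastic direction of agent `i` in iteration `k`. -/
noncomputable def Problem.noiseAt (P : Problem n dx dy Ξf Ξg) (W : Matrix (Fin n) (Fin n) ℝ)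
    (γ lt cl : ℝ) (μ : ℕ → ℝ) (init : Fin n → Triple dx dy) (ξf : ℕ → Fin n → Ω → Ξf)
    (ξg : ℕ → Fin n → Ω → Ξg) (k : ℕ) (i : Fin n) (ω : Ω) : Joint dx dy :=
  P.noise γ (μ k) i ((P.process W γ lt cl μ init ξf ξg k ω).pos i) (ξf k i ω) (ξg k i ω)

variable {P : Problem n dx dy Ξf Ξg} {W : Matrix (Fin n) (Fin n) ℝ}
  {γ lt cl : ℝ} {μ : ℕ → ℝ} {init : Fin n → Triple dx dy} {ξf : ℕ → Fin n → Ω → Ξf}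
  {ξg : ℕ → Fin n → Ω → Ξg} {δf δg μ₀ L₁ L₂ Lθ : ℝ}

lemma process_est_succ (k : ℕ) (ω : Ω) (i : Fin n) :
    (P.process W γ lt cl μ init ξf ξg (k + 1) ω).est i
      = P.localDir γ (μ k) i ((P.process W γ lt cl μ init ξf ξg k ω).pos i)
        + P.noiseAt W γ lt cl μ init ξf ξg k i ω := by
  rw [Problem.process, run_est, Problem.noiseAt, Problem.noise, add_sub_cancel]
  rfl

lemma measurable_mix {mΩ : MeasurableSpace Ω} {u : Ω → Fin n → Joint dx dy}
    (hu : ∀ i, Measurable fun ω => u ω i) (i : Fin n) : Measurable fun ω => mix W (u ω) i :=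
  Finset.measurable_sum _ fun j _ => (hu j).const_smul (W i j)

lemma measurable_scale {mΩ : MeasurableSpace Ω} {u : Ω → Joint dx dy} (hu : Measurable u) :
    Measurable fun ω => scale cl (u ω) :=
  measurable_toLp_prod (measurable_fst_prod hu) ((measurable_snd_prod hu).const_smul cl)

lemma memLp_comp_of_norm_sub_le {E F : Type*} [NormedAddCommGroup E] [NormedAddCommGroup F]
    {mΩ : MeasurableSpace Ω} {Pr : Measure Ω} [IsFiniteMeasure Pr] {f : E → F} {L : ℝ}
    (hL : 0 ≤ L) (h : ∀ x y, ‖f x - f y‖ ≤ L * ‖x - y‖) {X : Ω → E} (hX : MemLp X 2 Pr) :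
    MemLp (fun ω => f (X ω)) 2 Pr := by
  have h0 : MemLp (fun ω => f (X ω) - f 0) 2 Pr := by
    refine hX.of_le_mul (c := L) (((continuous_of_norm_sub_le hL h).comp_aestronglyMeasurable
      hX.aestronglyMeasurable).sub aestronglyMeasurable_const) (Filter.Eventually.of_forall fun ω => ?_)
    simpa using h (X ω) 0
  have h1 : MemLp (fun _ : Ω => f 0) 2 Pr := memLp_const _
  exact (h0.add h1).congr_norm (by
    simpa using (continuous_of_norm_sub_le hL h).comp_aestronglyMeasurable hX.aestronglyMeasurable)
    (Filter.Eventually.of_forall fun ω => by simp)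

lemma memLp_scale {mΩ : MeasurableSpace Ω} {Pr : Measure Ω} [IsFiniteMeasure Pr]
    {u : Ω → Joint dx dy} (hcl : 0 ≤ cl) (hu : MemLp u 2 Pr) :
    MemLp (fun ω => scale cl (u ω)) 2 Pr :=
  memLp_comp_of_norm_sub_le (f := scale cl) (L := 1 + cl) (by linarith)
    (fun v w => by rw [← map_sub]; exact norm_scale_le hcl _) hu

lemma memLp_mix {mΩ : MeasurableSpace Ω} {Pr : Measure Ω} {u : Ω → Fin n → Joint dx dy}
    (hu : ∀ i, MemLp (fun ω => u ω i) 2 Pr) (i : Fin n) : MemLp (fun ω => mix W (u ω) i) 2 Pr :=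
  memLp_finsetSum _ fun j _ => (hu j).const_smul (W i j)

/-- The state before iteration `k` is a function of the earlier samples. -/
lemma measurable_process {mΩ : MeasurableSpace Ω} (hO : P.Oracle δf δg) (k : ℕ)
    (h : ∀ j < k, ∀ i, Measurable (ξf j i) ∧ Measurable (ξg j i)) :
    (∀ i, Measurable fun ω => (P.process W γ lt cl μ init ξf ξg k ω).pos i) ∧
    (∀ i, Measurable fun ω => (P.process W γ lt cl μ init ξf ξg k ω).dir i) ∧
    (∀ i, Measurable fun ω => (P.process W γ lt cl μ init ξf ξg k ω).est i) := by
  induction k with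
  | zero =>
    exact ⟨fun i => measurable_const (a := (init i).toJoint),
      fun i => measurable_const (a := (⟨0, 0, 0⟩ : Triple dx dy).toJoint),
      fun i => measurable_const (a := (⟨0, 0, 0⟩ : Triple dx dy).toJoint)⟩
  | succ k ih =>
    obtain ⟨h1, h2, h3⟩ := ih fun j hj => h j (hj.trans k.lt_succ_self)
    have he : ∀ i, Measurable fun ω => (P.process W γ lt cl μ init ξf ξg (k + 1) ω).est i := by
      intro i
      simp only [Problem.process, run_est]
      exact hO.measurable_sampleDir γ (μ k) i (h1 i) (h k k.lt_succ_self i).1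
        (h k k.lt_succ_self i).2
    have hd : ∀ i, Measurable fun ω => (P.process W γ lt cl μ init ξf ξg (k + 1) ω).dir i := by
      intro i
      have := measurable_mix (W := W) (fun j => (h2 j).add ((he j).sub (h3 j))) i
      simp only [Problem.process, run_dir] at this ⊢
      exact this
    refine ⟨fun i => ?_, hd, he⟩
    have := measurable_mix (W := W)
      (fun j => (h1 j).sub ((measurable_scale (cl := cl) (hd j)).const_smul lt)) i
    simp only [Problem.process, run_pos] at this ⊢
    exact this

variable [mΩ : MeasurableSpace Ω] {Pr : Measure Ω} [IsProbabilityMeasure Pr]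

omit [IsProbabilityMeasure Pr] in
/-- The samples of one agent in one iteration are independent of the earlier samples and of the
samples of the other agents in that iteration. -/
lemma Problem.Sampling.exists_past (hS : P.Sampling Pr ξf ξg) (k : ℕ) (i : Fin n) :
    ∃ 𝓕 : MeasurableSpace Ω, 𝓕 ≤ mΩ ∧
      (∀ j < k, ∀ i', Measurable[𝓕] (ξf j i') ∧ Measurable[𝓕] (ξg j i')) ∧
      (∀ j, j ≠ i → Measurable[𝓕] (ξf k j) ∧ Measurable[𝓕] (ξg k j)) ∧
      Indep 𝓕 (MeasurableSpace.comap (fun ω => (ξf k i ω, ξg k i ω)) inferInstance) Pr := by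
  classical
  -- All indices up to iteration k except (k, i). Keeping the other agents of iteration k in the
  -- past makes the same σ-algebra serve for the cross terms between agents.
  let S : Finset (ℕ × Fin n) := Finset.range (k + 1) ×ˢ Finset.univ \ {(k, i)}
  let ζ : ℕ × Fin n → Ω → Ξf × Ξg := fun q ω => (ξf q.1 q.2 ω, ξg q.1 q.2 ω)
  have hζ : ∀ q, Measurable (ζ q) := fun q =>
    (hS.law_f q.1 q.2).measurable.prodMk (hS.law_g q.1 q.2).measurable
  have hind := hS.indep.indepFun_finset S {(k, i)} Finset.sdiff_disjoint hζ
  let Z : Ω → (s : S) → Ξf × Ξg := fun ω s => ζ s ω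
  have hmem : ∀ q ∈ S, Measurable[MeasurableSpace.comap Z inferInstance] (ζ q) := by
    intro q hq
    have hZ : Measurable[MeasurableSpace.comap Z inferInstance] Z := comap_measurable Z
    exact (measurable_pi_apply (⟨q, hq⟩ : S)).comp hZ
  refine ⟨MeasurableSpace.comap Z inferInstance, ?_, ?_, ?_, ?_⟩
  · exact (measurable_pi_lambda Z fun s => hζ s).comap_le
  · intro j hj i'
    have := hmem (j, i') (by simp [S]; omega)
    exact ⟨measurable_fst.comp this, measurable_snd.comp this⟩
  · intro j hj
    have := hmem (k, j) (by simp [S, hj])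
    exact ⟨measurable_fst.comp this, measurable_snd.comp this⟩
  · have h2 : IndepFun Z (ζ (k, i)) Pr :=
      hind.comp (φ := id)
        (ψ := fun (z : ({(k, i)} : Finset (ℕ × Fin n)) → Ξf × Ξg) =>
          z ⟨(k, i), Finset.mem_singleton_self _⟩)
        measurable_id (measurable_pi_apply _)
    exact h2

variable (hP : P.Regular L₁ L₂ γ Lθ) (hO : P.Oracle δf δg) (hS : P.Sampling Pr ξf ξg)
  (hμ : ∀ k, 0 ≤ μ k) (hμ' : ∀ k, μ k ≤ μ₀)

include hP hμ in
lemma Problem.Regular.measurable_noise {α : Type*} {mα : MeasurableSpace α} {v : α → Joint dx dy}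
    {a : α → Ξf} {b : α → Ξg} (hO : P.Oracle δf δg) (k : ℕ) (i : Fin n) (hv : Measurable v)
    (ha : Measurable a) (hb : Measurable b) :
    Measurable fun x => P.noise γ (μ k) i (v x) (a x) (b x) :=
  (hO.measurable_sampleDir γ (μ k) i hv ha hb).sub
    ((hP.continuous_localDir (hμ k) i).measurable.comp hv)

omit [IsProbabilityMeasure Pr] in
include hO hS in
lemma indepFun_pos (k : ℕ) (i : Fin n) :
    Measurable (fun ω => (P.process W γ lt cl μ init ξf ξg k ω).pos) ∧
    IndepFun (fun ω => (P.process W γ lt cl μ init ξf ξg k ω).pos)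
      (fun ω => (ξf k i ω, ξg k i ω)) Pr := by
  obtain ⟨𝓕, hle, hpast, -, hind⟩ := hS.exists_past k i
  -- `measurable_process` is applied with the σ-algebra 𝓕 in place of the ambient one, which
  -- expresses that the state depends on earlier samples only.
  have hpos : Measurable[𝓕] fun ω => (P.process W γ lt cl μ init ξf ξg k ω).pos :=
    @measurable_pi_lambda _ _ _ 𝓕 _ _ (measurable_process (mΩ := 𝓕) hO k hpast).1
  exact ⟨hpos.mono hle le_rfl, indep_of_indep_of_le_left hind hpos.comap_le⟩

-- The noise of agent j depends on the past and on the samples of j in iteration k. The past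
-- σ-algebra of (k, i) contains all of these, and the position of agent i as well.
omit [IsProbabilityMeasure Pr] in
include hP hO hS hμ in
lemma indepFun_noiseAt (k : ℕ) {i j : Fin n} (hij : j ≠ i) :
    Measurable (fun ω => ((P.process W γ lt cl μ init ξf ξg k ω).pos i,
      P.noiseAt W γ lt cl μ init ξf ξg k j ω)) ∧
    IndepFun (fun ω => ((P.process W γ lt cl μ init ξf ξg k ω).pos i,
      P.noiseAt W γ lt cl μ init ξf ξg k j ω)) (fun ω => (ξf k i ω, ξg k i ω)) Pr := by
  obtain ⟨𝓕, hle, hpast, hother, hind⟩ := hS.exists_past k i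
  have hp := (measurable_process (mΩ := 𝓕) (P := P) (W := W) (γ := γ) (lt := lt) (cl := cl)
    (μ := μ) (init := init) hO k hpast).1
  have hε : Measurable[𝓕] (P.noiseAt W γ lt cl μ init ξf ξg k j) :=
    hP.measurable_noise (mα := 𝓕) hμ hO k j (hp j) (hother j hij).1 (hother j hij).2
  have hU : Measurable[𝓕] fun ω => ((P.process W γ lt cl μ init ξf ξg k ω).pos i,
      P.noiseAt W γ lt cl μ init ξf ξg k j ω) :=
    (hp i).prodMk hε
  exact ⟨hU.mono hle le_rfl, indep_of_indep_of_le_left hind hU.comap_le⟩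

omit [IsProbabilityMeasure Pr] in
include hS in
lemma Problem.Sampling.measurable_pair (k : ℕ) (i : Fin n) :
    Measurable fun ω => (ξf k i ω, ξg k i ω) :=
  (hS.law_f k i).measurable.prodMk (hS.law_g k i).measurable

include hP hO hS hμ hμ'

lemma memLp_noiseAt (k : ℕ) (i : Fin n) :
    MemLp (P.noiseAt W γ lt cl μ init ξf ξg k i) 2 Pr ∧
      ∫ ω, ‖P.noiseAt W γ lt cl μ init ξf ξg k i ω‖ ^ 2 ∂Pr ≤ noiseLevel μ₀ δf δg := by
  obtain ⟨hposm, hind⟩ := indepFun_pos (W := W) (γ := γ) (lt := lt) (cl := cl) (μ := μ)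
    (init := init) hO hS k i
  have hζ := hS.measurable_pair k i
  have hφ : Measurable fun q : (Fin n → Joint dx dy) × (Ξf × Ξg) =>
      P.noise γ (μ k) i (q.1 i) q.2.1 q.2.2 :=
    hP.measurable_noise hμ hO k i ((measurable_pi_apply i).comp measurable_fst) measurable_snd.fst
      measurable_snd.snd
  have h := integrable_norm_sq_of_indepFun hposm hζ hind hφ (σ := noiseLevel μ₀ δf δg)
    (fun u => (integral_noise_sq_le hO hS γ (hμ k) (hμ' k) k i (u i)).1)
    (fun u => (integral_noise_sq_le hO hS γ (hμ k) (hμ' k) k i (u i)).2)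
  refine ⟨?_, h.2⟩
  rw [memLp_two_iff_integrable_sq_norm]
  · exact h.1
  · exact (hφ.comp (hposm.prodMk hζ)).aestronglyMeasurable

lemma integral_inner_noiseAt (k : ℕ) (i : Fin n) {ψ : (Fin n → Joint dx dy) → Joint dx dy}
    (hψ : Measurable ψ)
    (hψ2 : MemLp (fun ω => ψ (P.process W γ lt cl μ init ξf ξg k ω).pos) 2 Pr) :
    ∫ ω, inner ℝ (ψ (P.process W γ lt cl μ init ξf ξg k ω).pos)
      (P.noiseAt W γ lt cl μ init ξf ξg k i ω) ∂Pr = 0 := by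
  obtain ⟨hposm, hind⟩ := indepFun_pos (W := W) (γ := γ) (lt := lt) (cl := cl) (μ := μ)
    (init := init) hO hS k i
  have hζ := hS.measurable_pair k i
  have hφ : Measurable fun q : (Fin n → Joint dx dy) × (Ξf × Ξg) =>
      P.noise γ (μ k) i (q.1 i) q.2.1 q.2.2 :=
    hP.measurable_noise hμ hO k i ((measurable_pi_apply i).comp measurable_fst) measurable_snd.fst
      measurable_snd.snd
  exact integral_inner_eq_zero_of_indepFun hposm hζ hind hφ hψ hψ2 (memLp_noiseAt hP hO hS hμ hμ' k i).1
    (fun u => (integral_noise hO hS γ (μ k) k i (u i)).1)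
    (fun u => (integral_noise hO hS γ (μ k) k i (u i)).2)

lemma integral_inner_noiseAt_noiseAt (k : ℕ) {i j : Fin n} (hij : j ≠ i) :
    ∫ ω, inner ℝ (P.noiseAt W γ lt cl μ init ξf ξg k j ω)
      (P.noiseAt W γ lt cl μ init ξf ξg k i ω) ∂Pr = 0 := by
  obtain ⟨hU, hind⟩ := indepFun_noiseAt (W := W) (lt := lt) (cl := cl) (init := init)
    hP hO hS hμ k hij
  have hζ := hS.measurable_pair k i
  have hφ : Measurable fun q : (Joint dx dy × Joint dx dy) × (Ξf × Ξg) =>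
      P.noise γ (μ k) i q.1.1 q.2.1 q.2.2 :=
    hP.measurable_noise hμ hO k i measurable_fst.fst measurable_snd.fst measurable_snd.snd
  exact integral_inner_eq_zero_of_indepFun hU hζ hind hφ measurable_snd (memLp_noiseAt hP hO hS hμ hμ' k j).1 (memLp_noiseAt hP hO hS hμ hμ' k i).1
    (fun u => (integral_noise hO hS γ (μ k) k i u.1).1)
    (fun u => (integral_noise hO hS γ (μ k) k i u.1).2)

/-- The noise of the averaged direction has the variance of one agent divided by `n`. -/
lemma integral_norm_avg_noiseAt_sq_le (k : ℕ) :
    ∫ ω, ‖avg fun i => P.noiseAt W γ lt cl μ init ξf ξg k i ω‖ ^ 2 ∂Pr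
      ≤ noiseLevel μ₀ δf δg / n := by
  have hn : (0 : ℝ) < n := by have := hP.one_le; positivity
  set ε := P.noiseAt W γ lt cl μ init ξf ξg k with hε
  have h2 := fun i => memLp_noiseAt (W := W) (lt := lt) (cl := cl) (init := init) hP hO hS hμ hμ' k i
  have hI : ∀ i j, Integrable (fun ω => (inner ℝ (ε i ω) (ε j ω) : ℝ)) Pr := fun i j =>
    integrable_inner_of_memLp (h2 i).1 (h2 j).1
  have e1 : ∀ ω, ‖avg fun i => ε i ω‖ ^ 2
      = (1 / (n : ℝ)) ^ 2 * ∑ i, ∑ j, (inner ℝ (ε i ω) (ε j ω) : ℝ) := by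
    intro ω
    rw [avg, norm_smul, mul_pow, Real.norm_eq_abs, sq_abs, ← real_inner_self_eq_norm_sq, sum_inner]
    simp_rw [inner_sum]
  simp_rw [e1]
  rw [integral_const_mul, integral_finsetSum _ fun i _ => integrable_finsetSum _ fun j _ => hI i j]
  have e2 : ∀ i, ∫ ω, ∑ j, (inner ℝ (ε i ω) (ε j ω) : ℝ) ∂Pr ≤ noiseLevel μ₀ δf δg := by
    intro i
    rw [integral_finsetSum _ fun j _ => hI i j, Finset.sum_eq_single i]
    · simp_rw [real_inner_self_eq_norm_sq]
      exact (h2 i).2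
    · intro j _ hj
      exact integral_inner_noiseAt_noiseAt hP hO hS hμ hμ' k hj.symm
    · simp
  calc (1 / (n : ℝ)) ^ 2 * ∑ i, ∫ ω, ∑ j, (inner ℝ (ε i ω) (ε j ω) : ℝ) ∂Pr
      ≤ (1 / (n : ℝ)) ^ 2 * ∑ _i : Fin n, noiseLevel μ₀ δf δg := by
        gcongr with i
        exact e2 i
    _ = noiseLevel μ₀ δf δg / n := by simp; field_simp

/-- Square-integrability of the process. -/
lemma memLp_process (hcl : 0 ≤ cl) (k : ℕ) :
    (∀ i, MemLp (fun ω => (P.process W γ lt cl μ init ξf ξg k ω).pos i) 2 Pr) ∧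
    (∀ i, MemLp (fun ω => (P.process W γ lt cl μ init ξf ξg k ω).dir i) 2 Pr) ∧
    (∀ i, MemLp (fun ω => (P.process W γ lt cl μ init ξf ξg k ω).est i) 2 Pr) := by
  induction k with
  | zero =>
    exact ⟨fun i => memLp_const (init i).toJoint,
      fun i => memLp_const (⟨0, 0, 0⟩ : Triple dx dy).toJoint,
      fun i => memLp_const (⟨0, 0, 0⟩ : Triple dx dy).toJoint⟩
  | succ k ih =>
    obtain ⟨h1, h2, h3⟩ := ih
    have he : ∀ i, MemLp (fun ω => (P.process W γ lt cl μ init ξf ξg (k + 1) ω).est i) 2 Pr := by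
      intro i
      simp only [process_est_succ]
      refine MemLp.add ?_ (memLp_noiseAt hP hO hS hμ hμ' k i).1
      exact memLp_comp_of_norm_sub_le (hP.dirConst_pos ((hμ k).trans (hμ' k))).le
        (hP.localDir_lipschitz (hμ k) (hμ' k) i) (h1 i)
    have hd : ∀ i, MemLp (fun ω => (P.process W γ lt cl μ init ξf ξg (k + 1) ω).dir i) 2 Pr := by
      intro i
      have := memLp_mix (W := W) (fun j => (h2 j).add ((he j).sub (h3 j))) i
      simp only [Problem.process, run_dir] at this ⊢
      exact this
    refine ⟨fun i => ?_, hd, he⟩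
    have := memLp_mix (W := W) (fun j => (h1 j).sub ((memLp_scale hcl (hd j)).const_smul lt)) i
    simp only [Problem.process, run_pos] at this ⊢
    exact this

end Run

end SunDSBO

namespace SunDSBO

/-! ### Recursions in expectation -/

section Integrability

variable {n : ℕ} {Ω E : Type*} [NormedAddCommGroup E] [InnerProductSpace ℝ E]
  {mΩ : MeasurableSpace Ω} {Pr : Measure Ω}

lemma memLp_avg {u : Ω → Fin n → E} (hu : ∀ i, MemLp (fun ω => u ω i) 2 Pr) :
    MemLp (fun ω => avg (u ω)) 2 Pr :=
  (memLp_finsetSum Finset.univ fun i _ => hu i).const_smul (1 / (n : ℝ))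

lemma integrable_avg {u : Ω → Fin n → ℝ} (hu : ∀ i, Integrable (fun ω => u ω i) Pr) :
    Integrable (fun ω => avg (u ω)) Pr :=
  (integrable_finsetSum Finset.univ fun i _ => hu i).const_mul (1 / (n : ℝ))

lemma integral_avg {u : Ω → Fin n → ℝ} (hu : ∀ i, Integrable (fun ω => u ω i) Pr) :
    ∫ ω, avg (u ω) ∂Pr = avg fun i => ∫ ω, u ω i ∂Pr := by
  simp only [avg, smul_eq_mul]
  rw [integral_const_mul, integral_finsetSum _ fun i _ => hu i]

omit [InnerProductSpace ℝ E] in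
lemma integrable_norm_sq {u : Ω → E} (hu : MemLp u 2 Pr) : Integrable (fun ω => ‖u ω‖ ^ 2) Pr :=
  hu.integrable_norm_pow two_ne_zero

omit [InnerProductSpace ℝ E] in
lemma integrable_msq {u : Ω → Fin n → E} (hu : ∀ i, MemLp (fun ω => u ω i) 2 Pr) :
    Integrable (fun ω => msq (u ω)) Pr :=
  integrable_avg fun i => integrable_norm_sq (hu i)

lemma integrable_disp {u : Ω → Fin n → E} (hu : ∀ i, MemLp (fun ω => u ω i) 2 Pr) :
    Integrable (fun ω => disp (u ω)) Pr :=
  integrable_msq fun i => (hu i).sub (memLp_avg hu)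

omit [InnerProductSpace ℝ E] in
lemma integral_msq_le (hn : 1 ≤ n) {u : Ω → Fin n → E} (hu : ∀ i, MemLp (fun ω => u ω i) 2 Pr)
    {c : ℝ} (h : ∀ i, ∫ ω, ‖u ω i‖ ^ 2 ∂Pr ≤ c) : ∫ ω, msq (u ω) ∂Pr ≤ c := by
  unfold msq
  rw [integral_avg fun i => integrable_norm_sq (hu i)]
  exact (avg_mono h).trans_eq (avg_const hn c)

lemma msq_add₃_le (u v w : Fin n → E) :
    msq (fun i => u i + v i + w i) ≤ 3 * msq u + 3 * msq v + 3 * msq w := by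
  unfold msq
  rw [← avg_mul, ← avg_mul, ← avg_mul, ← avg_add (E := ℝ), ← avg_add (E := ℝ)]
  exact avg_mono fun i => norm_add₃_sq_le _ _ _

end Integrability

section Expectation

variable {n dx dy : ℕ} {Ξf Ξg Ω : Type*} [MeasurableSpace Ξf] [MeasurableSpace Ξg]
  {P : Problem n dx dy Ξf Ξg} {W : Matrix (Fin n) (Fin n) ℝ} (hW : W.IsHermitian)
  {γ lt cl : ℝ} {μ : ℕ → ℝ} {init : Fin n → Triple dx dy} {ξf : ℕ → Fin n → Ω → Ξf}
  {ξg : ℕ → Fin n → Ω → Ξg} {δf δg μ₀ L₁ L₂ Lθ Fl : ℝ}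
  [mΩ : MeasurableSpace Ω] {Pr : Measure Ω} [IsProbabilityMeasure Pr]

local notation "𝓢" => Problem.process P W γ lt cl μ init ξf ξg
local notation "𝓔" => Problem.noiseAt P W γ lt cl μ init ξf ξg

omit mΩ in
lemma process_zero_pos (ω : Ω) : (𝓢 0 ω).pos = fun i => (init i).toJoint := rfl

variable (hP : P.Regular L₁ L₂ γ Lθ) (hWd : W ∈ doublyStochastic ℝ (Fin n))
  (hρ : connectivity W hW < 1) (hcl : 0 ≤ cl)

include hP hWd hρ hcl

omit mΩ in
/-- Pathwise recursion for the dispersion of the tracked directions. -/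
lemma disp_process_dir_succ_le (hμ : ∀ k, 0 ≤ μ k) (hμ' : ∀ k, μ k ≤ μ₀) (k : ℕ) (ω : Ω) :
    disp (𝓢 (k + 2) ω).dir ≤ (1 - (1 - connectivity W hW) / 2) * disp (𝓢 (k + 1) ω).dir
      + 2 / (1 - connectivity W hW) * (6 * msq (fun i => 𝓔 (k + 1) i ω) + 6 * msq (fun i => 𝓔 k i ω)
        + 12 * dirConst L₁ L₂ γ μ₀ ^ 2 * (2 * disp (𝓢 (k + 1) ω).pos + 2 * disp (𝓢 k ω).pos
          + (1 + cl) ^ 2 * lt ^ 2 * ‖avg (𝓢 (k + 1) ω).dir‖ ^ 2)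
        + 12 * (μ (k + 1) - μ k) ^ 2 * L₁ ^ 2 * (2 * disp (𝓢 k ω).pos + 2 * disp (𝓢 0 ω).pos
          + k * ∑ j ∈ Finset.range k, (1 + cl) ^ 2 * lt ^ 2 * ‖avg (𝓢 (j + 1) ω).dir‖ ^ 2)
        + 2 * (μ (k + 1) - μ k) ^ 2
          * disp (mix W fun i => upperDir (gradient (P.localF i)) (init i).toJoint)) := by
  set ν := μ (k + 1) - μ k with hν
  -- The part of the increment caused by the change of μ, frozen at the initial point. It must stay
  -- inside `mix`: only its mixed dispersion is bounded later, whereas N may be estimated by its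
  -- mean square.
  let A : Fin n → Joint dx dy := fun i => upperDir (gradient (P.localF i)) (init i).toJoint
  let inc : Fin n → Joint dx dy := fun i => P.localDir γ (μ (k + 1)) i ((𝓢 (k + 1) ω).pos i)
    - P.localDir γ (μ k) i ((𝓢 k ω).pos i) - ν • A i
  let N : Fin n → Joint dx dy := fun i => 𝓔 (k + 1) i ω + -𝓔 k i ω + inc i
  have hdiff : ∀ i, (𝓢 (k + 2) ω).est i - (𝓢 (k + 1) ω).est i = N i + ν • A i := by
    intro i
    rw [process_est_succ, process_est_succ]
    simp only [N, inc]
    abel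
  have hdir : (𝓢 (k + 2) ω).dir = mix W fun i => (𝓢 (k + 1) ω).dir i + (N i + ν • A i) := by
    simp only [← hdiff]
    exact run_dir (k + 1)
  rw [hdir]
  refine (disp_mix_add_le hW hP.one_le hWd hρ _ _).trans ?_
  have hτ : (0 : ℝ) < 1 - connectivity W hW := by linarith
  refine add_le_add le_rfl (mul_le_mul_of_nonneg_left ?_ (by positivity))
  rw [mix_add, mix_smul]
  refine (disp_add_le _ _).trans ?_
  rw [disp_smul]
  have h1 : disp (mix W N) ≤ msq N :=
    (disp_mix_le_disp hW hP.one_le hWd hρ N).trans (disp_le_msq hP.one_le N)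
  have h2 : msq N ≤ 3 * msq (fun i => 𝓔 (k + 1) i ω) + 3 * msq (fun i => 𝓔 k i ω) + 3 * msq inc := by
    refine (msq_add₃_le _ _ _).trans_eq ?_
    simp only [msq, norm_neg]
  have h3 : msq inc ≤ 2 * dirConst L₁ L₂ γ μ₀ ^ 2 * msq (fun i => (𝓢 (k + 1) ω).pos i - (𝓢 k ω).pos i)
      + 2 * ν ^ 2 * L₁ ^ 2 * msq (fun i => (𝓢 k ω).pos i - (𝓢 0 ω).pos i) := by
    unfold msq
    rw [← avg_mul, ← avg_mul, ← avg_add (E := ℝ)]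
    refine avg_mono fun i => ?_
    refine (hP.norm_localDir_increment_sq_le (hμ (k + 1)) (hμ' (k + 1)) i _ _ _).trans_eq ?_
    rw [process_zero_pos]
    ring
  have h4 := msq_sub_le hP.one_le (𝓢 (k + 1) ω).pos (𝓢 k ω).pos
  have h5 := msq_sub_le hP.one_le (𝓢 k ω).pos (𝓢 0 ω).pos
  have h6 : ‖avg (𝓢 (k + 1) ω).pos - avg (𝓢 k ω).pos‖ ^ 2
      ≤ (1 + cl) ^ 2 * lt ^ 2 * ‖avg (𝓢 (k + 1) ω).dir‖ ^ 2 :=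
    norm_avg_run_pos_sub_sq_le hWd hcl k
  have h7 : ‖avg (𝓢 k ω).pos - avg (𝓢 0 ω).pos‖ ^ 2 ≤ k * ∑ j ∈ Finset.range k,
      (1 + cl) ^ 2 * lt ^ 2 * ‖avg (𝓢 (j + 1) ω).dir‖ ^ 2 :=
    norm_avg_run_pos_sub_init_sq_le hWd hcl k
  have h8 := mul_le_mul_of_nonneg_left (h4.trans (add_le_add le_rfl h6))
    (by positivity : 0 ≤ 12 * dirConst L₁ L₂ γ μ₀ ^ 2)
  have h9 := mul_le_mul_of_nonneg_left (h5.trans (add_le_add le_rfl h7))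
    (by positivity : 0 ≤ 12 * ν ^ 2 * L₁ ^ 2)
  linarith

variable (hO : P.Oracle δf δg) (hS : P.Sampling Pr ξf ξg)
  (hμ : ∀ k, 0 ≤ μ k) (hμ' : ∀ k, μ k ≤ μ₀)

include hO hS hμ hμ'

lemma expected_disp_pos_succ_le (k : ℕ) :
    ∫ ω, disp (𝓢 (k + 1) ω).pos ∂Pr
      ≤ (1 - (1 - connectivity W hW) / 2) * ∫ ω, disp (𝓢 k ω).pos ∂Pr
        + 2 / (1 - connectivity W hW) * ((1 + cl) ^ 2 * lt ^ 2
          * ∫ ω, disp (𝓢 (k + 1) ω).dir ∂Pr) := by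
  have hm := fun k => memLp_process (W := W) (lt := lt) (cl := cl) (init := init) hP hO hS hμ hμ' hcl k
  have i1 := integrable_disp (hm k).1
  have i2 := integrable_disp (hm (k + 1)).1
  have i3 := integrable_disp (hm (k + 1)).2.1
  rw [← integral_const_mul, ← integral_const_mul, ← integral_const_mul,
    ← integral_add (i1.const_mul _) ((i3.const_mul _).const_mul _)]
  refine integral_mono i2 ((i1.const_mul _).add ((i3.const_mul _).const_mul _)) fun ω => ?_
  exact disp_run_pos_succ_le hW hP.one_le hWd hρ hcl k

lemma expected_disp_dir_succ_le (k : ℕ) :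
    ∫ ω, disp (𝓢 (k + 2) ω).dir ∂Pr
      ≤ (1 - (1 - connectivity W hW) / 2) * ∫ ω, disp (𝓢 (k + 1) ω).dir ∂Pr
      + 2 / (1 - connectivity W hW) * (12 * noiseLevel μ₀ δf δg
        + 12 * dirConst L₁ L₂ γ μ₀ ^ 2 * (2 * ∫ ω, disp (𝓢 (k + 1) ω).pos ∂Pr
          + 2 * ∫ ω, disp (𝓢 k ω).pos ∂Pr
          + (1 + cl) ^ 2 * lt ^ 2 * ∫ ω, ‖avg (𝓢 (k + 1) ω).dir‖ ^ 2 ∂Pr)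
        + 12 * (μ (k + 1) - μ k) ^ 2 * L₁ ^ 2 * (2 * ∫ ω, disp (𝓢 k ω).pos ∂Pr
          + 2 * ∫ ω, disp (𝓢 0 ω).pos ∂Pr
          + k * ∑ j ∈ Finset.range k, (1 + cl) ^ 2 * lt ^ 2
            * ∫ ω, ‖avg (𝓢 (j + 1) ω).dir‖ ^ 2 ∂Pr)
        + 2 * (μ (k + 1) - μ k) ^ 2
          * disp (mix W fun i => upperDir (gradient (P.localF i)) (init i).toJoint)) := by
  have hm := fun k => memLp_process (W := W) (lt := lt) (cl := cl) (init := init) hP hO hS hμ hμ' hcl k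
  have hε := fun k i => memLp_noiseAt (W := W) (lt := lt) (cl := cl) (init := init) hP hO hS hμ hμ' k i
  have ip := fun k => integrable_disp (hm k).1
  have id := fun k => integrable_disp (hm k).2.1
  have ia := fun k => integrable_norm_sq (memLp_avg (hm k).2.1)
  have ie := fun k => integrable_msq (u := fun ω i => 𝓔 k i ω) fun i => (hε k i).1
  have hσ := fun k => integral_msq_le hP.one_le (u := fun ω i => 𝓔 k i ω) (fun i => (hε k i).1)
    fun i => (hε k i).2
  have hτ : (0 : ℝ) < 1 - connectivity W hW := by linarith
  set Z := disp (mix W fun i => upperDir (gradient (P.localF i)) (init i).toJoint)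
  set c1 := 12 * dirConst L₁ L₂ γ μ₀ ^ 2
  set c2 := 12 * (μ (k + 1) - μ k) ^ 2 * L₁ ^ 2
  set c3 := (1 + cl) ^ 2 * lt ^ 2
  set c4 := 2 * (μ (k + 1) - μ k) ^ 2
  have j1 : Integrable (fun ω => 6 * msq (fun i => 𝓔 (k + 1) i ω) + 6 * msq (fun i => 𝓔 k i ω)) Pr :=
    ((ie (k + 1)).const_mul 6).add ((ie k).const_mul 6)
  have j2a : Integrable (fun ω => 2 * disp (𝓢 (k + 1) ω).pos + 2 * disp (𝓢 k ω).pos) Pr :=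
    ((ip (k + 1)).const_mul 2).add ((ip k).const_mul 2)
  have j2 : Integrable (fun ω => 2 * disp (𝓢 (k + 1) ω).pos + 2 * disp (𝓢 k ω).pos
      + c3 * ‖avg (𝓢 (k + 1) ω).dir‖ ^ 2) Pr := j2a.add ((ia (k + 1)).const_mul c3)
  have j3a : Integrable (fun ω => 2 * disp (𝓢 k ω).pos + 2 * disp (𝓢 0 ω).pos) Pr :=
    ((ip k).const_mul 2).add ((ip 0).const_mul 2)
  have j3b : Integrable (fun ω => ∑ j ∈ Finset.range k, c3 * ‖avg (𝓢 (j + 1) ω).dir‖ ^ 2) Pr :=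
    integrable_finsetSum _ fun j _ => (ia (j + 1)).const_mul c3
  have j3 : Integrable (fun ω => 2 * disp (𝓢 k ω).pos + 2 * disp (𝓢 0 ω).pos
      + k * ∑ j ∈ Finset.range k, c3 * ‖avg (𝓢 (j + 1) ω).dir‖ ^ 2) Pr :=
    j3a.add (j3b.const_mul (k : ℝ))
  have j12 := j1.add (j2.const_mul c1)
  have j123 := j12.add (j3.const_mul c2)
  have jall := j123.add (integrable_const (μ := Pr) (c4 * Z))
  have hle := integral_mono (id (k + 2))
    (((id (k + 1)).const_mul (1 - (1 - connectivity W hW) / 2)).add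
      (jall.const_mul (2 / (1 - connectivity W hW)))) fun ω =>
    disp_process_dir_succ_le hW hP hWd hρ hcl hμ hμ' k ω
  refine hle.trans ?_
  rw [integral_add' ((id (k + 1)).const_mul _) (jall.const_mul _), integral_const_mul,
    integral_const_mul, integral_add' j123 (integrable_const _),
    integral_add' j12 (j3.const_mul c2), integral_add' j1 (j2.const_mul c1),
    integral_add ((ie (k + 1)).const_mul 6) ((ie k).const_mul 6), integral_const_mul,
    integral_const_mul, integral_const_mul, integral_const_mul,
    integral_add j2a ((ia (k + 1)).const_mul c3),
    integral_add ((ip (k + 1)).const_mul 2) ((ip k).const_mul 2),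
    integral_add j3a (j3b.const_mul (k : ℝ)),
    integral_add ((ip k).const_mul 2) ((ip 0).const_mul 2), integral_const_mul,
    integral_const_mul, integral_const_mul, integral_const_mul, integral_const_mul,
    integral_finsetSum _ fun j _ => (ia (j + 1)).const_mul c3]
  simp only [integral_const_mul, integral_const, probReal_univ, one_smul]
  have h0 := hσ k
  have h1 := hσ (k + 1)
  gcongr
  linarith

omit mΩ [IsProbabilityMeasure Pr] hP hW hρ hcl hO hS hμ hμ' in
/-- Decomposition of the averaged direction. -/
lemma avg_process_dir_succ (k : ℕ) (ω : Ω) :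
    avg (𝓢 (k + 1) ω).dir = P.meanDir γ (μ k) (avg (𝓢 k ω).pos)
      + ((avg fun i => P.localDir γ (μ k) i ((𝓢 k ω).pos i))
        - P.meanDir γ (μ k) (avg (𝓢 k ω).pos)) + avg fun i => 𝓔 k i ω := by
  have h1 : avg (𝓢 (k + 1) ω).dir = avg (𝓢 (k + 1) ω).est := avg_run_dir hWd (k + 1)
  have h2 : (𝓢 (k + 1) ω).est = fun i => P.localDir γ (μ k) i ((𝓢 k ω).pos i) + 𝓔 k i ω :=
    funext fun i => process_est_succ k ω i
  rw [h1, h2, avg_add]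
  abel

omit hW hWd hρ in
lemma memLp_meanDir (k : ℕ) : MemLp (fun ω => P.meanDir γ (μ k) (avg (𝓢 k ω).pos)) 2 Pr := by
  have hm := memLp_process (W := W) (lt := lt) (cl := cl) (init := init) hP hO hS hμ hμ' hcl k
  exact memLp_comp_of_norm_sub_le (hP.dirConst_pos ((hμ k).trans (hμ' k))).le
    (hP.meanDir_lipschitz (hμ k) (hμ' k)) (memLp_avg hm.1)

omit hW hρ in
lemma expected_norm_avg_dir_sq_le (k : ℕ) :
    ∫ ω, ‖avg (𝓢 (k + 1) ω).dir‖ ^ 2 ∂Pr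
      ≤ 3 * ∫ ω, ‖P.meanDir γ (μ k) (avg (𝓢 k ω).pos)‖ ^ 2 ∂Pr
        + 3 * (dirConst L₁ L₂ γ μ₀ ^ 2 * ∫ ω, disp (𝓢 k ω).pos ∂Pr)
        + 3 * (noiseLevel μ₀ δf δg / n) := by
  have hm := fun k => memLp_process (W := W) (lt := lt) (cl := cl) (init := init) hP hO hS hμ hμ' hcl k
  have hε := fun i => memLp_noiseAt (W := W) (lt := lt) (cl := cl) (init := init) hP hO hS hμ hμ' k i
  have i1 := integrable_norm_sq (memLp_meanDir (W := W) (lt := lt) (init := init) hP hcl hO hS hμ hμ' k)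
  have i2 := integrable_disp (hm k).1
  have i3 := integrable_norm_sq (memLp_avg (u := fun ω i => 𝓔 k i ω) fun i => (hε i).1)
  have h3 := integral_norm_avg_noiseAt_sq_le (W := W) (lt := lt) (cl := cl) (init := init)
    hP hO hS hμ hμ' k
  have j12 := (i1.const_mul 3).add ((i2.const_mul (dirConst L₁ L₂ γ μ₀ ^ 2)).const_mul 3)
  have hle := integral_mono (integrable_norm_sq (memLp_avg (hm (k + 1)).2.1))
    (j12.add (i3.const_mul 3)) fun ω => by
      change ‖avg (𝓢 (k + 1) ω).dir‖ ^ 2 ≤ 3 * ‖P.meanDir γ (μ k) (avg (𝓢 k ω).pos)‖ ^ 2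
        + 3 * (dirConst L₁ L₂ γ μ₀ ^ 2 * disp (𝓢 k ω).pos) + 3 * ‖avg fun i => 𝓔 k i ω‖ ^ 2
      rw [avg_process_dir_succ hWd k ω]
      refine (norm_add₃_sq_le _ _ _).trans ?_
      have := hP.norm_avg_localDir_sub_sq_le (hμ k) (hμ' k) (𝓢 k ω).pos
      gcongr
  refine hle.trans ?_
  rw [integral_add' j12 (i3.const_mul 3), integral_add' (i1.const_mul 3)
    ((i2.const_mul _).const_mul 3), integral_const_mul, integral_const_mul, integral_const_mul,
    integral_const_mul]
  gcongr

/-- As D̂⁻¹ = D⁻¹ = 0, the first tracked direction is D⁰ = W D̂⁰, that is, the mixed expected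
directions at the initial point plus mixed noise. The left side is deterministic, so the comparison
may be integrated over the sample path. -/
lemma initial_heterogeneity_le :
    μ 0 ^ 2 * disp (mix W fun i => upperDir (gradient (P.localF i)) (init i).toJoint)
      ≤ 8 * ∫ ω, disp (𝓢 1 ω).dir ∂Pr + 8 * noiseLevel μ₀ δf δg
        + 2 * L₂ ^ 2 * (2 * disp (fun i => (init i).toJoint)
          + ‖(avg fun i => (init i).toJoint).snd.snd - (avg fun i => (init i).toJoint).fst‖ ^ 2) := by
  have hm := memLp_process (W := W) (lt := lt) (cl := cl) (init := init) hP hO hS hμ hμ' hcl 1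
  have hε := fun i => memLp_noiseAt (W := W) (lt := lt) (cl := cl) (init := init) hP hO hS hμ hμ' 0 i
  have i1 := integrable_disp hm.2.1
  have i2 := integrable_msq (u := fun ω i => 𝓔 0 i ω) fun i => (hε i).1
  have h2 := integral_msq_le hP.one_le (u := fun ω i => 𝓔 0 i ω) (fun i => (hε i).1)
    fun i => (hε i).2
  have h0 := hP.disp_mix_upperDir_le hW hWd hρ (μ 0) fun i => (init i).toJoint
  have h1 : disp (mix W fun i => P.localDir γ (μ 0) i (init i).toJoint)
      ≤ 2 * ∫ ω, disp (𝓢 1 ω).dir ∂Pr + 2 * ∫ ω, msq (fun i => 𝓔 0 i ω) ∂Pr := by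
    have hle := integral_mono (integrable_const (μ := Pr)
      (disp (mix W fun i => P.localDir γ (μ 0) i (init i).toJoint)))
      ((i1.const_mul 2).add (i2.const_mul 2)) fun ω => by
        change disp (mix W fun i => P.localDir γ (μ 0) i (init i).toJoint)
          ≤ 2 * disp (𝓢 1 ω).dir + 2 * msq (fun i => 𝓔 0 i ω)
        have e1 : (𝓢 1 ω).dir = mix W fun i => P.localDir γ (μ 0) i (init i).toJoint + 𝓔 0 i ω := by
          have : (𝓢 1 ω).dir = mix W fun j => (𝓢 0 ω).dir j + ((𝓢 1 ω).est j - (𝓢 0 ω).est j) :=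
            run_dir 0
          rw [this]
          congr 1
          ext1 i
          have hd : (𝓢 0 ω).dir i = 0 := rfl
          have he : (𝓢 0 ω).est i = 0 := rfl
          rw [hd, he, zero_add, sub_zero, process_est_succ]
          rfl
        have e2 : (mix W fun i => P.localDir γ (μ 0) i (init i).toJoint)
            = fun i => (𝓢 1 ω).dir i + (-1 : ℝ) • mix W (fun i => 𝓔 0 i ω) i := by
          rw [e1, mix_add]
          ext1 i
          simp
        rw [e2]
        refine (disp_add_le _ _).trans ?_
        rw [disp_smul]
        have a1 := disp_mix_le_disp hW hP.one_le hWd hρ (fun i => 𝓔 0 i ω)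
        have a2 := disp_le_msq hP.one_le (fun i => 𝓔 0 i ω)
        linarith
    rw [integral_add' (i1.const_mul 2) (i2.const_mul 2), integral_const_mul,
      integral_const_mul] at hle
    simpa using hle
  linarith

end Expectation

end SunDSBO

namespace SunDSBO

/-! ### Decrease of the Lyapunov function in expectation -/

lemma inner_scale {dx dy : ℕ} (c : ℝ) (v w : Joint dx dy) :
    inner ℝ v (scale c w) = inner ℝ (scale c v) w := by
  rw [inner_prod v, inner_prod (scale c v), scale_fst, scale_snd, scale_fst, scale_snd,
    real_inner_smul_left, real_inner_smul_right]

lemma inner_avg {n : ℕ} {E : Type*} [NormedAddCommGroup E] [InnerProductSpace ℝ E] (v : E)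
    (u : Fin n → E) : inner ℝ v (avg u) = avg fun i => (inner ℝ v (u i) : ℝ) := by
  simp [avg, real_inner_smul_right, inner_sum]

section LyapunovExpectation

variable {n dx dy : ℕ} {Ξf Ξg Ω : Type*} [MeasurableSpace Ξf] [MeasurableSpace Ξg]
  {P : Problem n dx dy Ξf Ξg} {W : Matrix (Fin n) (Fin n) ℝ}
  {γ lt cl : ℝ} {μ : ℕ → ℝ} {init : Fin n → Triple dx dy} {ξf : ℕ → Fin n → Ω → Ξf}
  {ξg : ℕ → Fin n → Ω → Ξg} {δf δg μ₀ L₁ L₂ Lθ Fl : ℝ}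
  [mΩ : MeasurableSpace Ω] {Pr : Measure Ω} [IsProbabilityMeasure Pr]

local notation "𝓢" => Problem.process P W γ lt cl μ init ξf ξg
local notation "𝓔" => Problem.noiseAt P W γ lt cl μ init ξf ξg

/-- ∇Ψ is the (x, y) part of the mean direction plus the bias, and the bias costs 2 · 5 times the
square of the θ part. This yields integrability of ‖∇Ψ‖². -/
lemma Problem.Regular.norm_gradPenalized_sq_le (hP : P.Regular L₁ L₂ γ Lθ) (μ : ℝ)
    (v : Joint dx dy) :
    ‖P.gradPenalized γ μ v.snd‖ ^ 2 ≤ 10 * ‖P.meanDir γ μ v‖ ^ 2 := by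
  have h := hP.norm_bias_sq_le v
  have e : P.gradPenalized γ μ v.snd = (P.meanDir γ μ v).snd
      + (P.proxGradParam γ v.snd v.fst - P.gradV γ v.snd) := by
    rw [meanDir_snd]; abel
  rw [e, norm_sq_prod (P.meanDir γ μ v), meanDir_fst]
  have := norm_add_sq_le (P.meanDir γ μ v).snd (P.proxGradParam γ v.snd v.fst - P.gradV γ v.snd)
  nlinarith [sq_nonneg ‖(P.meanDir γ μ v).snd‖]

/-- The Lyapunov function is nonnegative and, by its expansion at 0, grows at most quadratically. -/
lemma Problem.Regular.integrable_lyap (hP : P.Regular L₁ L₂ γ Lθ) {μ : ℝ} (hμ : 0 ≤ μ)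
    (hFl : ∀ z, Fl ≤ P.upper z) {X : Ω → Joint dx dy} (hX : MemLp X 2 Pr) :
    Integrable (fun ω => P.lyap γ μ Fl (X ω)) Pr := by
  set N := P.gradLyap γ μ 0
  set C := lyapConst L₁ L₂ γ Lθ μ
  have hb : Integrable (fun ω => P.lyap γ μ Fl 0 + ‖N‖ * ‖X ω‖ + C * ‖X ω‖ ^ 2) Pr :=
    ((integrable_const _).add ((hX.integrable one_le_two).norm.const_mul _)).add
      ((integrable_norm_sq hX).const_mul C)
  refine hb.mono' ((hP.measurable_lyap μ Fl).comp_aemeasurable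
    hX.aestronglyMeasurable.aemeasurable).aestronglyMeasurable (Filter.Eventually.of_forall fun ω => ?_)
  rw [Real.norm_eq_abs, abs_of_nonneg (hP.lyap_nonneg hμ hFl _)]
  have h := hP.lyap_le (Fl := Fl) hμ le_rfl 0 (X ω)
  rw [sub_zero] at h
  have := real_inner_le_norm N (X ω)
  linarith

variable (hP : P.Regular L₁ L₂ γ Lθ) (hWd : W ∈ doublyStochastic ℝ (Fin n))
  (hcl : 0 < cl) (hO : P.Oracle δf δg) (hS : P.Sampling Pr ξf ξg)
  (hμ : ∀ k, 0 ≤ μ k) (hμ' : ∀ k, μ k ≤ μ₀)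

include hP hcl hO hS hμ hμ'

lemma integrable_gradPenalized_sq (k : ℕ) :
    Integrable (fun ω => ‖P.gradPenalized γ (μ k) (avg (𝓢 k ω).pos).snd‖ ^ 2) Pr := by
  have hm := memLp_process (W := W) (lt := lt) (cl := cl) (init := init) hP hO hS hμ hμ' hcl.le k
  have h := integrable_norm_sq
    (memLp_meanDir (W := W) (lt := lt) (init := init) hP hcl.le hO hS hμ hμ' k)
  have hX : AEMeasurable (fun ω => avg (𝓢 k ω).pos) Pr :=
    (memLp_avg hm.1).aestronglyMeasurable.aemeasurable
  refine (h.const_mul 10).mono' ?_ (Filter.Eventually.of_forall fun ω => ?_)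
  · exact ((((hP.measurable_gradPenalized (μ k)).comp
      (measurable_snd_prod measurable_id)).comp_aemeasurable hX).norm.pow_const 2).aestronglyMeasurable
  · rw [Real.norm_eq_abs, abs_of_nonneg (by positivity)]
    exact hP.norm_gradPenalized_sq_le (μ k) _

/-- The noise does not contribute to the first-order change of the Lyapunov function. -/
lemma integral_inner_gradLyap_noise (k : ℕ) :
    Integrable (fun ω => (inner ℝ (P.gradLyap γ (μ k) (avg (𝓢 k ω).pos))
      (scale cl (avg fun i => 𝓔 k i ω)) : ℝ)) Pr ∧
    ∫ ω, inner ℝ (P.gradLyap γ (μ k) (avg (𝓢 k ω).pos))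
      (scale cl (avg fun i => 𝓔 k i ω)) ∂Pr = 0 := by
  have hm := memLp_process (W := W) (lt := lt) (cl := cl) (init := init) hP hO hS hμ hμ' hcl.le k
  have hε := fun i => memLp_noiseAt (W := W) (lt := lt) (cl := cl) (init := init) hP hO hS hμ hμ' k i
  have hmd := memLp_meanDir (W := W) (lt := lt) (init := init) hP hcl.le hO hS hμ hμ' k
  have hX : AEMeasurable (fun ω => avg (𝓢 k ω).pos) Pr :=
    (memLp_avg hm.1).aestronglyMeasurable.aemeasurable
  have hN : MemLp (fun ω => P.gradLyap γ (μ k) (avg (𝓢 k ω).pos)) 2 Pr := by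
    -- The squared norms compare with the factor 41, and 41 ≤ 7².
    refine hmd.of_le_mul (c := 7) ((hP.measurable_gradLyap (μ k)).comp_aemeasurable
      hX).aestronglyMeasurable (Filter.Eventually.of_forall fun ω => ?_)
    refine (abs_le_of_sq_le_sq' ?_ (by positivity)).2
    rw [mul_pow]
    have := hP.norm_gradLyap_sq_le (μ k) (avg (𝓢 k ω).pos)
    nlinarith [sq_nonneg ‖P.meanDir γ (μ k) (avg (𝓢 k ω).pos)‖]
  have hψ : MemLp (fun ω => scale cl (P.gradLyap γ (μ k) (avg (𝓢 k ω).pos))) 2 Pr :=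
    memLp_scale hcl.le hN
  have hψm : Measurable fun X : Fin n → Joint dx dy => scale cl (P.gradLyap γ (μ k) (avg X)) := by
    refine measurable_scale ((hP.measurable_gradLyap (μ k)).comp ?_)
    exact (Finset.measurable_sum _ fun i _ => measurable_pi_apply i).const_smul (1 / (n : ℝ))
  have hI := fun i => integrable_inner_of_memLp hψ (hε i).1
  have h0 := fun i => integral_inner_noiseAt (W := W) (lt := lt) (cl := cl) (init := init)
    hP hO hS hμ hμ' k i hψm hψ
  simp only [inner_scale, inner_avg]
  refine ⟨integrable_avg hI, ?_⟩
  rw [integral_avg hI]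
  simp only [h0]
  simp [avg]

include hWd

/-- Pathwise, μ_{k+1} is replaced by μ_k using `lyap_mono`, and `lyap_step_le` applies with the
averaged bias and noise. In expectation the term linear in the noise vanishes and the quadratic one
gains 1/n. -/
lemma expected_lyap_succ_le {c : ℝ} (hcl' : cl ≤ (1 / γ - L₂) / (32 * weightA L₂ γ Lθ * Lθ ^ 2))
    (hFl : ∀ z, Fl ≤ P.upper z) (hanti : Antitone μ) (hlt : 0 ≤ lt) (hc0 : 0 < c) (hc : c ≤ 1 / 8)
    (hc' : c ≤ cl / 16) (hltc : 3 * (1 + cl) ^ 2 * lyapConst L₁ L₂ γ Lθ μ₀ * lt ≤ c) (k : ℕ) :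
    ∫ ω, P.lyap γ (μ (k + 1)) Fl (avg (𝓢 (k + 1) ω).pos) ∂Pr
      ≤ ∫ ω, P.lyap γ (μ k) Fl (avg (𝓢 k ω).pos) ∂Pr
        - c * lt * (∫ ω, ‖P.gradPenalized γ (μ k) (avg (𝓢 k ω).pos).snd‖ ^ 2 ∂Pr
          + ∫ ω, ‖P.meanDir γ (μ k) (avg (𝓢 k ω).pos)‖ ^ 2 ∂Pr)
        + (41 * (1 + cl) ^ 2 / (4 * c) + c) * lt
          * (dirConst L₁ L₂ γ μ₀ ^ 2 * ∫ ω, disp (𝓢 k ω).pos ∂Pr)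
        + 3 * (1 + cl) ^ 2 * lyapConst L₁ L₂ γ Lθ μ₀ * lt ^ 2 * (noiseLevel μ₀ δf δg / n) := by
  have hm := fun k => memLp_process (W := W) (lt := lt) (cl := cl) (init := init)
    hP hO hS hμ hμ' hcl.le k
  have hε := fun i => memLp_noiseAt (W := W) (lt := lt) (cl := cl) (init := init) hP hO hS hμ hμ' k i
  have hC := lyapConst_pos hP.nonneg hP.pos hP.γ_pos hP.Lθ_pos ((hμ k).trans (hμ' k))
  set a1 := (41 * (1 + cl) ^ 2 / (4 * c) + c) * lt with ha1
  set a2 := 3 * (1 + cl) ^ 2 * lyapConst L₁ L₂ γ Lθ μ₀ * lt ^ 2 with ha2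
  have ha1' : 0 ≤ a1 := by positivity
  have ha2' : 0 ≤ a2 := by positivity
  have i0 := hP.integrable_lyap (hμ k) hFl (memLp_avg (hm k).1)
  have i1 := hP.integrable_lyap (hμ (k + 1)) hFl (memLp_avg (hm (k + 1)).1)
  have i2 := integrable_gradPenalized_sq (W := W) (lt := lt) (init := init) hP hcl hO hS hμ hμ' k
  have i3 := integrable_norm_sq
    (memLp_meanDir (W := W) (lt := lt) (init := init) hP hcl.le hO hS hμ hμ' k)
  have i4 := integrable_disp (hm k).1
  have i5 := integrable_norm_sq (memLp_avg (u := fun ω i => 𝓔 k i ω) fun i => (hε i).1)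
  obtain ⟨i6, h6⟩ := integral_inner_gradLyap_noise (W := W) (lt := lt) (init := init)
    hP hcl hO hS hμ hμ' k
  have h5 := integral_norm_avg_noiseAt_sq_le (W := W) (lt := lt) (cl := cl) (init := init)
    hP hO hS hμ hμ' k
  have j1 := i0.sub ((i2.add i3).const_mul (c * lt))
  have j2 := j1.add ((i4.const_mul (dirConst L₁ L₂ γ μ₀ ^ 2)).const_mul a1)
  have j3 := j2.add (i5.const_mul a2)
  have hle := integral_mono i1 (j3.sub (i6.const_mul lt)) fun ω => by
    change P.lyap γ (μ (k + 1)) Fl (avg (𝓢 (k + 1) ω).pos)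
      ≤ P.lyap γ (μ k) Fl (avg (𝓢 k ω).pos)
        - c * lt * (‖P.gradPenalized γ (μ k) (avg (𝓢 k ω).pos).snd‖ ^ 2
          + ‖P.meanDir γ (μ k) (avg (𝓢 k ω).pos)‖ ^ 2)
        + a1 * (dirConst L₁ L₂ γ μ₀ ^ 2 * disp (𝓢 k ω).pos)
        + a2 * ‖avg fun i => 𝓔 k i ω‖ ^ 2
        - lt * inner ℝ (P.gradLyap γ (μ k) (avg (𝓢 k ω).pos)) (scale cl (avg fun i => 𝓔 k i ω))
    refine (lyap_mono (hanti k.le_succ) hFl _).trans ?_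
    have e : avg (𝓢 (k + 1) ω).pos = avg (𝓢 k ω).pos - lt • scale cl (avg (𝓢 (k + 1) ω).dir) :=
      avg_run_pos hWd k
    rw [e, avg_process_dir_succ hWd k ω]
    refine (hP.lyap_step_le hcl hcl' (hμ k) (hμ' k) hlt hc0 hc hc' hltc _ _ _).trans ?_
    have := hP.norm_avg_localDir_sub_sq_le (hμ k) (hμ' k) (𝓢 k ω).pos
    rw [← ha1, ← ha2]
    gcongr
  refine hle.trans ?_
  rw [integral_sub' j3 (i6.const_mul lt), integral_add' j2 (i5.const_mul a2),
    integral_add' j1 ((i4.const_mul _).const_mul a1), integral_sub' i0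
    ((i2.add i3).const_mul (c * lt)), integral_const_mul, integral_const_mul, integral_const_mul,
    integral_const_mul, integral_const_mul, integral_add' i2 i3, h6, mul_zero, sub_zero]
  gcongr

end LyapunovExpectation

end SunDSBO

namespace SunDSBO

/-! ### Real sequences -/

lemma penalty_nonneg {μ₀ p : ℝ} (hμ₀ : 0 ≤ μ₀) (k : ℕ) : 0 ≤ penalty μ₀ p k :=
  mul_nonneg hμ₀ (Real.rpow_nonneg (by positivity) _)

lemma penalty_zero (μ₀ p : ℝ) : penalty μ₀ p 0 = μ₀ := by simp [penalty]

lemma penalty_antitone {μ₀ p : ℝ} (hμ₀ : 0 ≤ μ₀) (hp : 0 ≤ p) : Antitone (penalty μ₀ p) := by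
  intro a b hab
  refine mul_le_mul_of_nonneg_left (Real.rpow_le_rpow_of_nonpos (by positivity) ?_ (by linarith)) hμ₀
  gcongr

lemma penalty_le {μ₀ p : ℝ} (hμ₀ : 0 ≤ μ₀) (hp : 0 ≤ p) (k : ℕ) : penalty μ₀ p k ≤ μ₀ := by
  simpa [penalty_zero] using penalty_antitone hμ₀ hp (Nat.zero_le k)

/-- Equivalent to (k + 1)μ_k ≤ (k + 2)μ_{k+1}, which holds because t ≤ t^p for t = (k + 1)/(k + 2)
and p ≤ 1. -/
lemma penalty_sub_succ_le {μ₀ p : ℝ} (hμ₀ : 0 ≤ μ₀) (hp : p ≤ 1) (k : ℕ) :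
    (penalty μ₀ p k - penalty μ₀ p (k + 1)) * (k + 2) ≤ penalty μ₀ p k := by
  have h1 : (0 : ℝ) < (k : ℝ) + 1 := by positivity
  have h2 : (0 : ℝ) < (k : ℝ) + 2 := by positivity
  have key : ((k : ℝ) + 1) ^ (-p) * (((k : ℝ) + 1) / (k + 2)) ≤ ((k : ℝ) + 2) ^ (-p) := by
    have ht : ((k : ℝ) + 1) / (k + 2) ≤ (((k : ℝ) + 1) / (k + 2)) ^ p := by
      conv_lhs => rw [← Real.rpow_one (((k : ℝ) + 1) / (k + 2))]
      exact Real.rpow_le_rpow_of_exponent_ge (by positivity)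
        ((div_le_one h2).2 (by linarith)) hp
    calc ((k : ℝ) + 1) ^ (-p) * (((k : ℝ) + 1) / (k + 2))
        ≤ ((k : ℝ) + 1) ^ (-p) * (((k : ℝ) + 1) / (k + 2)) ^ p := by gcongr
      _ = ((k : ℝ) + 2) ^ (-p) := by
        rw [Real.div_rpow h1.le h2.le, Real.rpow_neg h1.le, Real.rpow_neg h2.le]
        have := (Real.rpow_pos_of_pos h1 p).ne'
        have := (Real.rpow_pos_of_pos h2 p).ne'
        field_simp
  have e : penalty μ₀ p (k + 1) = μ₀ * ((k : ℝ) + 2) ^ (-p) := by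
    simp only [penalty]; push_cast; ring_nf
  have h := mul_le_mul_of_nonneg_left key (mul_nonneg hμ₀ h2.le)
  have e2 : μ₀ * ((k : ℝ) + 2) * (((k : ℝ) + 1) ^ (-p) * (((k : ℝ) + 1) / (k + 2)))
      = μ₀ * ((k : ℝ) + 1) ^ (-p) * (k + 1) := by field_simp
  rw [e2] at h
  rw [e, penalty]
  nlinarith

/-- One factor of the square absorbs the weight k + 1 by `penalty_sub_succ_le`; the other
telescopes. The weight matches the factor k in the squared displacement from the starting point. -/
lemma sum_penalty_sub_sq_le {μ₀ p : ℝ} (hμ₀ : 0 ≤ μ₀) (hp : 0 ≤ p) (hp' : p ≤ 1) (N : ℕ) :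
    ∑ k ∈ Finset.range N, (penalty μ₀ p (k + 1) - penalty μ₀ p k) ^ 2 * (k + 1) ≤ μ₀ ^ 2 := by
  have h : ∀ k, (penalty μ₀ p (k + 1) - penalty μ₀ p k) ^ 2 * (k + 1)
      ≤ μ₀ * (penalty μ₀ p k - penalty μ₀ p (k + 1)) := fun k => by
    have h1 := penalty_sub_succ_le hμ₀ hp' k
    have h2 := penalty_antitone hμ₀ hp k.le_succ
    have h3 := penalty_le hμ₀ hp k
    have h4 := sub_nonneg.2 h2
    nlinarith [mul_le_mul_of_nonneg_left h1 h4, mul_le_mul_of_nonneg_right h3 h4,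
      sq_nonneg (penalty μ₀ p (k + 1) - penalty μ₀ p k)]
  refine (Finset.sum_le_sum fun k _ => h k).trans ?_
  rw [← Finset.mul_sum, Finset.sum_range_sub', penalty_zero]
  nlinarith [penalty_nonneg (p := p) hμ₀ N]

/-- Summing the recursion telescopes the left side and leaves (τ/2)∑u. Together with the factor 2/τ
on the perturbation this gives a cost of 1/τ² per use. -/
lemma sum_le_of_contraction {u r : ℕ → ℝ} {τ : ℝ} (hτ : 0 < τ) (hτ' : τ ≤ 1) (hu : ∀ k, 0 ≤ u k)
    (h : ∀ k, u (k + 1) ≤ (1 - τ / 2) * u k + 2 / τ * r k) (N : ℕ) :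
    ∑ k ∈ Finset.range (N + 1), u k ≤ 2 / τ * u 0 + 4 / τ ^ 2 * ∑ k ∈ Finset.range N, r k := by
  have key : τ / 2 * ∑ k ∈ Finset.range N, u k + u N
      ≤ u 0 + 2 / τ * ∑ k ∈ Finset.range N, r k := by
    induction N with
    | zero => simp
    | succ N ih =>
      rw [Finset.sum_range_succ, Finset.sum_range_succ]
      linarith [h N]
  have h2 : τ / 2 * ∑ k ∈ Finset.range (N + 1), u k
      ≤ u 0 + 2 / τ * ∑ k ∈ Finset.range N, r k := by
    rw [Finset.sum_range_succ]
    nlinarith [hu N]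
  have h3 := mul_le_mul_of_nonneg_left h2 (by positivity : (0 : ℝ) ≤ 2 / τ)
  calc _ = 2 / τ * (τ / 2 * ∑ k ∈ Finset.range (N + 1), u k) := by field_simp
    _ ≤ _ := h3
    _ = _ := by field_simp; ring

/-- Each prefix sum is at most the full sum, and the remaining weights q k · k are summable. It
bounds the drift away from the initial point. -/
lemma sum_mul_prefix_sum_le {q b : ℕ → ℝ} {m : ℝ} (hq : ∀ k, 0 ≤ q k) (hb : ∀ k, 0 ≤ b k) (N : ℕ)
    (hm : ∑ k ∈ Finset.range N, q k * (k + 1) ≤ m) :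
    ∑ k ∈ Finset.range N, q k * (k * ∑ j ∈ Finset.range k, b j)
      ≤ m * ∑ j ∈ Finset.range N, b j := by
  have hB : 0 ≤ ∑ j ∈ Finset.range N, b j := Finset.sum_nonneg fun j _ => hb j
  refine le_trans ?_ (mul_le_mul_of_nonneg_right hm hB)
  rw [Finset.sum_mul]
  refine Finset.sum_le_sum fun k hk => ?_
  have h1 : ∑ j ∈ Finset.range k, b j ≤ ∑ j ∈ Finset.range N, b j :=
    Finset.sum_le_sum_of_subset_of_nonneg
      (Finset.range_subset_range.2 (Finset.mem_range.1 hk).le) fun j _ _ => hb j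
  rw [mul_assoc]
  refine mul_le_mul_of_nonneg_left ?_ (hq k)
  exact mul_le_mul (by linarith) h1 (Finset.sum_nonneg fun j _ => hb j) (by positivity)

lemma sum_mul_le {q u : ℕ → ℝ} {m : ℝ} (hq : ∀ k, 0 ≤ q k) (hu : ∀ k, 0 ≤ u k) (N : ℕ)
    (hm : ∑ k ∈ Finset.range N, q k * (k + 1) ≤ m) :
    ∑ k ∈ Finset.range N, q k * u k ≤ m * ∑ j ∈ Finset.range N, u j := by
  rw [Finset.mul_sum]
  refine Finset.sum_le_sum fun k hk => mul_le_mul_of_nonneg_right ?_ (hu k)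
  refine le_trans ?_ ((Finset.single_le_sum (f := fun k : ℕ => q k * ((k : ℝ) + 1))
    (fun i _ => mul_nonneg (hq i) (by positivity)) hk).trans hm)
  have : (0 : ℝ) ≤ k := k.cast_nonneg
  nlinarith [hq k]

lemma sum_range_le_succ {u : ℕ → ℝ} (hu : ∀ k, 0 ≤ u k) (N : ℕ) :
    ∑ k ∈ Finset.range N, u k ≤ ∑ k ∈ Finset.range (N + 1), u k := by
  rw [Finset.sum_range_succ]; linarith [hu N]

/-- The summed perturbation in the recursion for the dispersion of the directions. -/
lemma sum_tracking_residual_le {C l v Γ Z m : ℝ} {X B q : ℕ → ℝ} (hC : 1 ≤ C) (hv : 0 ≤ v)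
    (hΓ : 0 ≤ Γ) (hX : ∀ k, 0 ≤ X k) (hB : ∀ k, 0 ≤ B k) (hq : ∀ k, 0 ≤ q k) (hZ : 0 ≤ Z)
    (hX0 : X 0 ≤ Γ) (hmC : m ≤ C) (hZ0 : m * Z ≤ C * Γ)
    (hqs : ∀ N, ∑ k ∈ Finset.range N, q k * (k + 1) ≤ m) (N : ℕ) :
    ∑ k ∈ Finset.range N, (C * (v + X (k + 1) + X k + l ^ 2 * B k
      + q k * (X k + X 0 + k * ∑ j ∈ Finset.range k, l ^ 2 * B j)) + q k * (2 * Z))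
      ≤ C ^ 2 * ((N + 1 : ℕ) * v + 3 * ∑ k ∈ Finset.range (N + 1), X k
        + 2 * (l ^ 2 * ∑ k ∈ Finset.range (N + 1), B k) + 3 * Γ) := by
  have hC0 : 0 < C := by linarith
  have hm0 : 0 ≤ m := by simpa using hqs 0
  set SX := ∑ k ∈ Finset.range (N + 1), X k with hSX
  set SB := ∑ k ∈ Finset.range (N + 1), B k with hSB
  have hSX0 : 0 ≤ SX := Finset.sum_nonneg fun k _ => hX k
  have hSB0 : 0 ≤ SB := Finset.sum_nonneg fun k _ => hB k
  set v' : ℝ := (N + 1 : ℕ) * v with hv'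
  have hv0 : 0 ≤ v' := by positivity
  have e1 : ∑ k ∈ Finset.range N, X (k + 1) ≤ SX := by
    rw [hSX, Finset.sum_range_succ']; linarith [hX 0]
  have e2 := sum_range_le_succ hX N
  have e3 : ∑ k ∈ Finset.range N, l ^ 2 * B k ≤ l ^ 2 * SB := by
    rw [← Finset.mul_sum]; exact mul_le_mul_of_nonneg_left (sum_range_le_succ hB N) (by positivity)
  have e4 := sum_mul_le hq hX N (hqs N)
  have e6 := sum_mul_prefix_sum_le (b := fun j => l ^ 2 * B j) hq
    (fun j => mul_nonneg (by positivity) (hB j)) N (hqs N)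
  have e7 : ∑ k ∈ Finset.range N, q k ≤ m := by
    refine (Finset.sum_le_sum fun k _ => ?_).trans (hqs N)
    have : (0 : ℝ) ≤ k := k.cast_nonneg
    nlinarith [hq k]
  have e8 : ∑ k ∈ Finset.range N, v ≤ v' := by
    simp only [Finset.sum_const, Finset.card_range, nsmul_eq_mul, hv']
    push_cast; nlinarith
  have e9 : (∑ k ∈ Finset.range N, q k) * X 0 ≤ C * Γ :=
    mul_le_mul (e7.trans hmC) hX0 (hX 0) hC0.le
  have e10 : (∑ k ∈ Finset.range N, q k) * Z ≤ C * Γ :=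
    (mul_le_mul_of_nonneg_right e7 hZ).trans hZ0
  have e11 : m * ∑ j ∈ Finset.range N, X j ≤ C * SX :=
    mul_le_mul hmC e2 (Finset.sum_nonneg fun k _ => hX k) hC0.le
  have e12 : m * ∑ j ∈ Finset.range N, l ^ 2 * B j ≤ C * (l ^ 2 * SB) :=
    mul_le_mul hmC e3 (Finset.sum_nonneg fun k _ => mul_nonneg (by positivity) (hB k)) hC0.le
  have expand : ∑ k ∈ Finset.range N, (C * (v + X (k + 1) + X k + l ^ 2 * B k
      + q k * (X k + X 0 + k * ∑ j ∈ Finset.range k, l ^ 2 * B j)) + q k * (2 * Z))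
      = C * (∑ k ∈ Finset.range N, v + ∑ k ∈ Finset.range N, X (k + 1)
        + ∑ k ∈ Finset.range N, X k + ∑ k ∈ Finset.range N, l ^ 2 * B k
        + (∑ k ∈ Finset.range N, q k * X k + (∑ k ∈ Finset.range N, q k) * X 0
          + ∑ k ∈ Finset.range N, q k * (k * ∑ j ∈ Finset.range k, l ^ 2 * B j)))
        + 2 * ((∑ k ∈ Finset.range N, q k) * Z) := by
    rw [Finset.sum_mul, Finset.sum_mul]
    simp only [← Finset.sum_add_distrib]
    rw [Finset.mul_sum, Finset.mul_sum, ← Finset.sum_add_distrib]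
    exact Finset.sum_congr rfl fun k _ => by ring
  rw [expand]
  clear expand
  generalize ∑ k ∈ Finset.range N, v = t1 at *
  generalize ∑ k ∈ Finset.range N, X (k + 1) = t2 at *
  generalize ∑ k ∈ Finset.range N, X k = t3 at *
  generalize ∑ k ∈ Finset.range N, q k * (k * ∑ j ∈ Finset.range k, l ^ 2 * B j) = t6 at *
  generalize ∑ k ∈ Finset.range N, l ^ 2 * B k = t4 at *
  generalize ∑ k ∈ Finset.range N, q k * X k = t5 at *
  generalize ∑ k ∈ Finset.range N, q k = t7 at *
  have hSBl : 0 ≤ l ^ 2 * SB := by positivity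
  have f1 : C * (t1 + t2 + t3 + t4 + (t5 + t7 * X 0 + t6))
      ≤ C * (C * v' + C * SX + C * SX + C * (l ^ 2 * SB)
          + (C * SX + C * Γ + C * (l ^ 2 * SB))) := by
    refine mul_le_mul_of_nonneg_left ?_ hC0.le
    have g1 : v' ≤ C * v' := le_mul_of_one_le_left hv0 hC
    have g2 : SX ≤ C * SX := le_mul_of_one_le_left hSX0 hC
    have g3 : l ^ 2 * SB ≤ C * (l ^ 2 * SB) := le_mul_of_one_le_left hSBl hC
    linarith
  have f2 : 2 * (C * Γ) ≤ 2 * (C * (C * Γ)) := by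
    have : C * Γ ≤ C * (C * Γ) := le_mul_of_one_le_left (by positivity) hC
    linarith
  calc _ ≤ C * (C * v' + C * SX + C * SX + C * (l ^ 2 * SB)
        + (C * SX + C * Γ + C * (l ^ 2 * SB))) + 2 * (C * (C * Γ)) := by linarith
    _ = _ := by ring

/-- Absorption in the summed recursions. -/
lemma absorb_summed_recursions {C c s τ l v' w' Γ e SX SY SB SM SS : ℝ}
    (hC : 1 ≤ C) (hc : 0 < c) (hs1 : 128 * C ^ 3 * s ≤ 1) (hs2 : 12 * C * s ≤ c)
    (hτ : 0 < τ) (hτ' : τ ≤ 1) (hl : 0 < l) (hls : l ≤ s * τ ^ 4) (he : e = l ^ 2 / τ ^ 4)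
    (hv0 : 0 ≤ v') (hw0 : 0 ≤ w') (hΓ : 0 ≤ Γ)
    (hSX0 : 0 ≤ SX) (hSB0 : 0 ≤ SB) (hSM0 : 0 ≤ SM) (hSS0 : 0 ≤ SS)
    (b1 : SB ≤ 3 * SM + C * SX + 3 * w')
    (y1 : SY ≤ 4 * C ^ 2 / τ ^ 2 * (v' + 3 * SX + 2 * (l ^ 2 * SB) + 4 * Γ))
    (h : SX ≤ 2 / τ * Γ + 4 / τ ^ 2 * (C * l ^ 2 * SY))
    (v2 : c * (SS + SM) ≤ C * (Γ / l) + C * SX + C * (l * w')) :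
    SS ≤ 64 * C ^ 4 / c * (Γ / l + Γ / τ + e * v' + l * w') ∧
    SX ≤ (64 * C ^ 3 + 768 * C ^ 4 / c) * (Γ / l + Γ / τ + e * v' + l * w') := by
  have hC0 : 0 < C := by linarith
  have hs : 0 < s := pos_of_mul_pos_left (lt_of_lt_of_le hl hls) (by positivity)
  have hC3 : 1 ≤ C ^ 3 := one_le_pow₀ hC
  have hCC3 : C ≤ C ^ 3 := le_self_pow₀ hC (by norm_num)
  have hC34 : C ^ 3 ≤ C ^ 4 := pow_le_pow_right₀ hC (by norm_num)
  have hs3 : 128 * s ≤ 1 := by nlinarith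
  have hCs : 128 * (C * s) ≤ 1 := by nlinarith
  have hl_s : l ≤ s := hls.trans (mul_le_of_le_one_right hs.le (pow_le_one₀ hτ.le hτ'))
  have hl1 : l ≤ 1 := by linarith
  have hl2 : l ^ 2 ≤ l := by nlinarith
  have he0 : 0 ≤ e := by rw [he]; positivity
  -- From l² ≤ l ≤ sτ⁴. The power τ⁴ collects the two contractions, from directions to iterates and
  -- from increments to directions.
  have hes : e ≤ s := by
    rw [he, div_le_iff₀ (by positivity)]; linarith
  have hΓτ : Γ ≤ Γ / τ := by rw [le_div_iff₀ hτ]; nlinarith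
  have x1 : SX ≤ 2 * (Γ / τ)
      + 16 * C ^ 3 * e * (v' + 3 * SX + 2 * (l ^ 2 * SB) + 4 * Γ) := by
    have g2 : 4 / τ ^ 2 * (C * l ^ 2 * SY) ≤ 4 / τ ^ 2 * (C * l ^ 2
          * (4 * C ^ 2 / τ ^ 2 * (v' + 3 * SX + 2 * (l ^ 2 * SB) + 4 * Γ))) := by
      gcongr
    refine (h.trans (add_le_add_right g2 _)).trans (le_of_eq ?_)
    rw [he]; field_simp; ring
  -- The feedback of SX into itself then has weight at most 3/8, plus a small share through SB, so
  -- it can be moved to the left side.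
  have hce : 16 * C ^ 3 * e ≤ 1 / 8 := by
    have : C ^ 3 * e ≤ C ^ 3 * s := by gcongr
    linarith
  have hce0 : 0 ≤ 16 * C ^ 3 * e := by positivity
  have hlb : l ^ 2 * SB ≤ 3 * (l ^ 2 * SM) + SX / 128 + 3 * (l ^ 2 * w') := by
    have g := mul_le_mul_of_nonneg_left b1 (sq_nonneg l)
    have g2 : C * l ^ 2 ≤ C * s := by gcongr; linarith
    have g3 : C * l ^ 2 ≤ 1 / 128 := by linarith
    linarith [mul_le_mul_of_nonneg_right g3 hSX0]
  have x2 : SX ≤ 5 * (Γ / τ) + 32 * C ^ 3 * (e * v') + 3 / 2 * (l ^ 2 * SM)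
      + 3 / 2 * (l ^ 2 * w') := by
    have g1 := mul_le_mul_of_nonneg_right hce hSX0
    have g2 := mul_le_mul_of_nonneg_right hce (by positivity : 0 ≤ l ^ 2 * SB)
    have g3 := mul_le_mul_of_nonneg_right hce hΓ
    have x1' : SX ≤ 2 * (Γ / τ) + (16 * C ^ 3 * (e * v') + 3 * (16 * C ^ 3 * e * SX)
        + 2 * (16 * C ^ 3 * e * (l ^ 2 * SB)) + 4 * (16 * C ^ 3 * e * Γ)) :=
      x1.trans (le_of_eq (by ring))
    linarith
  have hT : 0 ≤ Γ / l := by positivity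
  have hU : 0 ≤ Γ / τ := by positivity
  have hev : 0 ≤ e * v' := by positivity
  have hlw : 0 ≤ l * w' := by positivity
  have hlw2 : l ^ 2 * w' ≤ l * w' := mul_le_mul_of_nonneg_right hl2 hw0
  -- The dispersion in the Lyapunov sum brings back (3/2)C l² SM, which 12Cs ≤ c bounds by half of
  -- the decrease c · SM.
  have v3 : c * SS + c / 2 * SM ≤ 32 * C ^ 4 * (Γ / l + Γ / τ + e * v' + l * w') := by
    have g1 : C * (3 / 2 * (l ^ 2 * SM)) ≤ c / 2 * SM := by
      have : C * l ^ 2 ≤ C * s := by gcongr; linarith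
      have g : C * l ^ 2 ≤ c / 12 := by linarith
      linarith [mul_le_mul_of_nonneg_right g hSM0, mul_nonneg hc.le hSM0]
    have g2 := mul_le_mul_of_nonneg_left x2 hC0.le
    have hC4 : C ≤ C ^ 4 := hCC3.trans hC34
    have f1 := mul_le_mul_of_nonneg_right hC4 hT
    have f2 := mul_le_mul_of_nonneg_right hC4 hU
    have f3 := mul_le_mul_of_nonneg_right hC4 hlw
    have f4 := mul_le_mul_of_nonneg_left hlw2 hC0.le
    have f5 : C * (32 * C ^ 3 * (e * v')) = 32 * (C ^ 4 * (e * v')) := by ring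
    have p1 : 0 ≤ C ^ 4 * (Γ / l) := by positivity
    have p2 : 0 ≤ C ^ 4 * (Γ / τ) := by positivity
    have p3 : 0 ≤ C ^ 4 * (l * w') := by positivity
    linarith
  set R := Γ / l + Γ / τ + e * v' + l * w' with hR
  have hR0 : 0 ≤ R := by positivity
  have hSMR : SM ≤ 64 * C ^ 4 / c * R := by
    rw [div_mul_eq_mul_div, le_div_iff₀ hc]
    linarith [mul_nonneg hc.le hSS0]
  constructor
  · rw [div_mul_eq_mul_div, le_div_iff₀ hc]
    linarith [mul_nonneg hc.le hSM0, mul_nonneg (pow_pos hC0 4).le hR0]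
  · have g1 : l ^ 2 * SM ≤ SM := mul_le_of_le_one_left hSM0 (by linarith)
    have f1 := mul_le_mul_of_nonneg_right hC3 hU
    have f2 := mul_le_mul_of_nonneg_right hC3 hlw
    have p1 : 0 ≤ C ^ 3 * (Γ / l) := by positivity
    have p2 : 0 ≤ C ^ 3 * (e * v') := by positivity
    have p3 : 0 ≤ C ^ 4 / c * R := by positivity
    have eR : C ^ 3 * R = C ^ 3 * (Γ / l) + C ^ 3 * (Γ / τ) + C ^ 3 * (e * v')
      + C ^ 3 * (l * w') := by rw [hR]; ring
    calc SX ≤ 64 * (C ^ 3 * R) + 768 * (C ^ 4 / c * R) := by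
          have : SM ≤ 64 * (C ^ 4 / c * R) := hSMR.trans (le_of_eq (by ring))
          linarith
      _ = _ := by ring


/-- The coupled recursions for the dispersions `X` and `Y` of iterates and directions and for the
Lyapunov values `V`, summed over the first `N + 1` iterations. -/
lemma sum_le_of_recursions {C c s τ l v w Γ Z m : ℝ} {X Y B M S V q : ℕ → ℝ}
    (hC : 1 ≤ C) (hc : 0 < c) (hs1 : 128 * C ^ 3 * s ≤ 1) (hs2 : 12 * C * s ≤ c)
    (hτ : 0 < τ) (hτ' : τ ≤ 1) (hl : 0 < l) (hls : l ≤ s * τ ^ 4)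
    (hv : 0 ≤ v) (hw : 0 ≤ w) (hΓ : 0 ≤ Γ)
    (hX : ∀ k, 0 ≤ X k) (hY : ∀ k, 0 ≤ Y k) (hB : ∀ k, 0 ≤ B k) (hM : ∀ k, 0 ≤ M k)
    (hS : ∀ k, 0 ≤ S k) (hV : ∀ k, 0 ≤ V k) (hq : ∀ k, 0 ≤ q k) (hZ : 0 ≤ Z)
    (hX0 : X 0 ≤ Γ) (hY0 : Y 0 ≤ C * Γ) (hV0 : V 0 ≤ C * Γ) (hmC : m ≤ C) (hZ0 : m * Z ≤ C * Γ)
    (hqs : ∀ N, ∑ k ∈ Finset.range N, q k * (k + 1) ≤ m)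
    (h1 : ∀ k, X (k + 1) ≤ (1 - τ / 2) * X k + 2 / τ * (C * l ^ 2 * Y k))
    (h2 : ∀ k, Y (k + 1) ≤ (1 - τ / 2) * Y k + 2 / τ * (C * (v + X (k + 1) + X k + l ^ 2 * B k
      + q k * (X k + X 0 + k * ∑ j ∈ Finset.range k, l ^ 2 * B j)) + q k * (2 * Z)))
    (h3 : ∀ k, B k ≤ 3 * M k + C * X k + 3 * w)
    (h4 : ∀ k, V (k + 1) ≤ V k - c * l * (S k + M k) + C * l * X k + C * l ^ 2 * w) (N : ℕ) :
    ∑ k ∈ Finset.range (N + 1), S k ≤ 64 * C ^ 4 / c *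
        (Γ / l + Γ / τ + l ^ 2 / τ ^ 4 * ((N + 1 : ℕ) * v) + l * ((N + 1 : ℕ) * w)) ∧
    ∑ k ∈ Finset.range (N + 1), X k ≤ (64 * C ^ 3 + 768 * C ^ 4 / c) *
        (Γ / l + Γ / τ + l ^ 2 / τ ^ 4 * ((N + 1 : ℕ) * v) + l * ((N + 1 : ℕ) * w)) := by
  have hC0 : 0 < C := by linarith
  set SX := ∑ k ∈ Finset.range (N + 1), X k with hSX
  set SY := ∑ k ∈ Finset.range (N + 1), Y k with hSY
  set SB := ∑ k ∈ Finset.range (N + 1), B k with hSB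
  set SM := ∑ k ∈ Finset.range (N + 1), M k with hSM
  set SS := ∑ k ∈ Finset.range (N + 1), S k with hSS
  have hSX0 : 0 ≤ SX := Finset.sum_nonneg fun k _ => hX k
  have hSB0 : 0 ≤ SB := Finset.sum_nonneg fun k _ => hB k
  have hSM0 : 0 ≤ SM := Finset.sum_nonneg fun k _ => hM k
  have hSS0 : 0 ≤ SS := Finset.sum_nonneg fun k _ => hS k
  set v' : ℝ := (N + 1 : ℕ) * v with hv'
  set w' : ℝ := (N + 1 : ℕ) * w with hw'
  have hv0 : 0 ≤ v' := by positivity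
  have hw0 : 0 ≤ w' := by positivity
  have b1 : SB ≤ 3 * SM + C * SX + 3 * w' := by
    refine (Finset.sum_le_sum fun k _ => h3 k).trans (le_of_eq ?_)
    rw [Finset.sum_add_distrib, Finset.sum_add_distrib, ← Finset.mul_sum, ← Finset.mul_sum]
    simp only [Finset.sum_const, Finset.card_range, nsmul_eq_mul, hw']
    ring
  have r1 := sum_tracking_residual_le (l := l) hC hv hΓ hX hB hq hZ hX0 hmC hZ0 hqs N
  rw [← hSX, ← hSB, ← hv'] at r1
  have y1 : SY ≤ 4 * C ^ 2 / τ ^ 2 * (v' + 3 * SX + 2 * (l ^ 2 * SB) + 4 * Γ) := by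
    have h := sum_le_of_contraction hτ hτ' hY h2 N
    have g1 : 2 / τ * Y 0 ≤ 4 * C ^ 2 / τ ^ 2 * Γ := by
      have hτ2 : τ ^ 2 ≤ τ := by nlinarith
      have : C * Γ ≤ C ^ 2 * Γ := by nlinarith [mul_nonneg hC0.le hΓ]
      calc 2 / τ * Y 0 ≤ 2 / τ ^ 2 * (C ^ 2 * Γ) :=
          mul_le_mul (by gcongr) (by linarith) (hY 0) (by positivity)
        _ ≤ 4 / τ ^ 2 * (C ^ 2 * Γ) := by gcongr; norm_num
        _ = _ := by ring
    have g2 := mul_le_mul_of_nonneg_left r1 (by positivity : (0 : ℝ) ≤ 4 / τ ^ 2)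
    calc SY ≤ _ := h
      _ ≤ 4 * C ^ 2 / τ ^ 2 * Γ
          + 4 / τ ^ 2 * (C ^ 2 * (v' + 3 * SX + 2 * (l ^ 2 * SB) + 3 * Γ)) := add_le_add g1 g2
      _ = _ := by ring
  have x1 : SX ≤ 2 / τ * Γ + 4 / τ ^ 2 * (C * l ^ 2 * SY) := by
    have h := sum_le_of_contraction hτ hτ' hX h1 N
    rw [← Finset.mul_sum] at h
    refine h.trans (add_le_add (by gcongr) ?_)
    have := sum_range_le_succ hY N
    gcongr
  have v1 : ∀ n, c * l * (∑ k ∈ Finset.range n, S k + ∑ k ∈ Finset.range n, M k) + V n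
      ≤ V 0 + C * l * ∑ k ∈ Finset.range n, X k + C * l ^ 2 * (n * w) := fun n => by
    induction n with
    | zero => simp
    | succ n ih =>
      simp only [Finset.sum_range_succ]
      push_cast
      linarith [h4 n]
  have v2 : c * (SS + SM) ≤ C * (Γ / l) + C * SX + C * (l * w') := by
    have h := v1 (N + 1)
    have : l * (c * (SS + SM)) ≤ l * (C * (Γ / l) + C * SX + C * (l * w')) := by
      have e1 : l * (C * (Γ / l) + C * SX + C * (l * w'))
          = C * Γ + C * l * SX + C * l ^ 2 * w' := by field_simp
      rw [e1]
      linarith [hV (N + 1)]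
    exact le_of_mul_le_mul_left this hl
  exact absorb_summed_recursions hC hc hs1 hs2 hτ hτ' hl hls rfl hv0 hw0 hΓ hSX0 hSB0 hSM0 hSS0
    b1 y1 x1 v2

end SunDSBO

namespace SunDSBO

/-! ### The convergence rate -/

/-- The decrease rate of the Lyapunov function. -/
noncomputable def decreaseRate (cl : ℝ) : ℝ := min (1 / 8) (cl / 16)

lemma decreaseRate_pos {cl : ℝ} (hcl : 0 < cl) : 0 < decreaseRate cl :=
  lt_min (by norm_num) (by positivity)

/-- A constant that dominates all the constants in the coupled recursions. -/
noncomputable def masterConst (L₁ L₂ γ Lθ μ₀ cl : ℝ) : ℝ :=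
  (1 + cl) ^ 2 + 12 + 24 * dirConst L₁ L₂ γ μ₀ ^ 2 + 12 * dirConst L₁ L₂ γ μ₀ ^ 2 * (1 + cl) ^ 2
    + 24 * L₁ ^ 2 + 12 * L₁ ^ 2 * (1 + cl) ^ 2
    + (41 * (1 + cl) ^ 2 / (4 * decreaseRate cl) + decreaseRate cl) * dirConst L₁ L₂ γ μ₀ ^ 2
    + 3 * (1 + cl) ^ 2 * lyapConst L₁ L₂ γ Lθ μ₀ + μ₀ ^ 2 + (1 / (2 * γ) + L₂)
    + 8 * (3 * μ₀ ^ 2 + 6) + 4 * L₂ ^ 2 * (1 / (1 / (2 * γ) - L₂)) + 4 * L₂ ^ 2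

/-- The numerical requirements on the constant of the coupled recursions. -/
structure Dominates (C L₁ L₂ γ Lθ μ₀ cl : ℝ) : Prop where
  one_le : 1 ≤ C
  mix_le : (1 + cl) ^ 2 ≤ C
  twelve_le : 12 ≤ C
  dir_le : 24 * dirConst L₁ L₂ γ μ₀ ^ 2 ≤ C
  dir_mix_le : 12 * dirConst L₁ L₂ γ μ₀ ^ 2 * (1 + cl) ^ 2 ≤ C
  upper_le : 24 * L₁ ^ 2 ≤ C
  upper_mix_le : 12 * L₁ ^ 2 * (1 + cl) ^ 2 ≤ C
  lyap_disp_le : (41 * (1 + cl) ^ 2 / (4 * decreaseRate cl) + decreaseRate cl)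
    * dirConst L₁ L₂ γ μ₀ ^ 2 ≤ C
  lyap_le : 3 * (1 + cl) ^ 2 * lyapConst L₁ L₂ γ Lθ μ₀ ≤ C
  penalty_le : μ₀ ^ 2 ≤ C
  prox_le : 1 / (2 * γ) + L₂ ≤ C
  noise_le : 8 * (3 * μ₀ ^ 2 + 6) ≤ C
  gap_le : 4 * L₂ ^ 2 * (1 / (1 / (2 * γ) - L₂)) ≤ C
  lower_le : 4 * L₂ ^ 2 ≤ C

lemma masterConst_dominates {L₁ L₂ γ Lθ μ₀ cl : ℝ} (hL₁ : 0 ≤ L₁) (hL₂ : 0 < L₂) (hγ : 0 < γ)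
    (hγ' : γ < 1 / (2 * L₂)) (hLθ : 0 < Lθ) (hμ₀ : 0 ≤ μ₀) (hcl : 0 < cl) :
    Dominates (masterConst L₁ L₂ γ Lθ μ₀ cl) L₁ L₂ γ Lθ μ₀ cl := by
  have hc := decreaseRate_pos hcl
  have hLc := lyapConst_pos hL₁ hL₂ hγ hLθ hμ₀
  have hinv := half_inv_sub_pos hL₂ hγ hγ'
  have t1 : 0 ≤ (1 + cl) ^ 2 := by positivity
  have t2 : 0 ≤ dirConst L₁ L₂ γ μ₀ ^ 2 := by positivity
  have t3 : 0 ≤ dirConst L₁ L₂ γ μ₀ ^ 2 * (1 + cl) ^ 2 := by positivity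
  have t4 : 0 ≤ L₁ ^ 2 := by positivity
  have t5 : 0 ≤ L₁ ^ 2 * (1 + cl) ^ 2 := by positivity
  have t7 : 0 ≤ (1 + cl) ^ 2 * lyapConst L₁ L₂ γ Lθ μ₀ := by positivity
  have t8 : 0 ≤ μ₀ ^ 2 := by positivity
  have t9 : 0 ≤ 1 / (2 * γ) := by positivity
  have t10 : 0 ≤ L₂ ^ 2 * (1 / (1 / (2 * γ) - L₂)) := by positivity
  have t11 : 0 ≤ L₂ ^ 2 := by positivity
  have t6 : 0 ≤ (41 * (1 + cl) ^ 2 / (4 * decreaseRate cl) + decreaseRate cl)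
      * dirConst L₁ L₂ γ μ₀ ^ 2 := by positivity
  constructor <;> unfold masterConst <;> linarith

section Rate

variable {n dx dy : ℕ} {Ξf Ξg Ω : Type*} [MeasurableSpace Ξf] [MeasurableSpace Ξg]
  {P : Problem n dx dy Ξf Ξg} {W : Matrix (Fin n) (Fin n) ℝ} (hW : W.IsHermitian)
  {γ lt cl : ℝ} {μ : ℕ → ℝ} {init : Fin n → Triple dx dy} {ξf : ℕ → Fin n → Ω → Ξf}
  {ξg : ℕ → Fin n → Ω → Ξg} {δf δg μ₀ L₁ L₂ Lθ Fl s C : ℝ}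
  [mΩ : MeasurableSpace Ω] {Pr : Measure Ω} [IsProbabilityMeasure Pr]

/-- The initial gap `𝒞₂`, including the initial dispersion of the tracked directions. -/
noncomputable def fullGap (P : Problem n dx dy Ξf Ξg) (W : Matrix (Fin n) (Fin n) ℝ)
    (γ lt cl : ℝ) (μ : ℕ → ℝ) (init : Fin n → Triple dx dy) (ξf : ℕ → Fin n → Ω → Ξf)
    (ξg : ℕ → Fin n → Ω → Ξg) (Pr : Measure Ω) (μ₀ Fl δf δg : ℝ) : ℝ :=
  P.initialGap γ μ₀ Fl init
    + (∫ ω, dispersion (P.process W γ lt cl μ init ξf ξg 1 ω).D ∂Pr) + δf ^ 2 + δg ^ 2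

local notation "𝓢" => Problem.process P W γ lt cl μ init ξf ξg
local notation "Γ" => fullGap P W γ lt cl μ init ξf ξg Pr μ₀ Fl δf δg

omit [IsProbabilityMeasure Pr] in
lemma fullGap_eq :
    Γ = μ₀ * (P.upper (meanPoint init) - Fl)
      + (P.lower (meanPoint init) - P.moreau γ (meanPoint init))
      + ‖(avg fun i => (init i).θ) - P.thetaStar γ (meanPoint init)‖ ^ 2
      + (disp fun i => (init i).toJoint) + ∫ ω, disp (𝓢 1 ω).dir ∂Pr + (δf ^ 2 + δg ^ 2) := by
  rw [fullGap, Problem.initialGap, dispersion_eq_disp]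
  have : ∀ ω, dispersion (𝓢 1 ω).D = disp (𝓢 1 ω).dir := fun ω => dispersion_eq_disp _
  simp only [this]
  ring

omit [IsProbabilityMeasure Pr] in
lemma integral_disp_process_nonneg (k : ℕ) : 0 ≤ ∫ ω, disp (𝓢 k ω).pos ∂Pr :=
  integral_nonneg fun _ => disp_nonneg _

omit [IsProbabilityMeasure Pr] in
lemma integral_disp_dir_nonneg (k : ℕ) : 0 ≤ ∫ ω, disp (𝓢 k ω).dir ∂Pr :=
  integral_nonneg fun _ => disp_nonneg _

variable (hP : P.Regular L₁ L₂ γ Lθ) (hWd : W ∈ doublyStochastic ℝ (Fin n))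
  (hρ : connectivity W hW < 1) (hcl : 0 < cl)
  (hO : P.Oracle δf δg) (hS : P.Sampling Pr ξf ξg)
  (hμ : ∀ k, 0 ≤ μ k) (hμ' : ∀ k, μ k ≤ μ₀)

omit [IsProbabilityMeasure Pr] in
include hP in
lemma le_fullGap (hμ₀ : 0 ≤ μ₀) (hFl : ∀ z, Fl ≤ P.upper z) :
    (disp fun i => (init i).toJoint) ≤ Γ ∧ ∫ ω, disp (𝓢 1 ω).dir ∂Pr ≤ Γ
      ∧ δf ^ 2 + δg ^ 2 ≤ Γ := by
  set z0 := meanPoint init with hz0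
  set e0 := ‖(avg fun i => (init i).θ) - P.thetaStar γ z0‖ ^ 2 with he0
  have dn : 0 ≤ δf ^ 2 + δg ^ 2 := by positivity
  have e0n : 0 ≤ e0 := by positivity
  have Fn : 0 ≤ μ₀ * (P.upper z0 - Fl) := mul_nonneg hμ₀ (sub_nonneg.2 (hFl z0))
  have Gn : 0 ≤ P.lower z0 - P.moreau γ z0 := sub_nonneg.2 (hP.moreau_le_lower z0)
  have Dn : 0 ≤ disp fun i => (init i).toJoint := disp_nonneg _
  have Yn := integral_disp_dir_nonneg (P := P) (W := W) (γ := γ) (lt := lt) (cl := cl)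
    (μ := μ) (init := init) (ξf := ξf) (ξg := ξg) (Pr := Pr) 1
  rw [fullGap_eq, ← hz0, ← he0]
  refine ⟨?_, ?_, ?_⟩ <;> linarith

include hP in
lemma integral_lyap_zero_le (hC : Dominates C L₁ L₂ γ Lθ μ₀ cl) (hμ₀ : 0 ≤ μ₀) (hμ0 : μ 0 = μ₀)
    (hFl : ∀ z, Fl ≤ P.upper z) :
    ∫ ω, P.lyap γ (μ 0) Fl (avg (𝓢 0 ω).pos) ∂Pr ≤ C * Γ := by
  have hC1 := hC.one_le
  have hC0 : 0 ≤ C := by linarith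
  set z0 := meanPoint init with hz0
  set e0 := ‖(avg fun i => (init i).θ) - P.thetaStar γ z0‖ ^ 2 with he0
  have dn : 0 ≤ δf ^ 2 + δg ^ 2 := by positivity
  have e0n : 0 ≤ e0 := by positivity
  have Fn : 0 ≤ μ₀ * (P.upper z0 - Fl) := mul_nonneg hμ₀ (sub_nonneg.2 (hFl z0))
  have Gn : 0 ≤ P.lower z0 - P.moreau γ z0 := sub_nonneg.2 (hP.moreau_le_lower z0)
  have Dn : 0 ≤ disp fun i => (init i).toJoint := disp_nonneg _
  have Yn := integral_disp_dir_nonneg (P := P) (W := W) (γ := γ) (lt := lt) (cl := cl)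
    (μ := μ) (init := init) (ξf := ξf) (ξg := ξg) (Pr := Pr) 1
  simp only [process_zero_pos, integral_const, probReal_univ, one_smul]
  refine (hP.lyap_le_gap _).trans ?_
  rw [avg_toJoint_fst, avg_toJoint_snd, hμ0, ← hz0, ← he0, fullGap_eq, ← hz0, ← he0]
  have g1 : (1 / (2 * γ) + L₂) * e0 ≤ C * e0 := mul_le_mul_of_nonneg_right hC.prox_le e0n
  have g2 : μ₀ * (P.upper z0 - Fl) ≤ C * (μ₀ * (P.upper z0 - Fl)) := le_mul_of_one_le_left Fn hC1
  have g3 : P.lower z0 - P.moreau γ z0 ≤ C * (P.lower z0 - P.moreau γ z0) :=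
    le_mul_of_one_le_left Gn hC1
  have g4 : C * (μ₀ * (P.upper z0 - Fl) + (P.lower z0 - P.moreau γ z0) + e0)
      ≤ C * (μ₀ * (P.upper z0 - Fl) + (P.lower z0 - P.moreau γ z0) + e0
      + (disp fun i => (init i).toJoint) + ∫ ω, disp (𝓢 1 ω).dir ∂Pr + (δf ^ 2 + δg ^ 2)) :=
    mul_le_mul_of_nonneg_left (by linarith) hC0
  linarith

include hP hWd hρ hcl hO hS hμ hμ' in
-- The term ‖ȳ⁰ − θ̄⁰‖² left by `initial_heterogeneity_le` is traded for G − V_γ and ‖θ̄⁰ − θ*‖²,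
-- both part of the gap. As μ 0 = μ₀, the weight μ₀² also matches the total weight of the increments
-- of μ.
lemma initial_heterogeneity_le_gap (hC : Dominates C L₁ L₂ γ Lθ μ₀ cl) (hμ0 : μ 0 = μ₀)
    (hFl : ∀ z, Fl ≤ P.upper z) :
    μ₀ ^ 2 * disp (mix W fun i => upperDir (gradient (P.localF i)) (init i).toJoint)
      ≤ C * Γ := by
  have hμ₀ : 0 ≤ μ₀ := (hμ 0).trans (hμ' 0)
  have hL₂ := hP.pos
  have hC1 := hC.one_le
  have hC0 : 0 ≤ C := by linarith
  set z0 := meanPoint init with hz0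
  set e0 := ‖(avg fun i => (init i).θ) - P.thetaStar γ z0‖ ^ 2 with he0
  have dn : 0 ≤ δf ^ 2 + δg ^ 2 := by positivity
  have e0n : 0 ≤ e0 := by positivity
  have Fn : 0 ≤ μ₀ * (P.upper z0 - Fl) := mul_nonneg hμ₀ (sub_nonneg.2 (hFl z0))
  have Gn : 0 ≤ P.lower z0 - P.moreau γ z0 := sub_nonneg.2 (hP.moreau_le_lower z0)
  have Dn : 0 ≤ disp fun i => (init i).toJoint := disp_nonneg _
  have Yn := integral_disp_dir_nonneg (P := P) (W := W) (γ := γ) (lt := lt) (cl := cl)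
    (μ := μ) (init := init) (ξf := ξf) (ξg := ξg) (Pr := Pr) 1
  have h := initial_heterogeneity_le hW (init := init) (lt := lt) (μ := μ) hP hWd hρ hcl.le hO hS
    hμ hμ'
  have h' := hP.norm_snd_sub_fst_sq_le (avg fun i => (init i).toJoint)
  rw [hμ0] at h
  rw [avg_toJoint_snd, avg_toJoint_fst, ← hz0, ← he0] at h'
  rw [avg_toJoint_snd, avg_toJoint_fst, ← hz0] at h
  refine h.trans ?_
  rw [fullGap_eq, ← hz0, ← he0]
  have g1 : 8 * ∫ ω, disp (𝓢 1 ω).dir ∂Pr ≤ C * ∫ ω, disp (𝓢 1 ω).dir ∂Pr :=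
    mul_le_mul_of_nonneg_right (by linarith [hC.twelve_le]) Yn
  have g2 : 8 * noiseLevel μ₀ δf δg ≤ C * (δf ^ 2 + δg ^ 2) := by
    rw [noiseLevel, ← mul_assoc]
    exact mul_le_mul_of_nonneg_right hC.noise_le dn
  have g3 := mul_le_mul_of_nonneg_left h' (by positivity : 0 ≤ 2 * L₂ ^ 2)
  have g4 : 4 * L₂ ^ 2 * (disp fun i => (init i).toJoint)
    ≤ C * disp fun i => (init i).toJoint := mul_le_mul_of_nonneg_right hC.lower_le Dn
  have g5 : 4 * L₂ ^ 2 * e0 ≤ C * e0 := mul_le_mul_of_nonneg_right hC.lower_le e0n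
  have g6 : 4 * L₂ ^ 2 * (1 / (1 / (2 * γ) - L₂)) * (P.lower z0 - P.moreau γ z0)
    ≤ C * (P.lower z0 - P.moreau γ z0) := mul_le_mul_of_nonneg_right hC.gap_le Gn
  have g7 := mul_nonneg hC0 Fn
  have g8 : 2 / (1 / (2 * γ) - L₂) = 2 * (1 / (1 / (2 * γ) - L₂)) := by ring
  rw [g8] at g3
  linarith

include hP hWd hρ hcl hO hS hμ hμ' in
lemma expected_disp_dir_succ_le_of_dominates (hC : Dominates C L₁ L₂ γ Lθ μ₀ cl) (k : ℕ) :
    ∫ ω, disp (𝓢 (k + 2) ω).dir ∂Pr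
      ≤ (1 - (1 - connectivity W hW) / 2) * ∫ ω, disp (𝓢 (k + 1) ω).dir ∂Pr
      + 2 / (1 - connectivity W hW) * (C * (noiseLevel μ₀ δf δg + ∫ ω, disp (𝓢 (k + 1) ω).pos ∂Pr
        + ∫ ω, disp (𝓢 k ω).pos ∂Pr + lt ^ 2 * ∫ ω, ‖avg (𝓢 (k + 1) ω).dir‖ ^ 2 ∂Pr
        + (μ (k + 1) - μ k) ^ 2 * (∫ ω, disp (𝓢 k ω).pos ∂Pr + ∫ ω, disp (𝓢 0 ω).pos ∂Pr
          + k * ∑ j ∈ Finset.range k, lt ^ 2 * ∫ ω, ‖avg (𝓢 (j + 1) ω).dir‖ ^ 2 ∂Pr))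
        + (μ (k + 1) - μ k) ^ 2
          * (2 * disp (mix W fun i => upperDir (gradient (P.localF i)) (init i).toJoint))) := by
  refine (expected_disp_dir_succ_le hW hP hWd hρ hcl.le hO hS hμ hμ' k).trans ?_
  have hτ : 0 < 1 - connectivity W hW := by linarith
  refine add_le_add_right (mul_le_mul_of_nonneg_left ?_ (by positivity)) _
  set σ := noiseLevel μ₀ δf δg with hσ
  have hσ0 : 0 ≤ σ := by rw [hσ, noiseLevel]; positivity
  set Q := (μ (k + 1) - μ k) ^ 2
  have hQ : 0 ≤ Q := sq_nonneg _
  have hB : ∀ j, 0 ≤ ∫ ω, ‖avg (𝓢 (j + 1) ω).dir‖ ^ 2 ∂Pr := fun j =>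
    integral_nonneg fun ω => by positivity
  have hsum : ∑ j ∈ Finset.range k, (1 + cl) ^ 2 * lt ^ 2
        * ∫ ω, ‖avg (𝓢 (j + 1) ω).dir‖ ^ 2 ∂Pr
      = (1 + cl) ^ 2 * ∑ j ∈ Finset.range k, lt ^ 2
        * ∫ ω, ‖avg (𝓢 (j + 1) ω).dir‖ ^ 2 ∂Pr := by
    rw [Finset.mul_sum]; exact Finset.sum_congr rfl fun j _ => by ring
  have hsn : 0 ≤ ∑ j ∈ Finset.range k, lt ^ 2 * ∫ ω, ‖avg (𝓢 (j + 1) ω).dir‖ ^ 2 ∂Pr :=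
    Finset.sum_nonneg fun j _ => mul_nonneg (by positivity) (hB j)
  rw [hsum]
  have hdisp := integral_disp_process_nonneg (P := P) (W := W) (γ := γ) (lt := lt) (cl := cl)
    (μ := μ) (init := init) (ξf := ξf) (ξg := ξg) (Pr := Pr)
  have x0 := hdisp 0
  have xk := hdisp k
  have xk1 := hdisp (k + 1)
  have bk := hB k
  clear_value σ Q
  generalize ∑ j ∈ Finset.range k, lt ^ 2 * ∫ ω, ‖avg (𝓢 (j + 1) ω).dir‖ ^ 2 ∂Pr = T at *
  generalize ∫ ω, disp (𝓢 0 ω).pos ∂Pr = X0 at *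
  generalize ∫ ω, disp (𝓢 (k + 1) ω).pos ∂Pr = X1 at *
  generalize ∫ ω, disp (𝓢 k ω).pos ∂Pr = Xk at *
  generalize ∫ ω, ‖avg (𝓢 (k + 1) ω).dir‖ ^ 2 ∂Pr = Bk at *
  have c1 : 12 * σ ≤ C * σ := mul_le_mul_of_nonneg_right hC.twelve_le hσ0
  have c2 : 24 * dirConst L₁ L₂ γ μ₀ ^ 2 * (X1 + Xk) ≤ C * (X1 + Xk) :=
    mul_le_mul_of_nonneg_right hC.dir_le (by linarith)
  have c3 : 12 * dirConst L₁ L₂ γ μ₀ ^ 2 * (1 + cl) ^ 2 * (lt ^ 2 * Bk) ≤ C * (lt ^ 2 * Bk) :=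
    mul_le_mul_of_nonneg_right hC.dir_mix_le (by positivity)
  have c4 : 24 * L₁ ^ 2 * (Q * (Xk + X0)) ≤ C * (Q * (Xk + X0)) :=
    mul_le_mul_of_nonneg_right hC.upper_le (by positivity)
  have c5 : 12 * L₁ ^ 2 * (1 + cl) ^ 2 * (Q * (k * T)) ≤ C * (Q * (k * T)) :=
    mul_le_mul_of_nonneg_right hC.upper_mix_le (by positivity)
  linarith

set_option maxHeartbeats 1000000 in
include hP hWd hρ hcl hO hS hμ in
lemma sum_expected_le (hC : Dominates C L₁ L₂ γ Lθ μ₀ cl)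
    (hcl' : cl ≤ (1 / γ - L₂) / (32 * weightA L₂ γ Lθ * Lθ ^ 2))
    (hFl : ∀ z, Fl ≤ P.upper z) (hanti : Antitone μ) (hμ0 : μ 0 = μ₀)
    (hqs : ∀ N, ∑ k ∈ Finset.range N, (μ (k + 1) - μ k) ^ 2 * (k + 1) ≤ μ₀ ^ 2)
    (hs1 : 128 * C ^ 3 * s ≤ 1) (hs2 : 12 * C * s ≤ decreaseRate cl) (hlt : 0 < lt)
    (hls : lt ≤ s * (1 - connectivity W hW) ^ 4) (N : ℕ) :
    ∑ k ∈ Finset.range (N + 1), ∫ ω, ‖P.gradPenalized γ (μ k) (avg (𝓢 k ω).pos).snd‖ ^ 2 ∂Pr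
      ≤ 64 * C ^ 4 / decreaseRate cl * (Γ / lt + Γ / (1 - connectivity W hW)
        + lt ^ 2 / (1 - connectivity W hW) ^ 4 * ((N + 1 : ℕ) * noiseLevel μ₀ δf δg)
        + lt * ((N + 1 : ℕ) * (noiseLevel μ₀ δf δg / n))) ∧
    ∑ k ∈ Finset.range (N + 1), ∫ ω, disp (𝓢 k ω).pos ∂Pr
      ≤ (64 * C ^ 3 + 768 * C ^ 4 / decreaseRate cl) * (Γ / lt + Γ / (1 - connectivity W hW)
        + lt ^ 2 / (1 - connectivity W hW) ^ 4 * ((N + 1 : ℕ) * noiseLevel μ₀ δf δg)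
        + lt * ((N + 1 : ℕ) * (noiseLevel μ₀ δf δg / n))) := by
  have hμ' : ∀ k, μ k ≤ μ₀ := fun k => hμ0 ▸ hanti (Nat.zero_le k)
  have hμ₀ : 0 ≤ μ₀ := (hμ 0).trans (hμ' 0)
  have hc := decreaseRate_pos hcl
  have hn : (0 : ℝ) < n := by exact_mod_cast hP.one_le
  have hC1 := hC.one_le
  have hC0 : 0 ≤ C := by linarith
  have hσ0 : 0 ≤ noiseLevel μ₀ δf δg := by rw [noiseLevel]; positivity
  have hdisp := integral_disp_process_nonneg (P := P) (W := W) (γ := γ) (lt := lt) (cl := cl)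
    (μ := μ) (init := init) (ξf := ξf) (ξg := ξg) (Pr := Pr)
  have hdisp' := integral_disp_dir_nonneg (P := P) (W := W) (γ := γ) (lt := lt) (cl := cl)
    (μ := μ) (init := init) (ξf := ξf) (ξg := ξg) (Pr := Pr)
  obtain ⟨hΓX, hΓY, hΓd⟩ := le_fullGap (W := W) (lt := lt) (cl := cl) (μ := μ)
    (init := init) (ξf := ξf) (ξg := ξg) (Pr := Pr) (δf := δf) (δg := δg) hP hμ₀ hFl
  have hX0 : ∫ ω, disp (𝓢 0 ω).pos ∂Pr = disp fun i => (init i).toJoint := by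
    simp only [process_zero_pos, integral_const, probReal_univ, one_smul]
  have hV0 := integral_lyap_zero_le (W := W) (lt := lt) (ξf := ξf) (ξg := ξg) (Pr := Pr)
    (init := init) (δf := δf) (δg := δg) hP hC hμ₀ hμ0 hFl
  have hZ0 := initial_heterogeneity_le_gap hW (lt := lt) (init := init) (Fl := Fl) hP hWd hρ hcl hO
    hS hμ hμ' hC hμ0 hFl
  have hΓ0 : 0 ≤ Γ := (by positivity : 0 ≤ δf ^ 2 + δg ^ 2).trans hΓd
  have hY0 : ∫ ω, disp (𝓢 1 ω).dir ∂Pr ≤ C * Γ := hΓY.trans (le_mul_of_one_le_left hΓ0 hC1)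
  have hltc : 3 * (1 + cl) ^ 2 * lyapConst L₁ L₂ γ Lθ μ₀ * lt ≤ decreaseRate cl := by
    have hs : 0 < s := pos_of_mul_pos_left (lt_of_lt_of_le hlt hls) (by positivity)
    have h1 : lt ≤ s := hls.trans (mul_le_of_le_one_right hs.le
      (pow_le_one₀ (by linarith) (by linarith [connectivity_nonneg hW])))
    calc 3 * (1 + cl) ^ 2 * lyapConst L₁ L₂ γ Lθ μ₀ * lt ≤ C * s :=
          mul_le_mul hC.lyap_le h1 hlt.le hC0
      _ ≤ decreaseRate cl := by nlinarith
  -- The state of index k + 1 stores the directions computed in iteration k; hence the shift by one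
  -- in Y and B, but not in X, M, S and V.
  refine sum_le_of_recursions (m := μ₀ ^ 2)
    (Z := disp (mix W fun i => upperDir (gradient (P.localF i)) (init i).toJoint))
    (Y := fun k => ∫ ω, disp (𝓢 (k + 1) ω).dir ∂Pr)
    (B := fun k => ∫ ω, ‖avg (𝓢 (k + 1) ω).dir‖ ^ 2 ∂Pr)
    (M := fun k => ∫ ω, ‖P.meanDir γ (μ k) (avg (𝓢 k ω).pos)‖ ^ 2 ∂Pr)
    (V := fun k => ∫ ω, P.lyap γ (μ k) Fl (avg (𝓢 k ω).pos) ∂Pr)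
    (X := fun k => ∫ ω, disp (𝓢 k ω).pos ∂Pr)
    (S := fun k => ∫ ω, ‖P.gradPenalized γ (μ k) (avg (𝓢 k ω).pos).snd‖ ^ 2 ∂Pr)
    (q := fun k => (μ (k + 1) - μ k) ^ 2)
    hC1 hc hs1 hs2 (by linarith) (by linarith [connectivity_nonneg hW]) hlt hls hσ0 (by positivity)
    hΓ0 hdisp (fun k => hdisp' (k + 1)) (fun k => integral_nonneg fun ω => sq_nonneg _)
    (fun k => integral_nonneg fun ω => sq_nonneg _)
    (fun k => integral_nonneg fun ω => sq_nonneg _)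
    (fun k => integral_nonneg fun ω => hP.lyap_nonneg (hμ k) hFl _) (fun k => sq_nonneg _)
    (disp_nonneg _) ?_ hY0 hV0 hC.penalty_le hZ0 hqs (fun k => ?_) (fun k => ?_) (fun k => ?_)
    (fun k => ?_) N
  · exact hX0.trans_le hΓX
  · refine (expected_disp_pos_succ_le hW hP hWd hρ hcl.le hO hS hμ hμ' k).trans ?_
    have hτ : 0 < 1 - connectivity W hW := by linarith
    refine add_le_add_right (mul_le_mul_of_nonneg_left ?_ (by positivity)) _
    exact mul_le_mul_of_nonneg_right (mul_le_mul_of_nonneg_right hC.mix_le (sq_nonneg _))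
      (hdisp' (k + 1))
  · exact expected_disp_dir_succ_le_of_dominates hW hP hWd hρ hcl hO hS hμ hμ' hC k
  · refine (expected_norm_avg_dir_sq_le hP hWd hcl.le hO hS hμ hμ' k).trans ?_
    have : 3 * dirConst L₁ L₂ γ μ₀ ^ 2 * ∫ ω, disp (𝓢 k ω).pos ∂Pr
        ≤ C * ∫ ω, disp (𝓢 k ω).pos ∂Pr :=
      mul_le_mul_of_nonneg_right (by linarith [hC.dir_le, sq_nonneg (dirConst L₁ L₂ γ μ₀)])
        (hdisp k)
    linarith
  · refine (expected_lyap_succ_le hP hWd hcl hO hS hμ hμ' hcl' hFl hanti hlt.le hc (min_le_left _ _)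
      (min_le_right _ _) hltc k).trans ?_
    have c1 : (41 * (1 + cl) ^ 2 / (4 * decreaseRate cl) + decreaseRate cl)
        * dirConst L₁ L₂ γ μ₀ ^ 2 * (lt * ∫ ω, disp (𝓢 k ω).pos ∂Pr)
        ≤ C * (lt * ∫ ω, disp (𝓢 k ω).pos ∂Pr) :=
      mul_le_mul_of_nonneg_right hC.lyap_disp_le (mul_nonneg hlt.le (hdisp k))
    have c2 : 3 * (1 + cl) ^ 2 * lyapConst L₁ L₂ γ Lθ μ₀ * (lt ^ 2 * (noiseLevel μ₀ δf δg / n))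
        ≤ C * (lt ^ 2 * (noiseLevel μ₀ δf δg / n)) :=
      mul_le_mul_of_nonneg_right hC.lyap_le (by positivity)
    linarith

end Rate

/-- The average over the iterations of the bound of `sum_expected_le`, in terms of the number of
agents and iterations. -/
lemma rate_bound {cθ s τ μ₀ δf δg G : ℝ} {n K : ℕ} (hcθ : 0 < cθ) (hs : 0 < s) (hτ : 0 < τ)
    (hτ' : τ ≤ 1) (hn : 1 ≤ n) (hK : 1 ≤ K) (hG : δf ^ 2 + δg ^ 2 ≤ G)
    (hl : rate cθ n K ≤ s * τ ^ 4) :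
    1 / (K : ℝ) * (G / rate cθ n K + G / τ + rate cθ n K ^ 2 / τ ^ 4 * (K * noiseLevel μ₀ δf δg)
        + rate cθ n K * (K * (noiseLevel μ₀ δf δg / n)))
      ≤ ((1 + s) / cθ + cθ ^ 2 * (3 * μ₀ ^ 2 + 6) + cθ * (3 * μ₀ ^ 2 + 6))
        * (G / Real.sqrt (n * K) + n * (δf ^ 2 + δg ^ 2) / (τ ^ 4 * K)) := by
  have hn0 : (0 : ℝ) < n := by exact_mod_cast hn
  have hK0 : (0 : ℝ) < K := by exact_mod_cast hK
  have hd : 0 ≤ δf ^ 2 + δg ^ 2 := by positivity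
  set d := δf ^ 2 + δg ^ 2 with hdd
  have hG0 : 0 ≤ G := hd.trans hG
  rw [Real.sqrt_mul hn0.le]
  have hrn := Real.sqrt_pos.2 hn0
  have hrK := Real.sqrt_pos.2 hK0
  have sn := Real.sq_sqrt hn0.le
  have sK := Real.sq_sqrt hK0.le
  rw [noiseLevel, ← hdd]
  unfold rate at hl ⊢
  set a := Real.sqrt n
  set b := Real.sqrt K
  set q := 3 * μ₀ ^ 2 + 6 with hq
  have hq0 : 0 < q := by positivity
  clear_value a b q d
  rw [← sn, ← sK]
  -- Since λ ≤ sτ⁴ ≤ sτ, the term G/τ is dominated by the leading term G/λ and leaves no power of τ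
  -- behind.
  have h1 : G / τ ≤ s * (G / (cθ * a / b)) := by
    have h4 : τ ^ 4 ≤ τ := by
      have := pow_le_pow_of_le_one hτ.le hτ' (show 1 ≤ 4 by norm_num)
      simpa using this
    have h5 : cθ * a / b ≤ s * τ := hl.trans (by gcongr)
    rw [← mul_div_assoc, div_le_div_iff₀ hτ (by positivity)]
    nlinarith
  have e1 : 1 / b ^ 2 * (G / (cθ * a / b)) = 1 / cθ * (G / (a * b)) := by field_simp
  -- The tracking noise lacks the factor 1/n and becomes the term nσ²/(τ⁴K); in `e3` the averaged
  -- noise has this factor and joins the term of order 1/√(nK).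
  have e2 : 1 / b ^ 2 * ((cθ * a / b) ^ 2 / τ ^ 4 * (b ^ 2 * (q * d)))
      = cθ ^ 2 * q * (a ^ 2 * d / (τ ^ 4 * b ^ 2)) := by field_simp
  have e3 : 1 / b ^ 2 * (cθ * a / b * (b ^ 2 * (q * d / a ^ 2)))
      = cθ * q * (d / (a * b)) := by field_simp
  have h2 : d / (a * b) ≤ G / (a * b) := by gcongr
  have h3 : 0 ≤ a ^ 2 * d / (τ ^ 4 * b ^ 2) := by positivity
  have h4 : 0 ≤ G / (a * b) := by positivity
  have h1' := mul_le_mul_of_nonneg_left h1 (by positivity : 0 ≤ 1 / b ^ 2)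
  have e4 : 1 / b ^ 2 * (s * (G / (cθ * a / b))) = s / cθ * (G / (a * b)) := by
    rw [mul_left_comm, e1]; ring
  rw [mul_add, mul_add, mul_add, e1, e2, e3]
  rw [e4] at h1'
  have h5 : cθ * q * (d / (a * b)) ≤ cθ * q * (G / (a * b)) := by gcongr
  have h6 : 0 ≤ ((1 + s) / cθ + cθ * q) * (a ^ 2 * d / (τ ^ 4 * b ^ 2)) := by positivity
  have h7 : 0 ≤ cθ ^ 2 * q * (G / (a * b)) := by positivity
  have e5 : (1 + s) / cθ = 1 / cθ + s / cθ := by ring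
  rw [e5] at h6 ⊢
  linarith

end SunDSBO

/-! ### Choice of the constants and the final bounds. -/

theorem mainTheorem6
    (L₁ L₂ γ μ₀ p Lθ cl : ℝ) (hL₁ : 0 ≤ L₁) (hL₂ : 0 < L₂)
    (hγ : 0 < γ) (hγ' : γ < 1 / (2 * L₂)) (hμ₀ : 0 < μ₀) (hp : 0 ≤ p) (hp' : p < 1 / 4)
    (hLθ : 0 < Lθ) (hcl : 0 < cl)
    (hcl' : cl ≤ (1 / γ - L₂) / (32 * SunDSBO.weightA L₂ γ Lθ * Lθ ^ 2)) :
    ∃ s > 0, ∀ cθ : ℝ, 0 < cθ → ∃ A > 0,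
      ∀ (n dx dy : ℕ) (Ξf Ξg Ω : Type*)
        [MeasurableSpace Ξf] [MeasurableSpace Ξg] [MeasurableSpace Ω]
        (Pr : MeasureTheory.Measure Ω) [MeasureTheory.IsProbabilityMeasure Pr]
        (P : SunDSBO.Problem n dx dy Ξf Ξg) (δf δg Fl : ℝ)
        (ξf : ℕ → Fin n → Ω → Ξf) (ξg : ℕ → Fin n → Ω → Ξg)
        (W : Matrix (Fin n) (Fin n) ℝ) (hW : W.IsHermitian)
        (init : Fin n → SunDSBO.Triple dx dy) (K : ℕ),
        1 ≤ n → 1 ≤ K → 0 ≤ δf → 0 ≤ δg →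
        (∀ z, Fl ≤ P.upper z) →
        P.Smooth L₁ L₂ → P.Oracle δf δg → P.Sampling Pr ξf ξg →
        (∀ z z', ‖P.thetaStar γ z - P.thetaStar γ z'‖ ≤ Lθ * ‖z - z'‖) →
        W ∈ doublyStochastic ℝ (Fin n) → SunDSBO.connectivity W hW < 1 →
        SunDSBO.rate cθ n K ≤ s * (1 - SunDSBO.connectivity W hW) ^ 4 →
        let ρ : ℝ := SunDSBO.connectivity W hW
        let μ : ℕ → ℝ := SunDSBO.penalty μ₀ p
        let lt : ℝ := SunDSBO.rate cθ n K
        let S : ℕ → Ω → SunDSBO.State n dx dy := fun k ω =>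
          P.run W γ lt (cl * lt) μ init (fun m i => ξf m i ω) (fun m i => ξg m i ω) k
        let stat : ℕ → Ω → ℝ := fun k ω =>
          ‖gradient (P.penalized γ (μ k)) (SunDSBO.meanPoint (S k ω).v)‖ ^ 2
        let cons : ℕ → Ω → ℝ := fun k ω => SunDSBO.dispersion (S k ω).v
        let C₂ : ℝ := P.initialGap γ μ₀ Fl init
          + (∫ ω, SunDSBO.dispersion (S 1 ω).D ∂Pr) + δf ^ 2 + δg ^ 2
        (∀ k, Differentiable ℝ (P.penalized γ (μ k))) ∧
        (∀ k < K, MeasureTheory.Integrable (stat k) Pr ∧ MeasureTheory.Integrable (cons k) Pr) ∧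
        1 / (K : ℝ) * ∑ k ∈ Finset.range K, ∫ ω, stat k ω ∂Pr
          ≤ A * (C₂ / Real.sqrt ((n : ℝ) * K))
            + A * ((n : ℝ) * (δf ^ 2 + δg ^ 2) / ((1 - ρ) ^ 4 * K)) ∧
        1 / (K : ℝ) * ∑ k ∈ Finset.range K, ∫ ω, cons k ω ∂Pr
          ≤ A * (C₂ / Real.sqrt K)
            + A * ((n : ℝ) ^ (3 / 2 : ℝ) * (δf ^ 2 + δg ^ 2) / ((1 - ρ) ^ 4 * K)) := by
  have hc := SunDSBO.decreaseRate_pos hcl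
  have hC := SunDSBO.masterConst_dominates hL₁ hL₂ hγ hγ' hLθ hμ₀.le hcl
  set C := SunDSBO.masterConst L₁ L₂ γ Lθ μ₀ cl
  set c := SunDSBO.decreaseRate cl
  have hC0 : 0 < C := by linarith [hC.one_le]
  -- The two entries are exactly the absorption conditions of `sum_le_of_recursions`. The threshold
  -- does not involve cθ, which enters only through A'.
  set s := min (1 / (128 * C ^ 3)) (c / (12 * C)) with hs
  have hs0 : 0 < s := lt_min (by positivity) (by positivity)
  have hs1 : 128 * C ^ 3 * s ≤ 1 := by
    rw [← le_div_iff₀' (by positivity)]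
    exact min_le_left _ _
  have hs2 : 12 * C * s ≤ c := by
    rw [← le_div_iff₀' (by positivity)]
    exact min_le_right _ _
  refine ⟨s, hs0, fun cθ hcθ => ?_⟩
  set A' := (1 + s) / cθ + cθ ^ 2 * (3 * μ₀ ^ 2 + 6) + cθ * (3 * μ₀ ^ 2 + 6) with hA'
  have hA'0 : 0 < A' := by positivity
  set A₁ := 64 * C ^ 4 / c
  set A₂ := 64 * C ^ 3 + 768 * C ^ 4 / c
  have hA₁ : 0 < A₁ := by positivity
  have hA₂ : 0 < A₂ := by positivity
  -- A₁ belongs to the stationarity bound, A₂ to the dispersion bound, and A' to the conversion into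
  -- rates; the sum serves both claims.
  refine ⟨(A₁ + A₂) * A', by positivity, ?_⟩
  intro n dx dy Ξf Ξg Ω _ _ _ Pr _ P δf δg Fl ξf ξg W hW init K hn hK _ _ hFl hSm hO hS hLip hWd hρ
    hrate ρ μ lt S stat cons C₂
  have hP : P.Regular L₁ L₂ γ Lθ := ⟨hSm, hn, hL₁, hL₂, hγ, hγ', hLθ, hLip⟩
  have hμ : ∀ k, 0 ≤ μ k := SunDSBO.penalty_nonneg hμ₀.le
  have hμ' : ∀ k, μ k ≤ μ₀ := SunDSBO.penalty_le hμ₀.le hp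
  have hgrad := fun k => SunDSBO.hasGradientAt_penalized hSm hn hL₂ hγ hγ' hLθ hLip (μ k)
  have hstat : ∀ k ω, stat k ω = ‖P.gradPenalized γ (μ k)
      (SunDSBO.avg (P.process W γ lt cl μ init ξf ξg k ω).pos).snd‖ ^ 2 := fun k ω => by
    change ‖gradient (P.penalized γ (μ k)) (SunDSBO.meanPoint (S k ω).v)‖ ^ 2 = _
    rw [(hgrad k _).gradient, ← SunDSBO.avg_toJoint_snd]
    rfl
  have hcons : ∀ k ω, cons k ω = SunDSBO.disp (P.process W γ lt cl μ init ξf ξg k ω).pos :=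
    fun k ω => SunDSBO.dispersion_eq_disp _
  have hn0 : (0 : ℝ) < n := by exact_mod_cast hn
  have hK0 : (0 : ℝ) < K := by exact_mod_cast hK
  have hn1 : (1 : ℝ) ≤ n := by exact_mod_cast hn
  have hlt : 0 < lt := by
    change 0 < cθ * Real.sqrt n / Real.sqrt K
    positivity
  have hτ : 0 < 1 - ρ := sub_pos.2 hρ
  have hτ' : 1 - ρ ≤ 1 := by linarith [SunDSBO.connectivity_nonneg hW]
  have hd : 0 ≤ δf ^ 2 + δg ^ 2 := by positivity
  obtain ⟨-, -, hG⟩ := SunDSBO.le_fullGap (W := W) (lt := lt) (cl := cl) (μ := μ) (init := init)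
    (ξf := ξf) (ξg := ξg) (Pr := Pr) (δf := δf) (δg := δg) hP hμ₀.le hFl
  change δf ^ 2 + δg ^ 2 ≤ C₂ at hG
  have hC₂ : 0 ≤ C₂ := hd.trans hG
  have hbound := SunDSBO.rate_bound (μ₀ := μ₀) hcθ hs0 hτ hτ' hn hK hG hrate
  rw [← hA'] at hbound
  obtain ⟨N, rfl⟩ : ∃ N, K = N + 1 := ⟨K - 1, by omega⟩
  obtain ⟨h1, h2⟩ := SunDSBO.sum_expected_le (δf := δf) (δg := δg) (Fl := Fl) (lt := lt)
    (init := init) hW hP hWd hρ hcl hO hS hμ hC hcl' hFl (SunDSBO.penalty_antitone hμ₀.le hp)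
    (SunDSBO.penalty_zero μ₀ p) (SunDSBO.sum_penalty_sub_sq_le hμ₀.le hp (by linarith)) hs1 hs2
    hlt hrate N
  have hT : 0 ≤ C₂ / Real.sqrt (n * (N + 1 : ℕ)) := by positivity
  have hU : 0 ≤ n * (δf ^ 2 + δg ^ 2) / ((1 - ρ) ^ 4 * (N + 1 : ℕ)) := by positivity
  have hav : ∀ {a x R : ℝ}, 0 < a → x ≤ a * R →
      1 / ((N + 1 : ℕ) : ℝ) * R ≤ A' * (C₂ / Real.sqrt (n * (N + 1 : ℕ))
        + n * (δf ^ 2 + δg ^ 2) / ((1 - ρ) ^ 4 * (N + 1 : ℕ))) → a ≤ A₁ + A₂ →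
      1 / ((N + 1 : ℕ) : ℝ) * x ≤ (A₁ + A₂) * A' * (C₂ / Real.sqrt (n * (N + 1 : ℕ)))
        + (A₁ + A₂) * A' * (n * (δf ^ 2 + δg ^ 2) / ((1 - ρ) ^ 4 * (N + 1 : ℕ))) := by
    intro a x R ha hx hR haA
    have g1 := mul_le_mul_of_nonneg_left hx (by positivity : (0 : ℝ) ≤ 1 / ((N + 1 : ℕ) : ℝ))
    have g2 := mul_le_mul_of_nonneg_left hR ha.le
    have g3 := mul_le_mul_of_nonneg_right haA (mul_nonneg hA'0.le (add_nonneg hT hU))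
    linarith
  refine ⟨fun k z => (hgrad k z).differentiableAt, fun k _ => ⟨?_, ?_⟩, ?_, ?_⟩
  · simp only [funext (hstat k)]
    exact SunDSBO.integrable_gradPenalized_sq hP hcl hO hS hμ hμ' k
  · simp only [funext (hcons k)]
    exact SunDSBO.integrable_disp (SunDSBO.memLp_process hP hO hS hμ hμ' hcl.le k).1
  · simp only [hstat]
    exact hav hA₁ h1 hbound (by linarith)
  · simp only [hcons]
    -- The dispersion satisfies a bound of the same form as the stationarity measure. The stated one
    -- is weaker, because n ≥ 1 gives √K ≤ √(nK) and n ≤ n^{3/2}.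
    refine (hav hA₂ h2 hbound (by linarith)).trans ?_
    have hn2 : (n : ℝ) ≤ (n : ℝ) ^ (3 / 2 : ℝ) := by
      conv_lhs => rw [← Real.rpow_one (n : ℝ)]
      exact Real.rpow_le_rpow_of_exponent_le hn1 (by norm_num)
    have hr : Real.sqrt ((N + 1 : ℕ) : ℝ) ≤ Real.sqrt (n * (N + 1 : ℕ)) :=
      Real.sqrt_le_sqrt (le_mul_of_one_le_left hK0.le hn1)
    have hr0 : 0 < Real.sqrt ((N + 1 : ℕ) : ℝ) := Real.sqrt_pos.2 hK0
    gcongr
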